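/- **Conventions.** Let $S$ be a ribbon category with tensor product $\otimes$, unit $\mathbf 1$, braiding $c_{U,V}:U\otimes V\to V\otimes U$, twist $\theta$, dual objects $U^\vee$ with $\mathrm{coev}_U:\mathbf 1\to U\otimes U^\vee$ and $\mathrm{ev}_U:U^\vee\otimes U\to\mathbf 1$, and natural isomorphism $\delta_U=\big((\mathrm{ev}_U\circ c_{U,U^\vee}\circ(\theta_U\otimes \mathrm{id}))\otimes \mathrm{id}\big)\circ(\mathrm{id}_U\otimes \mathrm{coev}_{U^\vee}):U\to U^{\vee\vee}$. Associators and unitors of $S$ are suppressed in the formulas. Let $H$ be a Hopf algebra in $S$ with product $\mu$, unit $\eta$, coproduct $\Delta$, counit $\varepsilon$ and invertible antipode $S_H$. The dual $H^\vee$ is a Hopf algebra with structure maps the duals of those of $H$, where $(U\otimes V)^\vee= V^\vee\otimes U^\vee$. For $x:\mathbf 1\to H$ write ${}_xM=\mu\circ(x\otimes \mathrm{id})$, $M_x=\mu\circ(\mathrm{id}\otimes x)$ and, if $x$ has a multiplicative inverse $x^{-1}$, $\mathrm{Ad}_x={}_xM\circ M_{x^{-1}}$. For $H$-modules $(A,\rho_A)$,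 $(B,\rho_B)$ put $\rho^{H\otimes H}_{A\otimes B}=(\rho_A\otimes\rho_B)\circ(\mathrm{id}_H\otimes c_{H,A}\otimes \mathrm{id}_B)$; $A\otimes B$ is an $H$-module via $\rho^{H\otimes H}_{A\otimes B}\circ(\Delta\otimes \mathrm{id})$, and $\mathbf 1$ is an $H$-module via $\varepsilon$; $\mathrm{Rep}_S(H)$ is the category of left $H$-modules in $S$. **The category $C$.** Let $C=C_0\sqcup C_1$ be the disjoint union of the categories $C_0=\mathrm{Rep}_S(H)$ and $C_1=S$, with tensor product $A\otimes_C B$ on objects and morphisms given by the tensor product of $\mathrm{Rep}_S(H)$ if $A,B\in C_0$ (in $C_0$); by that of $S$ (forgetting the action) if exactly one of $A,B$ is in $C_0$ (in $C_1$); and by $H\otimes A\otimes B\in C_0$ with $H$ acting by multiplication on the factor $H$, respectively $\mathrm{id}_H\otimes f\otimes g$ on morphisms, if $A,B\in C_1$. The unit is the trivial module $\mathbf 1\in C_0$, with the unitors of $S$. **Associators.** For $\gamma,\delta:\mathbf 1\to H\otimes H$ and $\phi:H\to H$ let $\alpha_{A,B,C}:A\otimes_C(B\otimes_C C)\to(A\otimes_C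 B)\otimes_C C$ be, with upper indices giving the degrees: * $\alpha_{A^0,B^0,C^0}=\mathrm{id}$, $\alpha_{A^0,B^0,C^1}=\mathrm{id}$, $\alpha_{A^1,B^0,C^0}=\mathrm{id}$ (that is, the associator of $S$); * $\alpha_{A^0,B^1,C^0}=(\mathrm{id}_A\otimes c_{C,B})\circ\big[\big(\rho^{H\otimes H}_{A\otimes C}\circ(\gamma\otimes \mathrm{id}_{A\otimes C})\big)\otimes \mathrm{id}_B\big]\circ(\mathrm{id}_A\otimes c_{C,B}^{-1})$; * $\alpha_{A^0,B^1,C^1}=\big[(\mathrm{id}_H\otimes\rho_A)\circ\big(((\mathrm{id}_H\otimes S_H^{-1})\circ c_{H,H}^{-1}\circ\Delta)\otimes \mathrm{id}_A\big)\circ c_{H,A}^{-1}\big]\otimes \mathrm{id}_B\otimes \mathrm{id}_C$; * $\alpha_{A^1,B^0,C^1}=\big[(\mu\otimes \mathrm{id}_A\otimes\rho_B)\circ(\mathrm{id}_{H\otimes H}\otimes c_{H,A}\otimes \mathrm{id}_B)\circ(\mathrm{id}_H\otimes\delta\otimes \mathrm{id}_A\otimes \mathrm{id}_B)\big]\otimes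 \mathrm{id}_C$; * $\alpha_{A^1,B^1,C^0}=(\mathrm{id}_H\otimes \mathrm{id}_{A\otimes B}\otimes\rho_C)\circ(\mathrm{id}_H\otimes c_{H,A\otimes B}\otimes \mathrm{id}_C)\circ(\Delta\otimes \mathrm{id}_{A\otimes B}\otimes \mathrm{id}_C)$; * $\alpha_{A^1,B^1,C^1}=\big[(\phi\otimes \mathrm{id}_A)\circ c_{H,A}^{-1}\big]\otimes \mathrm{id}_B\otimes \mathrm{id}_C$. **Theorem 1.** (i) Let $\Gamma:H^\vee\to H$ and $\lambda:H\to\mathbf 1$ be morphisms in $S$ such that a) $\Gamma$ is an isomorphism of Hopf algebras; b) $\lambda$ is a right cointegral, $(\lambda\otimes \mathrm{id}_H)\circ\Delta=\eta\circ\lambda$, there is $g:\mathbf 1\to H$ with $(\mathrm{id}_H\otimes\lambda)\circ\Delta=g\circ\lambda$, and $(\lambda\otimes\lambda)\circ(\mathrm{id}_H\otimes\Gamma)\circ\mathrm{coev}_H=\mathrm{id}_{\mathbf 1}$ (then $g$ is unique and has a multiplicative inverse); c) $\Gamma^\vee=\delta_H\circ\theta_H^{-1}\circ S_H^2\circ\mathrm{Ad}_{g^{-1}}\circ\Gamma$.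 Then, with $$\gamma=(\mathrm{id}_H\otimes (S_H^{-1}\circ\Gamma))\circ\mathrm{coev}_H,\qquad \delta=(\mathrm{id}_H\otimes(M_g\circ S_H^2))\circ\gamma,\qquad \phi=(\mathrm{id}_H\otimes\lambda)\circ(S_H\otimes\mu)\circ(\gamma\otimes \mathrm{id}_H),$$ the morphisms $\alpha_{A,B,C}$ above are natural isomorphisms in $C$ and make $(C,\otimes_C,\mathbf 1)$ a monoidal category, denoted $C(H,\Gamma,\lambda)$. (ii) Let $H'$ be a Hopf algebra in $S$ with invertible antipode, $\varphi:H'\to H$ an isomorphism of Hopf algebras, $\Gamma'=\varphi^{-1}\circ\Gamma\circ(\varphi^{-1})^\vee$ and $\lambda'=\lambda\circ\varphi$. Then $\Gamma',\lambda'$ satisfy a)–c) for $H'$, with $g'=\varphi^{-1}\circ g$, and $C(H,\Gamma,\lambda)$ and $C(H',\Gamma',\lambda')$ are equivalent as monoidal categories. -/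

import Mathlib

open CategoryTheory MonoidalCategory

universe v u

/-! ### Ribbon categories

Duals: `Xᘁ` is Mathlib's right dual, with `η_ X Xᘁ : 𝟙_ S ⟶ X ⊗ Xᘁ` (coevaluation) and
`ε_ X Xᘁ : Xᘁ ⊗ X ⟶ 𝟙_ S` (evaluation); `rightAdjointMate f` is the dual `fᘁ : Yᘁ ⟶ Xᘁ` of a
morphism `f : X ⟶ Y`. -/

/-- A ribbon category: a braided category with duals, together with a twist `θ`, i.e. a natural
automorphism of the identity functor with `θ_{X ⊗ Y} = c_{Y,X} ∘ c_{X,Y} ∘ (θ_X ⊗ θ_Y)` and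
`θ_{X^∨} = (θ_X)^∨`. -/
class RibbonCategory (S : Type u) [Category.{v} S] [MonoidalCategory S] [BraidedCategory S]
    [RightRigidCategory S] where
  /-- The twist isomorphisms. -/
  twist (X : S) : X ≅ X
  twist_naturality {X Y : S} (f : X ⟶ Y) : f ≫ (twist Y).hom = (twist X).hom ≫ f
  twist_tensor (X Y : S) :
    (twist (X ⊗ Y)).hom =
      ((twist X).hom ⊗ₘ (twist Y).hom) ≫ (β_ X Y).hom ≫ (β_ Y X).hom
  twist_dual (X : S) : (twist (Xᘁ : S)).hom = rightAdjointMate (twist X).hom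

namespace HopfExt

section Defs

variable {S : Type u} [Category.{v} S] [MonoidalCategory S] [BraidedCategory S]

/-- The natural monoidal isomorphism `δ_X : X ⟶ X^∨^∨` of a ribbon category:
`δ_X = ((ev_X ∘ c_{X,X^∨} ∘ (θ_X ⊗ id)) ⊗ id) ∘ (id ⊗ coev_{X^∨})`. -/
def toDoubleDual [RightRigidCategory S] [RibbonCategory S] (X : S) : X ⟶ ((Xᘁ : S)ᘁ : S) :=
  (ρ_ X).inv ≫ X ◁ η_ (Xᘁ : S) ((Xᘁ : S)ᘁ : S) ≫ (α_ X (Xᘁ : S) ((Xᘁ : S)ᘁ : S)).inv ≫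
    ((RibbonCategory.twist X).hom ▷ (Xᘁ : S) ≫ (β_ X (Xᘁ : S)).hom ≫ ε_ X (Xᘁ : S)) ▷
      ((Xᘁ : S)ᘁ : S) ≫ (λ_ ((Xᘁ : S)ᘁ : S)).hom

/-! ### The monoidal product on modules over a Hopf algebra

`Mod S H` is the category of (left) `H`-modules in `S`. -/

variable {H : S} [HopfObj H]

/-- The action `H ⊗ M ⟶ M` of a module. -/
abbrev act (M : Mod S H) : H ⊗ M.X ⟶ M.X := ModObj.smul (M := H) (X := M.X)

lemma act_one (M : Mod S H) : MonObj.one ▷ M.X ≫ act M = (λ_ M.X).hom :=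
  ModObj.one_smul_self H M.X

lemma act_mul (M : Mod S H) :
    MonObj.mul ▷ M.X ≫ act M = (α_ H H M.X).hom ≫ H ◁ act M ≫ act M :=
  ModObj.mul_smul_self H M.X

lemma act_hom {M N : Mod S H} (f : M ⟶ N) : act M ≫ f.hom = H ◁ f.hom ≫ act N :=
  f.isModHom.smul_hom

/-- A module from an object and an action morphism. -/
abbrev mkMod (X : S) (r : H ⊗ X ⟶ X) (h1 : MonObj.one ▷ X ≫ r = (λ_ X).hom)
    (h2 : MonObj.mul ▷ X ≫ r = (α_ H H X).hom ≫ H ◁ r ≫ r) : Mod S H :=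
  letI : ModObj H X := ⟨r, h1, h2⟩
  ⟨X⟩

/-- A module morphism from a morphism commuting with the actions. -/
abbrev mkHom {M N : Mod S H} (f : M.X ⟶ N.X) (h : act M ≫ f = H ◁ f ≫ act N) : M ⟶ N :=
  Mod.Hom.mk' f h

/-- The action of `H ⊗ H` on `M ⊗ N`: `(ρ_M ⊗ ρ_N) ∘ (id_H ⊗ c_{H,M} ⊗ id_N)`. -/
def act₂ (M N : Mod S H) : (H ⊗ H) ⊗ (M.X ⊗ N.X) ⟶ M.X ⊗ N.X :=
  tensorμ H H M.X N.X ≫ (act M ⊗ₘ act N)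

lemma act₂_one (M N : Mod S H) :
    (MonObj.one : 𝟙_ S ⟶ H ⊗ H) ▷ (M.X ⊗ N.X) ≫ act₂ M N = (λ_ (M.X ⊗ N.X)).hom := by
  rw [MonObj.tensorObj.one_def, act₂, comp_whiskerRight, Category.assoc,
    tensorμ_natural_left_assoc, tensorHom_comp_tensorHom, act_one, act_one,
    ← tensor_left_unitality]

lemma act₂_mul (M N : Mod S H) :
    (MonObj.mul : (H ⊗ H) ⊗ (H ⊗ H) ⟶ H ⊗ H) ▷ (M.X ⊗ N.X) ≫ act₂ M N =
      (α_ (H ⊗ H) (H ⊗ H) (M.X ⊗ N.X)).hom ≫ (H ⊗ H) ◁ act₂ M N ≫ act₂ M N := by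
  rw [MonObj.tensorObj.mul_def, act₂, comp_whiskerRight, Category.assoc,
    tensorμ_natural_left_assoc, tensorHom_comp_tensorHom, act_mul, act_mul,
    whiskerLeft_comp, Category.assoc, tensorμ_natural_right_assoc, tensorHom_comp_tensorHom,
    ← tensorHom_comp_tensorHom, ← tensor_associativity_assoc]

/-- The tensor product of two modules: `M ⊗ N` with `H` acting through the coproduct. -/
def tensorMod (M N : Mod S H) : Mod S H :=
  mkMod (M.X ⊗ N.X) (ComonObj.comul ▷ (M.X ⊗ N.X) ≫ act₂ M N)
    (by
      rw [← comp_whiskerRight_assoc, BimonObj.one_comul, act₂_one])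
    (by
      have h := BimonObj.mul_comul H
      rw [← MonObj.tensorObj.mul_def] at h
      rw [← comp_whiskerRight_assoc, h, comp_whiskerRight, Category.assoc, act₂_mul,
        MonoidalCategory.tensorHom_def', comp_whiskerRight, Category.assoc,
        associator_naturality_left_assoc, associator_naturality_middle_assoc,
        ← whisker_exchange_assoc, whiskerLeft_comp, Category.assoc])

/-- `X ↦ H ⊗ X`, with `H` acting by multiplication. -/
def freeMod (X : S) : Mod S H :=
  mkMod (H ⊗ X) ((α_ H H X).inv ≫ MonObj.mul ▷ X)
    (by
      have h := MonObj.one_mul H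
      rw [whiskerRight_tensor_assoc]
      simp only [Iso.hom_inv_id_assoc]
      rw [← comp_whiskerRight, h]
      simp)
    (by
      have h := MonObj.mul_assoc H
      rw [whiskerRight_tensor_assoc]
      simp only [Iso.hom_inv_id_assoc]
      rw [← comp_whiskerRight, h]
      simp)

/-- The tensor unit `𝟙_ S`, with `H` acting through the counit. -/
def trivMod : Mod S H :=
  mkMod (𝟙_ S) (ComonObj.counit ▷ 𝟙_ S ≫ (λ_ (𝟙_ S)).hom)
    (by
      rw [← comp_whiskerRight_assoc, BimonObj.one_counit]; simp)
    (by
      have h := BimonObj.mul_counit H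
      rw [Comon.tensorObj_counit, MonoidalCategory.tensorHom_def'] at h
      rw [← comp_whiskerRight_assoc, h]
      simp [unitors_equal])

/-- The tensor product of two module morphisms. -/
def tensorModHom {M M' N N' : Mod S H} (f : M ⟶ M') (g : N ⟶ N') :
    tensorMod M N ⟶ tensorMod M' N' :=
  mkHom (M := tensorMod M N) (N := tensorMod M' N') (f.hom ⊗ₘ g.hom)
    (by
      change (ComonObj.comul ▷ (M.X ⊗ N.X) ≫ act₂ M N) ≫ (f.hom ⊗ₘ g.hom) =
        H ◁ (f.hom ⊗ₘ g.hom) ≫ ComonObj.comul ▷ (M'.X ⊗ N'.X) ≫ act₂ M' N'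
      rw [whisker_exchange_assoc, act₂, act₂, tensorμ_natural_right_assoc,
        tensorHom_comp_tensorHom, ← act_hom, ← act_hom]
      simp)

/-- The module morphism `id_H ⊗ f`. -/
def freeModHom {X Y : S} (f : X ⟶ Y) : (freeMod X : Mod S H) ⟶ freeMod Y :=
  mkHom (M := freeMod X) (N := freeMod Y) (H ◁ f)
    (by
      change ((α_ H H X).inv ≫ MonObj.mul ▷ X) ≫ H ◁ f =
        H ◁ H ◁ f ≫ (α_ H H Y).inv ≫ MonObj.mul ▷ Y
      rw [Category.assoc, ← whisker_exchange]
      simp)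

variable (H) in
/-- The category `C = C₀ + C₁` with `C₀ = Rep_S(H)` (summand `inl`) and `C₁ = S` (summand `inr`):
the disjoint union of the two categories. -/
abbrev Ext : Type (max u v) := Mod S H ⊕ S

variable (H) in
/-- The functor `C ⥤ S` which is the forgetful functor on `C₀` and the identity on `C₁`. -/
def total : Ext H ⥤ S := (Mod.forget (D := S) H).sum' (𝟭 S)

/-- The tensor product of objects of `C`. -/
def tensorO : Ext H → Ext H → Ext H
  | .inl A, .inl B => .inl (tensorMod A B)
  | .inl A, .inr B => .inr (A.X ⊗ B)
  | .inr A, .inl B => .inr (A ⊗ B.X)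
  | .inr A, .inr B => .inl (freeMod (A ⊗ B))

/-- The tensor product of morphisms of `C`. -/
def tensorM {A A' B B' : Ext H} (f : A ⟶ A') (g : B ⟶ B') : tensorO A B ⟶ tensorO A' B' :=
  match A, A', B, B', f, g with
  | .inl _, .inl _, .inl _, .inl _, f, g => ULift.up (tensorModHom f.down g.down)
  | .inl _, .inl _, .inr _, .inr _, f, g => ULift.up (f.down.hom ⊗ₘ g.down)
  | .inr _, .inr _, .inl _, .inl _, f, g => ULift.up (f.down ⊗ₘ g.down.hom)
  | .inr _, .inr _, .inr _, .inr _, f, g => ULift.up (freeModHom (f.down ⊗ₘ g.down))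

variable (H) in
/-- The tensor unit of `C`: the trivial module in `C₀`. -/
def unitO : Ext H := .inl trivMod

/-- The underlying morphism of the left unitor. -/
def leftUnitorM : (A : Ext H) → ((total H).obj (tensorO (unitO H) A) ⟶ (total H).obj A)
  | .inl A => (λ_ A.X).hom
  | .inr A => (λ_ A).hom

/-- The underlying morphism of the right unitor. -/
def rightUnitorM : (A : Ext H) → ((total H).obj (tensorO A (unitO H)) ⟶ (total H).obj A)
  | .inl A => (ρ_ A.X).hom
  | .inr A => (ρ_ A).hom

/-- The tensor product on `C` together with candidates for the coherence isomorphisms. -/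
abbrev extStruct
    (a : ∀ A B C : Ext H, tensorO (tensorO A B) C ≅ tensorO A (tensorO B C))
    (l : ∀ A : Ext H, tensorO (unitO H) A ≅ A) (r : ∀ A : Ext H, tensorO A (unitO H) ≅ A) :
    MonoidalCategoryStruct (Ext H) where
  tensorObj := tensorO
  tensorHom := tensorM
  whiskerLeft A _ _ f := tensorM (𝟙 A) f
  whiskerRight f B := tensorM f (𝟙 B)
  tensorUnit := unitO H
  associator := a
  leftUnitor := l
  rightUnitor := r

/-! ### The associativity isomorphisms in terms of `gam, del : 𝟙_ S ⟶ H ⊗ H` and `phi : H ⟶ H` -/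

/-- `A ⊗ C ⟶ A ⊗ C`: the action of an element of `H ⊗ H`. -/
def actBy (x : 𝟙_ S ⟶ H ⊗ H) (A C : Mod S H) : A.X ⊗ C.X ⟶ A.X ⊗ C.X :=
  (λ_ (A.X ⊗ C.X)).inv ≫ x ▷ (A.X ⊗ C.X) ≫ act₂ A C

/-- `A ⊗ H ⟶ H ⊗ A`; for vector spaces `a ⊗ h ↦ h₂ ⊗ S⁻¹(h₁) a`. It is the inverse of
`(ρ_A ⊗ id) ∘ (id ⊗ c_{H,A}) ∘ (Δ ⊗ id)`. -/
noncomputable def twistedFlip [IsIso (HopfObj.antipode (X := H))] (A : Mod S H) : A.X ⊗ H ⟶ H ⊗ A.X :=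
  (β_ H A.X).inv ≫
    (ComonObj.comul ≫ (β_ H H).inv ≫ H ◁ inv (HopfObj.antipode (X := H))) ▷ A.X ≫
      (α_ H H A.X).hom ≫ H ◁ act A

/-- `X ⊗ B ⟶ H ⊗ (X ⊗ B)`: insert `x : 𝟙_ S ⟶ H ⊗ H` on the left, move its second leg past `X`
with `c_{H,X}` and let it act on `B`; for vector spaces `p ⊗ b ↦ x₁ ⊗ p ⊗ x₂ b`. -/
def insertAct (x : 𝟙_ S ⟶ H ⊗ H) (X : S) (B : Mod S H) : X ⊗ B.X ⟶ H ⊗ (X ⊗ B.X) :=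
  (λ_ (X ⊗ B.X)).inv ≫ x ▷ (X ⊗ B.X) ≫ tensorμ H H X B.X ≫ (H ⊗ X) ◁ act B ≫
    (α_ H X B.X).hom

/-- The morphisms of `S` underlying `α_{A,B,C} : A ⊗ (B ⊗ C) ⟶ (A ⊗ B) ⊗ C`. -/
noncomputable def assocM [IsIso (HopfObj.antipode (X := H))] (gam del : 𝟙_ S ⟶ H ⊗ H) (phi : H ⟶ H) :
    (A B C : Ext H) →
      ((total H).obj (tensorO A (tensorO B C)) ⟶ (total H).obj (tensorO (tensorO A B) C))
  | .inl A, .inl B, .inl C => (α_ A.X B.X C.X).inv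
  | .inl A, .inl B, .inr C => (α_ A.X B.X C).inv
  | .inr A, .inl B, .inl C => (α_ A B.X C.X).inv
  | .inl A, .inr B, .inl C =>
      A.X ◁ (β_ C.X B).inv ≫ (α_ A.X C.X B).inv ≫ actBy gam A C ▷ B ≫ (α_ A.X C.X B).hom ≫
        A.X ◁ (β_ C.X B).hom ≫ (α_ A.X B C.X).inv
  | .inl A, .inr B, .inr C =>
      (α_ A.X H (B ⊗ C)).inv ≫ twistedFlip A ▷ (B ⊗ C) ≫ (α_ H A.X (B ⊗ C)).hom ≫
        H ◁ (α_ A.X B C).inv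
  | .inr A, .inl B, .inr C =>
      H ◁ (α_ A B.X C).inv ≫ H ◁ insertAct del A B ▷ C ≫ H ◁ (α_ H (A ⊗ B.X) C).hom ≫
        (α_ H H ((A ⊗ B.X) ⊗ C)).inv ≫ MonObj.mul ▷ ((A ⊗ B.X) ⊗ C)
  | .inr A, .inr B, .inl C =>
      H ◁ (α_ A B C.X).inv ≫ ComonObj.comul ▷ ((A ⊗ B) ⊗ C.X) ≫ tensorμ H H (A ⊗ B) C.X ≫
        (H ⊗ (A ⊗ B)) ◁ act C
  | .inr A, .inr B, .inr C =>
      (α_ A H (B ⊗ C)).inv ≫ ((β_ H A).inv ≫ phi ▷ A) ▷ (B ⊗ C) ≫ (α_ (H ⊗ A) B C).inv ≫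
        (α_ H A B).hom ▷ C

/-! ### The Hopf-algebraic data -/

/-- Left multiplication with an element, `h ↦ x h`. -/
def mulL (x : 𝟙_ S ⟶ H) : H ⟶ H := (λ_ H).inv ≫ x ▷ H ≫ MonObj.mul

/-- Right multiplication with an element, `h ↦ h x`. -/
def mulR (x : 𝟙_ S ⟶ H) : H ⟶ H := (ρ_ H).inv ≫ H ◁ x ≫ MonObj.mul

/-- `y` is the multiplicative inverse of `x`. -/
def IsMulInverse (x y : 𝟙_ S ⟶ H) : Prop :=
  (λ_ (𝟙_ S)).inv ≫ (x ⊗ₘ y) ≫ MonObj.mul = MonObj.one ∧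
    (λ_ (𝟙_ S)).inv ≫ (y ⊗ₘ x) ≫ MonObj.mul = MonObj.one

variable (H) in
/-- `lam` is a right cointegral: `(lam ⊗ id) ∘ Δ = η ∘ lam`. -/
def IsRightCointegral (lam : H ⟶ 𝟙_ S) : Prop :=
  ComonObj.comul ≫ lam ▷ H ≫ (λ_ H).hom = lam ≫ MonObj.one

/-- `g` is the distinguished element of `lam`: `(id ⊗ lam) ∘ Δ = g ∘ lam`. -/
def IsDistinguished (lam : H ⟶ 𝟙_ S) (g : 𝟙_ S ⟶ H) : Prop :=
  ComonObj.comul ≫ H ◁ lam ≫ (ρ_ H).hom = lam ≫ g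

section Rigid

variable [RightRigidCategory S]

variable (H) in
/-- The product of the dual Hopf algebra: the dual of the coproduct, where `H^∨ ⊗ H^∨` is the dual
of `H ⊗ H` by the nested evaluation; on elements `(a b)(h) = b(h₁) a(h₂)`. -/
def dualMul : (Hᘁ : S) ⊗ (Hᘁ : S) ⟶ (Hᘁ : S) :=
  @rightAdjointMate S _ _ H (H ⊗ H) _ hasRightDualTensor ComonObj.comul

variable (H) in
/-- The coproduct of the dual Hopf algebra: the dual of the product. -/
def dualComul : (Hᘁ : S) ⟶ (Hᘁ : S) ⊗ (Hᘁ : S) :=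
  @rightAdjointMate S _ _ (H ⊗ H) H hasRightDualTensor _ MonObj.mul

variable (H) in
/-- The unit of the dual Hopf algebra: the dual of the counit. -/
def dualOne : 𝟙_ S ⟶ (Hᘁ : S) :=
  @rightAdjointMate S _ _ H (𝟙_ S) _ hasRightDualUnit ComonObj.counit

variable (H) in
/-- The counit of the dual Hopf algebra: the dual of the unit. -/
def dualCounit : (Hᘁ : S) ⟶ 𝟙_ S :=
  @rightAdjointMate S _ _ (𝟙_ S) H hasRightDualUnit _ MonObj.one

/-- `Γ : H^∨ ⟶ H` is an isomorphism of Hopf algebras: it is invertible and compatible with product,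
unit, coproduct, counit and antipode, where the antipode of `H^∨` is the dual of that of `H`. -/
structure IsDualHopfIso (Γ : (Hᘁ : S) ⟶ H) : Prop where
  isIso : IsIso Γ
  mul : dualMul H ≫ Γ = (Γ ⊗ₘ Γ) ≫ MonObj.mul
  one : dualOne H ≫ Γ = MonObj.one
  comul : Γ ≫ ComonObj.comul = dualComul H ≫ (Γ ⊗ₘ Γ)
  counit : Γ ≫ ComonObj.counit = dualCounit H
  antipode : rightAdjointMate (HopfObj.antipode (X := H)) ≫ Γ = Γ ≫ HopfObj.antipode

/-- The conditions on the data `(Γ, lam)`, where `g` is the distinguished element of `lam`. In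
`self_dual` the morphism `Ad_{g⁻¹}` is `h ↦ g⁻¹ h g`; the inverse `g⁻¹` exists and is unique by
the other conditions. -/
structure IsAdmissible [RibbonCategory S] (Γ : (Hᘁ : S) ⟶ H) (lam : H ⟶ 𝟙_ S) (g : 𝟙_ S ⟶ H) :
    Prop where
  hopf_iso : IsDualHopfIso Γ
  cointegral : IsRightCointegral H lam
  distinguished : IsDistinguished lam g
  normalised : η_ H (Hᘁ : S) ≫ H ◁ Γ ≫ (lam ⊗ₘ lam) ≫ (λ_ (𝟙_ S)).hom = 𝟙 (𝟙_ S)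
  self_dual : ∀ gInv : 𝟙_ S ⟶ H, IsMulInverse g gInv →
    rightAdjointMate Γ =
      Γ ≫ (mulR g ≫ mulL gInv) ≫ HopfObj.antipode ≫ HopfObj.antipode ≫
        (RibbonCategory.twist H).inv ≫ toDoubleDual H

section Antipode

variable [IsIso (HopfObj.antipode (X := H))]

/-- `(id ⊗ (S⁻¹ ∘ Γ)) ∘ coev`. -/
noncomputable def gammaOf (Γ : (Hᘁ : S) ⟶ H) : 𝟙_ S ⟶ H ⊗ H :=
  η_ H (Hᘁ : S) ≫ H ◁ (Γ ≫ inv (HopfObj.antipode (X := H)))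

/-- `(id ⊗ (M_g ∘ S²)) ∘ γ`. -/
noncomputable def deltaOf (Γ : (Hᘁ : S) ⟶ H) (g : 𝟙_ S ⟶ H) : 𝟙_ S ⟶ H ⊗ H :=
  gammaOf Γ ≫ H ◁ (HopfObj.antipode ≫ HopfObj.antipode ≫ mulR g)

/-- `(id ⊗ lam) ∘ (S ⊗ μ) ∘ (γ ⊗ id)`. -/
noncomputable def phiOf (Γ : (Hᘁ : S) ⟶ H) (lam : H ⟶ 𝟙_ S) : H ⟶ H :=
  (λ_ H).inv ≫ gammaOf Γ ▷ H ≫ (α_ H H H).hom ≫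
    (HopfObj.antipode ⊗ₘ (MonObj.mul ≫ lam)) ≫ (ρ_ H).hom

/-- `M` is the monoidal category `C(H, Γ, lam)`: its tensor product, on objects and morphisms, is
the prescribed one, its unit is the trivial module, and in `S` its associators
`A ⊗ (B ⊗ C) ⟶ (A ⊗ B) ⊗ C` and unitors are the prescribed morphisms. -/
def IsExtension (Γ : (Hᘁ : S) ⟶ H) (lam : H ⟶ 𝟙_ S) (g : 𝟙_ S ⟶ H)
    (M : MonoidalCategory (Ext H)) : Prop :=
  ∃ (a : ∀ A B C : Ext H, tensorO (tensorO A B) C ≅ tensorO A (tensorO B C))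
    (l : ∀ A : Ext H, tensorO (unitO H) A ≅ A) (r : ∀ A : Ext H, tensorO A (unitO H) ≅ A),
    M.toMonoidalCategoryStruct = extStruct a l r ∧
    (∀ A B C, (total H).map (a A B C).inv =
      assocM (gammaOf Γ) (deltaOf Γ g) (phiOf Γ lam) A B C) ∧
    (∀ A, (total H).map (l A).hom = leftUnitorM A) ∧
    (∀ A, (total H).map (r A).hom = rightUnitorM A)

end Antipode

end Rigid

end Defs

end HopfExt

set_option linter.unusedSectionVars false
set_option linter.unusedSimpArgs false

/-! Formulas on elements below suppress braidings. Forgetting the actions is faithful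
(`total_map_injective`), so every axiom for $C$ is an identity between morphisms of $S$. Such
identities are computed with right-nested tensor products and a spectator tail.

The duality datum enters only through the copairing
$E=(\mathrm{id}\otimes\Gamma)\circ\mathrm{coev}=e_1\otimes e_2$. For invertible $\Gamma$, being an
isomorphism of Hopf algebras is the same as $E$ being a nondegenerate Hopf copairing
(`isHopfCopairing_iff`). Then $\gamma=e_1\otimes S^{-1}(e_2)$, $\delta=e_1\otimes S(e_2)g$, and
$\phi$ is the Fourier map $F(h)=e_1\lambda(e_2h)$. The twist cancels from condition c), which says
that a twisted copy of $E$ is carried to $E$ by the braiding (`self_dual_iff`). It is used in the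
form that the braiding carries $\delta$ to $g\gamma_1\otimes\gamma_2$ (`copairing_symm`). All this
is collected in `HopfDatum`.

Up to bracketing, each nontrivial associator is one of five operators: the action of $\gamma$
(`gOp`, degree 010), the inverse `tOp` of $h\otimes a\mapsto h_1a\otimes h_2$ (011), $h\otimes
m\mapsto h\delta_1\otimes\delta_2m$ (`dOp`, 101), $h\otimes m\mapsto h_1\otimes h_2m$ (`vOp`, 110),
and $F$ after an inverse braiding (111). The sixteen pentagons become relations among them. With at
most two entries of degree 1 they follow from coassociativity, from $E$ being a bicharacter, from
the coproducts of the two legs of $\delta$ and, for 1010, from condition c).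

With three entries of degree 1 they are properties of $F$: 1110 is the cointegral property, 1011 is
the property defining $g$, and 0111 is $\Delta F(h)=e_1\otimes F(e_2h)$. The case 1101 needs $S\circ
F=F'$ with $F'(h)=\lambda(h\delta_1)\delta_2$ (`fourier_antipode`). To prove this, put
$\Lambda=\lambda(e_1)e_2$, a left integral with $\lambda(\Lambda)=1$. Then
$F(\Lambda_1)\otimes\Lambda_2=\gamma$ and $F'(\Lambda_1)\otimes\Lambda_2=E$, which differ by $S$ on
the first leg. Since $S(h)g=\Lambda_1\lambda(h\Lambda_2)$ and $h\mapsto S(h)g$ is invertible, a map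
$k$ is determined by $k(\Lambda_1)\otimes\Lambda_2$.

In 1111 both sides are linear on a free module and need comparing only on the unit
(`fourier_dOp_fourier_uOp`). The same computation gives $F(gF(h))=S^{-1}(h)$, so $F$ is invertible
(`isIso_fourier`).

For part (ii), restriction of modules along $\varphi$ is an equivalence, and is monoidal with
structure map $\varphi\otimes\mathrm{id}$ on products of two objects of $C_1$ and the identity
otherwise. The primed data are the transported ones, so the associators match. -/

namespace HopfExt

/-! ### Associator-free calculus

Every morphism is extended by an identity on a tail `W`, and all tensor products are nested to the
right, so that no associators or unitors occur in compositions. -/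

section Calculus

variable {S : Type u} [Category.{v} S] [MonoidalCategory S]

/-- A morphism with two inputs, extended by a tail. -/
def fuse {X Y Z : S} (m : X ⊗ Y ⟶ Z) (W : S) : X ⊗ (Y ⊗ W) ⟶ Z ⊗ W :=
  (α_ X Y W).inv ≫ m ▷ W

/-- A morphism with two outputs, extended by a tail. -/
def fork {X Y Z : S} (d : X ⟶ Y ⊗ Z) (W : S) : X ⊗ W ⟶ Y ⊗ (Z ⊗ W) :=
  d ▷ W ≫ (α_ Y Z W).hom

/-- A morphism without inputs, extended by a tail. -/
def ins {X : S} (x : 𝟙_ S ⟶ X) (W : S) : W ⟶ X ⊗ W :=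
  (λ_ W).inv ≫ x ▷ W

/-- A morphism without inputs and with two outputs, extended by a tail. -/
def ins₂ {X Y : S} (x : 𝟙_ S ⟶ X ⊗ Y) (W : S) : W ⟶ X ⊗ (Y ⊗ W) :=
  (λ_ W).inv ≫ x ▷ W ≫ (α_ X Y W).hom

/-- A morphism without outputs, extended by a tail. -/
def cap {X : S} (l : X ⟶ 𝟙_ S) (W : S) : X ⊗ W ⟶ W :=
  l ▷ W ≫ (λ_ W).hom

lemma fuse_nat {X Y Z : S} (m : X ⊗ Y ⟶ Z) {W W' : S} (f : W ⟶ W') :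
    X ◁ Y ◁ f ≫ fuse m W' = fuse m W ≫ Z ◁ f := by
  simp [fuse, ← whisker_exchange]

lemma fuse_nat_assoc : type_of% (reassoc_of% @fuse_nat) := @(reassoc_of% @fuse_nat)

lemma fork_nat {X Y Z : S} (d : X ⟶ Y ⊗ Z) {W W' : S} (f : W ⟶ W') :
    X ◁ f ≫ fork d W' = fork d W ≫ Y ◁ Z ◁ f := by
  simp [fork, whisker_exchange_assoc]

lemma fork_nat_assoc : type_of% (reassoc_of% @fork_nat) := @(reassoc_of% @fork_nat)

lemma ins_nat {X : S} (x : 𝟙_ S ⟶ X) {W W' : S} (f : W ⟶ W') :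
    f ≫ ins x W' = ins x W ≫ X ◁ f := by
  simp [ins, ← whisker_exchange]

lemma ins_nat_assoc : type_of% (reassoc_of% @ins_nat) := @(reassoc_of% @ins_nat)

lemma ins₂_nat {X Y : S} (x : 𝟙_ S ⟶ X ⊗ Y) {W W' : S} (f : W ⟶ W') :
    f ≫ ins₂ x W' = ins₂ x W ≫ X ◁ Y ◁ f := by
  simp only [ins₂, Category.assoc, ← associator_naturality_right, ← whisker_exchange_assoc,
    id_whiskerLeft, Iso.inv_hom_id_assoc]

lemma ins₂_nat_assoc : type_of% (reassoc_of% @ins₂_nat) := @(reassoc_of% @ins₂_nat)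

lemma cap_nat {X : S} (l : X ⟶ 𝟙_ S) {W W' : S} (f : W ⟶ W') :
    X ◁ f ≫ cap l W' = cap l W ≫ f := by
  simp [cap, whisker_exchange_assoc]

lemma cap_nat_assoc : type_of% (reassoc_of% @cap_nat) := @(reassoc_of% @cap_nat)

lemma fuse_comp {X Y Z Z' : S} (m : X ⊗ Y ⟶ Z) (f : Z ⟶ Z') (W : S) :
    fuse m W ≫ f ▷ W = fuse (m ≫ f) W := by
  simp [fuse]

lemma comp_fork {X X' Y Z : S} (f : X ⟶ X') (d : X' ⟶ Y ⊗ Z) (W : S) :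
    f ▷ W ≫ fork d W = fork (f ≫ d) W := by
  simp [fork]

lemma ins_comp {X X' : S} (x : 𝟙_ S ⟶ X) (f : X ⟶ X') (W : S) :
    ins x W ≫ f ▷ W = ins (x ≫ f) W := by
  simp [ins]

lemma ins_comp_assoc : type_of% (reassoc_of% @ins_comp) := @(reassoc_of% @ins_comp)

lemma comp_cap {X X' : S} (f : X ⟶ X') (l : X' ⟶ 𝟙_ S) (W : S) :
    f ▷ W ≫ cap l W = cap (f ≫ l) W := by
  simp [cap]

lemma ins₂_left {X X' Y : S} (x : 𝟙_ S ⟶ X ⊗ Y) (f : X ⟶ X') (W : S) :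
    ins₂ x W ≫ f ▷ (Y ⊗ W) = ins₂ (x ≫ f ▷ Y) W := by
  simp [ins₂]

lemma ins₂_right {X Y Y' : S} (x : 𝟙_ S ⟶ X ⊗ Y) (f : Y ⟶ Y') (W : S) :
    ins₂ x W ≫ X ◁ f ▷ W = ins₂ (x ≫ X ◁ f) W := by
  simp [ins₂]

lemma ins₂_right_assoc : type_of% (reassoc_of% @ins₂_right) := @(reassoc_of% @ins₂_right)

lemma ins_fork {X Y Z : S} (x : 𝟙_ S ⟶ X) (d : X ⟶ Y ⊗ Z) (W : S) :
    ins x W ≫ fork d W = ins₂ (x ≫ d) W := by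
  simp [ins, fork, ins₂]

lemma cap_ins {X Y : S} (l : X ⟶ 𝟙_ S) (y : 𝟙_ S ⟶ Y) (W : S) :
    cap l W ≫ ins y W = (l ≫ y) ▷ W := by
  simp [ins, cap]

/-- The tail `𝟙_ S` gives back the plain morphism, so an identity holding for all tails descends. -/
lemma ext_whiskerRight {X Y : S} {f f' : X ⟶ Y} (h : ∀ W : S, f ▷ W = f' ▷ W) : f = f' := by
  have := h (𝟙_ S)
  simpa using this

lemma ext_ins {X : S} {f f' : 𝟙_ S ⟶ X} (h : ∀ W : S, ins f W = ins f' W) : f = f' := by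
  have := h (𝟙_ S)
  simpa [ins, ← unitors_inv_equal] using this

lemma ext_ins₂ {X Y : S} {f f' : 𝟙_ S ⟶ X ⊗ Y} (h : ∀ W : S, ins₂ f W = ins₂ f' W) : f = f' := by
  have := h (𝟙_ S)
  simp only [ins₂, Iso.cancel_iso_inv_left, Iso.cancel_iso_hom_right_assoc] at this
  simpa using this

lemma ins₂_eq_ins_fork {X Y : S} (x : 𝟙_ S ⟶ X ⊗ Y) (W : S) :
    ins₂ x W = ins x W ≫ (α_ X Y W).hom := by
  simp [ins₂, ins]

variable [BraidedCategory S]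

/-- The braiding, extended by a tail. -/
def br (X Y W : S) : X ⊗ (Y ⊗ W) ⟶ Y ⊗ (X ⊗ W) :=
  (α_ X Y W).inv ≫ (β_ X Y).hom ▷ W ≫ (α_ Y X W).hom

/-- The inverse braiding, extended by a tail. -/
def bri (X Y W : S) : Y ⊗ (X ⊗ W) ⟶ X ⊗ (Y ⊗ W) :=
  (α_ Y X W).inv ≫ (β_ X Y).inv ▷ W ≫ (α_ X Y W).hom

@[simp]
lemma br_bri (X Y W : S) : br X Y W ≫ bri X Y W = 𝟙 _ := by
  simp [br, bri]

@[simp]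
lemma br_bri_assoc : type_of% (reassoc_of% @br_bri) := @(reassoc_of% @br_bri)

@[simp]
lemma bri_br (X Y W : S) : bri X Y W ≫ br X Y W = 𝟙 _ := by
  simp [br, bri]

@[simp]
lemma bri_br_assoc : type_of% (reassoc_of% @bri_br) := @(reassoc_of% @bri_br)

@[simp]
lemma whiskerLeft_br_bri (A X Y W : S) : A ◁ br X Y W ≫ A ◁ bri X Y W = 𝟙 _ := by
  rw [← whiskerLeft_comp, br_bri, whiskerLeft_id]

@[simp]
lemma whiskerLeft_br_bri_assoc : type_of% (reassoc_of% @whiskerLeft_br_bri) := @(reassoc_of% @whiskerLeft_br_bri)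

@[simp]
lemma whiskerLeft_bri_br (A X Y W : S) : A ◁ bri X Y W ≫ A ◁ br X Y W = 𝟙 _ := by
  rw [← whiskerLeft_comp, bri_br, whiskerLeft_id]

@[simp]
lemma whiskerLeft_bri_br_assoc : type_of% (reassoc_of% @whiskerLeft_bri_br) := @(reassoc_of% @whiskerLeft_bri_br)

instance (X Y W : S) : IsIso (br X Y W) := ⟨bri X Y W, by simp, by simp⟩
instance (X Y W : S) : IsIso (bri X Y W) := ⟨br X Y W, by simp, by simp⟩

lemma br_nat (X Y : S) {W W' : S} (f : W ⟶ W') :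
    X ◁ Y ◁ f ≫ br X Y W' = br X Y W ≫ Y ◁ X ◁ f := by
  simp only [br, associator_inv_naturality_right_assoc, whisker_exchange_assoc, Category.assoc,
    associator_naturality_right]

lemma br_nat_assoc : type_of% (reassoc_of% @br_nat) := @(reassoc_of% @br_nat)

lemma bri_nat (X Y : S) {W W' : S} (f : W ⟶ W') :
    Y ◁ X ◁ f ≫ bri X Y W' = bri X Y W ≫ X ◁ Y ◁ f := by
  simp only [bri, associator_inv_naturality_right_assoc, whisker_exchange_assoc, Category.assoc,
    associator_naturality_right]

lemma bri_nat_assoc : type_of% (reassoc_of% @bri_nat) := @(reassoc_of% @bri_nat)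

lemma br_br_br (X Y Z W : S) :
    X ◁ br Y Z W ≫ br X Z (Y ⊗ W) ≫ Z ◁ br X Y W =
      br X Y (Z ⊗ W) ≫ Y ◁ br X Z W ≫ br Y Z (X ⊗ W) := by
  have h := congrArg (fun f => ((α_ X Y (Z ⊗ W)).inv ≫ (α_ (X ⊗ Y) Z W).inv ≫ (α_ X Y Z).hom ▷ W) ≫
    f ▷ W ≫ (α_ Z (Y ⊗ X) W).hom ≫ Z ◁ (α_ Y X W).hom) (BraidedCategory.yang_baxter X Y Z)
  simp only [comp_whiskerRight] at h
  refine Eq.trans ?_ (Eq.trans h.symm ?_)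
  · simp only [br]
    monoidal
  · simp only [br]
    monoidal

lemma br_br_br_assoc : type_of% (reassoc_of% @br_br_br) := @(reassoc_of% @br_br_br)

lemma fuse_braid {X Y Z : S} (m : X ⊗ Y ⟶ Z) (A W : S) :
    fuse m (A ⊗ W) ≫ br Z A W = X ◁ br Y A W ≫ br X A (Y ⊗ W) ≫ A ◁ fuse m W := by
  have h := BraidedCategory.braiding_naturality_left m A
  have h' : m ▷ A ▷ W ≫ (β_ Z A).hom ▷ W = (β_ (X ⊗ Y) A).hom ▷ W ≫ (A ◁ m) ▷ W := by
    rw [← comp_whiskerRight, h, comp_whiskerRight]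
  simp only [fuse, br, Category.assoc, associator_inv_naturality_left_assoc, reassoc_of% h',
    BraidedCategory.braiding_tensor_left_hom]
  monoidal

lemma fuse_braid_assoc : type_of% (reassoc_of% @fuse_braid) := @(reassoc_of% @fuse_braid)

lemma braid_fuse {X Y Z : S} (m : X ⊗ Y ⟶ Z) (A W : S) :
    A ◁ fuse m W ≫ br A Z W = br A X (Y ⊗ W) ≫ X ◁ br A Y W ≫ fuse m (A ⊗ W) := by
  have h := BraidedCategory.braiding_naturality_right A m
  have h' : (A ◁ m) ▷ W ≫ (β_ A Z).hom ▷ W = (β_ A (X ⊗ Y)).hom ▷ W ≫ m ▷ A ▷ W := by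
    rw [← comp_whiskerRight, h, comp_whiskerRight]
  simp only [fuse, br, Category.assoc, whiskerLeft_comp, associator_inv_naturality_middle_assoc,
    reassoc_of% h', BraidedCategory.braiding_tensor_right_hom]
  monoidal

lemma braid_fuse_assoc : type_of% (reassoc_of% @braid_fuse) := @(reassoc_of% @braid_fuse)

lemma fork_braid {X Y Z : S} (d : X ⟶ Y ⊗ Z) (A W : S) :
    br X A W ≫ A ◁ fork d W = fork d (A ⊗ W) ≫ Y ◁ br Z A W ≫ br Y A (Z ⊗ W) := by
  have h := BraidedCategory.braiding_naturality_left d A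
  have h' : (β_ X A).hom ▷ W ≫ (A ◁ d) ▷ W = d ▷ A ▷ W ≫ (β_ (Y ⊗ Z) A).hom ▷ W := by
    rw [← comp_whiskerRight, ← h, comp_whiskerRight]
  simp only [fork, br, Category.assoc, whiskerLeft_comp, ← associator_naturality_middle_assoc,
    reassoc_of% h', BraidedCategory.braiding_tensor_left_hom]
  monoidal

lemma fork_braid_assoc : type_of% (reassoc_of% @fork_braid) := @(reassoc_of% @fork_braid)

lemma braid_fork {X Y Z : S} (d : X ⟶ Y ⊗ Z) (A W : S) :
    br A X W ≫ fork d (A ⊗ W) = A ◁ fork d W ≫ br A Y (Z ⊗ W) ≫ Y ◁ br A Z W := by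
  have h := BraidedCategory.braiding_naturality_right A d
  have h' : (β_ A X).hom ▷ W ≫ d ▷ A ▷ W = (A ◁ d) ▷ W ≫ (β_ A (Y ⊗ Z)).hom ▷ W := by
    rw [← comp_whiskerRight, ← h, comp_whiskerRight]
  simp only [fork, br, Category.assoc, whiskerLeft_comp, ← associator_naturality_left_assoc,
    reassoc_of% h', BraidedCategory.braiding_tensor_right_hom]
  monoidal

lemma braid_fork_assoc : type_of% (reassoc_of% @braid_fork) := @(reassoc_of% @braid_fork)

lemma whisker_braid {X Y : S} (f : X ⟶ Y) (A W : S) :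
    f ▷ (A ⊗ W) ≫ br Y A W = br X A W ≫ A ◁ f ▷ W := by
  have h := BraidedCategory.braiding_naturality_left f A
  have h' : f ▷ A ▷ W ≫ (β_ Y A).hom ▷ W = (β_ X A).hom ▷ W ≫ (A ◁ f) ▷ W := by
    rw [← comp_whiskerRight, h, comp_whiskerRight]
  simp only [br, associator_inv_naturality_left_assoc, reassoc_of% h']
  monoidal

lemma whisker_braid_assoc : type_of% (reassoc_of% @whisker_braid) := @(reassoc_of% @whisker_braid)

lemma braid_whisker {X Y : S} (f : X ⟶ Y) (A W : S) :
    A ◁ f ▷ W ≫ br A Y W = br A X W ≫ f ▷ (A ⊗ W) := by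
  have h := BraidedCategory.braiding_naturality_right A f
  have h' : (A ◁ f) ▷ W ≫ (β_ A Y).hom ▷ W = (β_ A X).hom ▷ W ≫ f ▷ A ▷ W := by
    rw [← comp_whiskerRight, h, comp_whiskerRight]
  simp only [br, associator_inv_naturality_middle_assoc, reassoc_of% h']
  monoidal

lemma braid_whisker_assoc : type_of% (reassoc_of% @braid_whisker) := @(reassoc_of% @braid_whisker)

lemma ins_braid {X : S} (x : 𝟙_ S ⟶ X) (A W : S) :
    ins x (A ⊗ W) ≫ br X A W = A ◁ ins x W := by
  rw [ins, Category.assoc, whisker_braid, ins, whiskerLeft_comp, br,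
    braiding_tensorUnit_left]
  monoidal

lemma ins_braid_assoc : type_of% (reassoc_of% @ins_braid) := @(reassoc_of% @ins_braid)

lemma braid_ins {X : S} (x : 𝟙_ S ⟶ X) (A W : S) :
    A ◁ ins x W ≫ br A X W = ins x (A ⊗ W) := by
  rw [ins, whiskerLeft_comp, Category.assoc, braid_whisker, ins, br,
    braiding_tensorUnit_right]
  monoidal

lemma braid_ins_assoc : type_of% (reassoc_of% @braid_ins) := @(reassoc_of% @braid_ins)

lemma cap_braid {X : S} (l : X ⟶ 𝟙_ S) (A W : S) :
    br X A W ≫ A ◁ cap l W = cap l (A ⊗ W) := by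
  rw [cap, whiskerLeft_comp, ← whisker_braid_assoc, cap, br,
    braiding_tensorUnit_left]
  monoidal

lemma braid_cap {X : S} (l : X ⟶ 𝟙_ S) (A W : S) :
    br A X W ≫ cap l (A ⊗ W) = A ◁ cap l W := by
  rw [cap, ← braid_whisker_assoc, cap, br, braiding_tensorUnit_right]
  monoidal

lemma braid_cap_assoc : type_of% (reassoc_of% @braid_cap) := @(reassoc_of% @braid_cap)

lemma ins₂_braid {X Y : S} (x : 𝟙_ S ⟶ X ⊗ Y) (A W : S) :
    ins₂ x (A ⊗ W) ≫ X ◁ br Y A W ≫ br X A (Y ⊗ W) = A ◁ ins₂ x W := by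
  have h := ins_braid x A W
  have h' := fork_braid (𝟙 (X ⊗ Y)) A W
  simp only [fork, id_whiskerRight, Category.id_comp] at h'
  rw [ins₂_eq_ins_fork, Category.assoc, ← h', reassoc_of% h, ← whiskerLeft_comp, ins₂_eq_ins_fork]

lemma ins₂_braid_assoc : type_of% (reassoc_of% @ins₂_braid) := @(reassoc_of% @ins₂_braid)

lemma braid_ins₂ {X Y : S} (x : 𝟙_ S ⟶ X ⊗ Y) (A W : S) :
    A ◁ ins₂ x W ≫ br A X (Y ⊗ W) ≫ X ◁ br A Y W = ins₂ x (A ⊗ W) := by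
  have h := braid_ins x A W
  have h' := braid_fork (𝟙 (X ⊗ Y)) A W
  simp only [fork, id_whiskerRight, Category.id_comp] at h'
  rw [ins₂_eq_ins_fork, whiskerLeft_comp, Category.assoc, ← h', reassoc_of% h, ins₂_eq_ins_fork]

lemma braid_ins₂_assoc : type_of% (reassoc_of% @braid_ins₂) := @(reassoc_of% @braid_ins₂)

/-- A pair created from the unit crosses `A` for free, so moving one leg across undoes moving the
other. -/
lemma ins₂_braid_right {X Y : S} (x : 𝟙_ S ⟶ X ⊗ Y) (A W : S) :
    ins₂ x (A ⊗ W) ≫ X ◁ br Y A W = A ◁ ins₂ x W ≫ bri X A (Y ⊗ W) := by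
  rw [← ins₂_braid]
  simp

lemma braid_ins₂_left {X Y : S} (x : 𝟙_ S ⟶ X ⊗ Y) (A W : S) :
    A ◁ ins₂ x W ≫ br A X (Y ⊗ W) = ins₂ x (A ⊗ W) ≫ X ◁ bri A Y W := by
  rw [← braid_ins₂]
  simp

lemma braid_ins₂_left_assoc : type_of% (reassoc_of% @braid_ins₂_left) := @(reassoc_of% @braid_ins₂_left)

lemma whisker_bri {X Y : S} (f : X ⟶ Y) (A W : S) :
    A ◁ f ▷ W ≫ bri Y A W = bri X A W ≫ f ▷ (A ⊗ W) := by
  rw [← cancel_epi (br X A W), ← whisker_braid_assoc]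
  simp

lemma whisker_bri_assoc : type_of% (reassoc_of% @whisker_bri) := @(reassoc_of% @whisker_bri)

lemma bri_whisker {X Y : S} (f : X ⟶ Y) (A W : S) :
    f ▷ (A ⊗ W) ≫ bri A Y W = bri A X W ≫ A ◁ f ▷ W := by
  rw [← cancel_epi (br A X W), ← braid_whisker_assoc]
  simp

lemma bri_whisker_assoc : type_of% (reassoc_of% @bri_whisker) := @(reassoc_of% @bri_whisker)

lemma fuse_bri {X Y Z : S} (m : X ⊗ Y ⟶ Z) (A W : S) :
    A ◁ fuse m W ≫ bri Z A W = bri X A (Y ⊗ W) ≫ X ◁ bri Y A W ≫ fuse m (A ⊗ W) := by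
  rw [← cancel_epi (br X A (Y ⊗ W)), ← cancel_epi (X ◁ br Y A W), ← fuse_braid_assoc]
  simp

lemma bri_fork {X Y Z : S} (d : X ⟶ Y ⊗ Z) (A W : S) :
    bri X A W ≫ fork d (A ⊗ W) = A ◁ fork d W ≫ bri Y A (Z ⊗ W) ≫ Y ◁ bri Z A W := by
  rw [← cancel_epi (br X A W), fork_braid_assoc]
  simp

lemma bri_fork_assoc : type_of% (reassoc_of% @bri_fork) := @(reassoc_of% @bri_fork)

lemma bri_cap {X : S} (l : X ⟶ 𝟙_ S) (A W : S) :
    bri X A W ≫ cap l (A ⊗ W) = A ◁ cap l W := by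
  rw [← cap_braid]
  simp

lemma bri_cap_assoc : type_of% (reassoc_of% @bri_cap) := @(reassoc_of% @bri_cap)

lemma bri_fuse {X Y Z : S} (m : X ⊗ Y ⟶ Z) (A W : S) :
    fuse m (A ⊗ W) ≫ bri A Z W = X ◁ bri A Y W ≫ bri A X (Y ⊗ W) ≫ A ◁ fuse m W := by
  rw [← cancel_epi (X ◁ br A Y W), ← cancel_epi (br A X (Y ⊗ W)), ← braid_fuse_assoc]
  simp

lemma bri_fuse_assoc : type_of% (reassoc_of% @bri_fuse) := @(reassoc_of% @bri_fuse)

lemma fork_bri {X Y Z : S} (d : X ⟶ Y ⊗ Z) (A W : S) :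
    bri A X W ≫ A ◁ fork d W = fork d (A ⊗ W) ≫ Y ◁ bri A Z W ≫ bri A Y (Z ⊗ W) := by
  rw [← cancel_epi (br A X W), braid_fork_assoc]
  simp

lemma fork_bri_assoc : type_of% (reassoc_of% @fork_bri) := @(reassoc_of% @fork_bri)

lemma bri_ins {X : S} (x : 𝟙_ S ⟶ X) (A W : S) :
    ins x (A ⊗ W) ≫ bri A X W = A ◁ ins x W := by
  rw [← braid_ins]
  simp only [Category.assoc, br_bri, Category.comp_id]

lemma bri_ins_assoc : type_of% (reassoc_of% @bri_ins) := @(reassoc_of% @bri_ins)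

lemma cap_bri {X : S} (l : X ⟶ 𝟙_ S) (A W : S) :
    bri A X W ≫ A ◁ cap l W = cap l (A ⊗ W) := by
  rw [← braid_cap]
  simp only [bri_br_assoc]

lemma cap_bri_assoc : type_of% (reassoc_of% @cap_bri) := @(reassoc_of% @cap_bri)

lemma bri_bri_bri (X Y Z W : S) :
    bri Y Z (X ⊗ W) ≫ Y ◁ bri X Z W ≫ bri X Y (Z ⊗ W) =
      Z ◁ bri X Y W ≫ bri X Z (Y ⊗ W) ≫ X ◁ bri Y Z W := by
  rw [← cancel_epi (br Y Z (X ⊗ W)), ← cancel_epi (Y ◁ br X Z W), ← cancel_epi (br X Y (Z ⊗ W)),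
    br_bri_assoc, whiskerLeft_br_bri_assoc, br_bri, ← br_br_br_assoc]
  simp

lemma bri_bri_bri_assoc : type_of% (reassoc_of% @bri_bri_bri) := @(reassoc_of% @bri_bri_bri)

/-! ### Naturality under further strands -/

section Whiskered

variable (A B : S)

lemma whiskerLeft_fuse_nat {X Y Z : S} (m : X ⊗ Y ⟶ Z) {W W' : S} (f : W ⟶ W') :
    A ◁ X ◁ Y ◁ f ≫ A ◁ fuse m W' = A ◁ fuse m W ≫ A ◁ Z ◁ f := by
  rw [← whiskerLeft_comp, fuse_nat, whiskerLeft_comp]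

lemma whiskerLeft_fuse_nat_assoc : type_of% (reassoc_of% @whiskerLeft_fuse_nat) := @(reassoc_of% @whiskerLeft_fuse_nat)

lemma whiskerLeft_fork_nat {X Y Z : S} (d : X ⟶ Y ⊗ Z) {W W' : S} (f : W ⟶ W') :
    A ◁ X ◁ f ≫ A ◁ fork d W' = A ◁ fork d W ≫ A ◁ Y ◁ Z ◁ f := by
  rw [← whiskerLeft_comp, fork_nat, whiskerLeft_comp]

lemma whiskerLeft_fork_nat_assoc : type_of% (reassoc_of% @whiskerLeft_fork_nat) := @(reassoc_of% @whiskerLeft_fork_nat)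

lemma whiskerLeft_cap_nat {X : S} (l : X ⟶ 𝟙_ S) {W W' : S} (f : W ⟶ W') :
    A ◁ X ◁ f ≫ A ◁ cap l W' = A ◁ cap l W ≫ A ◁ f := by
  rw [← whiskerLeft_comp, cap_nat, whiskerLeft_comp]

lemma whiskerLeft_br_nat (X Y : S) {W W' : S} (f : W ⟶ W') :
    A ◁ X ◁ Y ◁ f ≫ A ◁ br X Y W' = A ◁ br X Y W ≫ A ◁ Y ◁ X ◁ f := by
  rw [← whiskerLeft_comp, br_nat, whiskerLeft_comp]

lemma whiskerLeft_br_nat_assoc : type_of% (reassoc_of% @whiskerLeft_br_nat) := @(reassoc_of% @whiskerLeft_br_nat)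

lemma whiskerLeft_ins_nat {X : S} (x : 𝟙_ S ⟶ X) {W W' : S} (f : W ⟶ W') :
    A ◁ f ≫ A ◁ ins x W' = A ◁ ins x W ≫ A ◁ X ◁ f := by
  rw [← whiskerLeft_comp, ins_nat, whiskerLeft_comp]

lemma whiskerLeft_ins_nat_assoc : type_of% (reassoc_of% @whiskerLeft_ins_nat) := @(reassoc_of% @whiskerLeft_ins_nat)

lemma whiskerLeft_ins₂_nat {X Y : S} (x : 𝟙_ S ⟶ X ⊗ Y) {W W' : S} (f : W ⟶ W') :
    A ◁ f ≫ A ◁ ins₂ x W' = A ◁ ins₂ x W ≫ A ◁ X ◁ Y ◁ f := by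
  rw [← whiskerLeft_comp, ins₂_nat, whiskerLeft_comp]

lemma whiskerLeft_ins₂_nat_assoc : type_of% (reassoc_of% @whiskerLeft_ins₂_nat) := @(reassoc_of% @whiskerLeft_ins₂_nat)

lemma whiskerLeft_whisker_exchange {X Y W W' : S} (k : X ⟶ Y) (f : W ⟶ W') :
    A ◁ X ◁ f ≫ A ◁ k ▷ W' = A ◁ k ▷ W ≫ A ◁ Y ◁ f := by
  rw [← whiskerLeft_comp, whisker_exchange, whiskerLeft_comp]

lemma whiskerLeft_whisker_exchange_assoc : type_of% (reassoc_of% @whiskerLeft_whisker_exchange) := @(reassoc_of% @whiskerLeft_whisker_exchange)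

lemma whiskerLeft₂_br_nat (X Y : S) {W W' : S} (f : W ⟶ W') :
    A ◁ B ◁ X ◁ Y ◁ f ≫ A ◁ B ◁ br X Y W' = A ◁ B ◁ br X Y W ≫ A ◁ B ◁ Y ◁ X ◁ f := by
  rw [← whiskerLeft_comp, whiskerLeft_br_nat, whiskerLeft_comp]

lemma whiskerLeft₂_br_nat_assoc : type_of% (reassoc_of% @whiskerLeft₂_br_nat) := @(reassoc_of% @whiskerLeft₂_br_nat)

end Whiskered

end Calculus

/-! ### Hopf algebra axioms with a tail -/

section HopfLaws

variable {S : Type u} [Category.{v} S] [MonoidalCategory S] [BraidedCategory S]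

section

variable (H : S) [HopfObj H]

local notation "𝕞" => fuse (MonObj.mul (X := H))
local notation "𝕕" => fork (ComonObj.comul (X := H))
local notation "𝕦" => ins (MonObj.one (X := H))
local notation "𝕖" => cap (ComonObj.counit (X := H))
local notation "𝕤" => HopfObj.antipode (X := H)

lemma mul_mul (W : S) : 𝕞 (H ⊗ W) ≫ 𝕞 W = H ◁ 𝕞 W ≫ 𝕞 W := by
  have h := MonObj.mul_assoc H
  have h' : MonObj.mul ▷ H ▷ W ≫ MonObj.mul ▷ W =
      (α_ H H H).hom ▷ W ≫ (H ◁ MonObj.mul) ▷ W ≫ MonObj.mul (X := H) ▷ W := by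
    rw [← comp_whiskerRight, h, comp_whiskerRight, comp_whiskerRight]
  simp only [fuse, Category.assoc, associator_inv_naturality_left_assoc, h']
  monoidal

lemma mul_mul_assoc : type_of% (reassoc_of% @mul_mul) := @(reassoc_of% @mul_mul)

lemma one_mul (W : S) : 𝕦 (H ⊗ W) ≫ 𝕞 W = 𝟙 _ := by
  have h := MonObj.one_mul H
  have h' : MonObj.one ▷ H ▷ W ≫ MonObj.mul (X := H) ▷ W = (λ_ H).hom ▷ W := by
    rw [← comp_whiskerRight, h]
  simp only [fuse, ins, Category.assoc, associator_inv_naturality_left_assoc, h']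
  monoidal

lemma one_mul_assoc : type_of% (reassoc_of% @one_mul) := @(reassoc_of% @one_mul)

lemma mul_one (W : S) : H ◁ 𝕦 W ≫ 𝕞 W = 𝟙 _ := by
  have h := MonObj.mul_one H
  have h' : (H ◁ MonObj.one) ▷ W ≫ MonObj.mul (X := H) ▷ W = (ρ_ H).hom ▷ W := by
    rw [← comp_whiskerRight, h]
  simp only [fuse, ins, whiskerLeft_comp, Category.assoc, associator_inv_naturality_middle_assoc,
    h']
  monoidal

lemma mul_one_assoc : type_of% (reassoc_of% @mul_one) := @(reassoc_of% @mul_one)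

lemma comul_comul (W : S) : 𝕕 W ≫ 𝕕 (H ⊗ W) = 𝕕 W ≫ H ◁ 𝕕 W := by
  have h := ComonObj.comul_assoc H
  have h' : ComonObj.comul (X := H) ▷ W ≫ (H ◁ ComonObj.comul (X := H)) ▷ W =
      ComonObj.comul (X := H) ▷ W ≫ ComonObj.comul (X := H) ▷ H ▷ W ≫ (α_ H H H).hom ▷ W := by
    rw [← comp_whiskerRight, h, comp_whiskerRight, comp_whiskerRight]
  simp only [fork, Category.assoc, whiskerLeft_comp, ← associator_naturality_middle_assoc,
    reassoc_of% h']
  monoidal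

lemma comul_comul_assoc : type_of% (reassoc_of% @comul_comul) := @(reassoc_of% @comul_comul)

lemma comul_counit_left (W : S) : 𝕕 W ≫ 𝕖 (H ⊗ W) = 𝟙 _ := by
  have h := ComonObj.counit_comul H
  have h' : ComonObj.comul (X := H) ▷ W ≫ ComonObj.counit (X := H) ▷ H ▷ W = (λ_ H).inv ▷ W := by
    rw [← comp_whiskerRight, h]
  simp only [fork, cap, Category.assoc, ← associator_naturality_left_assoc, reassoc_of% h']
  monoidal

lemma comul_counit_left_assoc : type_of% (reassoc_of% @comul_counit_left) := @(reassoc_of% @comul_counit_left)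

lemma comul_counit_right (W : S) : 𝕕 W ≫ H ◁ 𝕖 W = 𝟙 _ := by
  have h := ComonObj.comul_counit H
  have h' : ComonObj.comul (X := H) ▷ W ≫ (H ◁ ComonObj.counit (X := H)) ▷ W =
      (ρ_ H).inv ▷ W := by
    rw [← comp_whiskerRight, h]
  simp only [fork, cap, whiskerLeft_comp, Category.assoc, ← associator_naturality_middle_assoc,
    reassoc_of% h']
  monoidal

lemma comul_counit_right_assoc : type_of% (reassoc_of% @comul_counit_right) := @(reassoc_of% @comul_counit_right)

lemma mul_comul (W : S) :
    𝕞 W ≫ 𝕕 W = H ◁ 𝕕 W ≫ 𝕕 (H ⊗ H ⊗ W) ≫ H ◁ br H H (H ⊗ W) ≫ 𝕞 (H ⊗ H ⊗ W) ≫ H ◁ 𝕞 W := by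
  have h := BimonObj.mul_comul H
  rw [fuse, fork, Category.assoc, ← comp_whiskerRight_assoc, h]
  simp only [fuse, fork, br, tensorμ, comp_whiskerRight]
  rw [MonoidalCategory.tensorHom_def', MonoidalCategory.tensorHom_def]
  monoidal

lemma mul_comul_assoc : type_of% (reassoc_of% @mul_comul) := @(reassoc_of% @mul_comul)

lemma one_comul (W : S) : 𝕦 W ≫ 𝕕 W = 𝕦 W ≫ 𝕦 (H ⊗ W) := by
  have h := BimonObj.one_comul H
  rw [MonObj.tensorObj.one_def, MonoidalCategory.tensorHom_def] at h
  rw [ins_nat, fork, ins, Category.assoc, ← comp_whiskerRight_assoc, h]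
  simp only [ins, comp_whiskerRight]
  monoidal

lemma one_comul_assoc : type_of% (reassoc_of% @one_comul) := @(reassoc_of% @one_comul)

lemma mul_counit (W : S) : 𝕞 W ≫ 𝕖 W = H ◁ 𝕖 W ≫ 𝕖 W := by
  have h := BimonObj.mul_counit H
  rw [Comon.tensorObj_counit, MonoidalCategory.tensorHom_def'] at h
  rw [fuse, cap, Category.assoc, ← comp_whiskerRight_assoc, h]
  simp only [comp_whiskerRight, whiskerLeft_comp]
  monoidal

lemma antipode_left (W : S) : 𝕕 W ≫ 𝕤 ▷ (H ⊗ W) ≫ 𝕞 W = 𝕖 W ≫ 𝕦 W := by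
  have h := HopfObj.antipode_left H
  rw [cap_ins, ← h, fork, fuse]
  simp only [comp_whiskerRight]
  monoidal

lemma antipode_left_assoc : type_of% (reassoc_of% @antipode_left) := @(reassoc_of% @antipode_left)

lemma antipode_right (W : S) : 𝕕 W ≫ H ◁ 𝕤 ▷ W ≫ 𝕞 W = 𝕖 W ≫ 𝕦 W := by
  have h := HopfObj.antipode_right H
  rw [cap_ins, ← h, fork, fuse]
  simp only [comp_whiskerRight]
  monoidal

lemma antipode_right_assoc : type_of% (reassoc_of% @antipode_right) := @(reassoc_of% @antipode_right)

lemma mul_antipode (W : S) :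
    𝕞 W ≫ 𝕤 ▷ W = H ◁ 𝕤 ▷ W ≫ 𝕤 ▷ (H ⊗ W) ≫ br H H W ≫ 𝕞 W := by
  have h := HopfObj.mul_antipode H
  rw [fuse_comp, h, fuse, MonoidalCategory.tensorHom_def']
  simp only [fuse, br, comp_whiskerRight]
  monoidal

lemma mul_antipode_assoc : type_of% (reassoc_of% @mul_antipode) := @(reassoc_of% @mul_antipode)

lemma antipode_comul (W : S) :
    𝕤 ▷ W ≫ 𝕕 W = 𝕕 W ≫ br H H W ≫ 𝕤 ▷ (H ⊗ W) ≫ H ◁ 𝕤 ▷ W := by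
  have h := HopfObj.antipode_comul H
  rw [comp_fork, h, fork, MonoidalCategory.tensorHom_def]
  simp [fork, br]

lemma antipode_comul_assoc : type_of% (reassoc_of% @antipode_comul) := @(reassoc_of% @antipode_comul)

lemma one_antipode (W : S) : 𝕦 W ≫ 𝕤 ▷ W = 𝕦 W := by
  rw [ins_comp, HopfObj.one_antipode]

lemma one_antipode_assoc : type_of% (reassoc_of% @one_antipode) := @(reassoc_of% @one_antipode)

lemma antipode_counit (W : S) : 𝕤 ▷ W ≫ 𝕖 W = 𝕖 W := by
  rw [comp_cap, HopfObj.antipode_counit]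

lemma antipode_counit_assoc : type_of% (reassoc_of% @antipode_counit) := @(reassoc_of% @antipode_counit)

@[simp]
lemma antipode_inv [IsIso 𝕤] (W : S) : 𝕤 ▷ W ≫ inv 𝕤 ▷ W = 𝟙 _ := by
  rw [← comp_whiskerRight, IsIso.hom_inv_id, id_whiskerRight]

@[simp]
lemma inv_antipode [IsIso 𝕤] (W : S) : inv 𝕤 ▷ W ≫ 𝕤 ▷ W = 𝟙 _ := by
  rw [← comp_whiskerRight, IsIso.inv_hom_id, id_whiskerRight]

@[simp]
lemma inv_antipode_assoc : type_of% (reassoc_of% @inv_antipode) := @(reassoc_of% @inv_antipode)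

/-- $S^{-1}(h_2)h_1=\varepsilon(h)$: since $S$ reverses products along the braiding, applying it
cancels the inverse braiding and leaves the ordinary antipode axiom. -/
lemma inv_antipode_right [IsIso 𝕤] (W : S) :
    𝕕 W ≫ H ◁ inv 𝕤 ▷ W ≫ bri H H W ≫ 𝕞 W = 𝕖 W ≫ 𝕦 W := by
  rw [← cancel_mono (𝕤 ▷ W)]
  simp only [Category.assoc, mul_antipode, one_antipode]
  rw [← bri_whisker_assoc, ← whisker_bri_assoc, bri_br_assoc, whisker_exchange_assoc,
    ← whiskerLeft_comp_assoc, inv_antipode, whiskerLeft_id, Category.id_comp, antipode_left]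

lemma inv_antipode_left [IsIso 𝕤] (W : S) :
    𝕕 W ≫ inv 𝕤 ▷ (H ⊗ W) ≫ bri H H W ≫ 𝕞 W = 𝕖 W ≫ 𝕦 W := by
  rw [← cancel_mono (𝕤 ▷ W)]
  simp only [Category.assoc, mul_antipode, one_antipode]
  rw [← bri_whisker_assoc, inv_antipode_assoc, ← whisker_bri_assoc, bri_br_assoc,
    antipode_right]

end

end HopfLaws

/-! ### Modules and the operators underlying the associators -/

section Actions

variable {S : Type u} [Category.{v} S] [MonoidalCategory S] [BraidedCategory S]
variable {H : S} [HopfObj H]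

local notation "𝕞" => fuse (MonObj.mul (X := H))
local notation "𝕕" => fork (ComonObj.comul (X := H))
local notation "𝕦" => ins (MonObj.one (X := H))
local notation "𝕖" => cap (ComonObj.counit (X := H))
local notation "𝕤" => HopfObj.antipode (X := H)

/-- The axioms of an action of `H` on `M`. -/
structure IsAct {M : S} (r : H ⊗ M ⟶ M) : Prop where
  mul : 𝕞 M ≫ r = H ◁ r ≫ r
  one : 𝕦 M ≫ r = 𝟙 M

/-- Two actions on the same object commute, the second one acting further to the right. -/
def Comm {N : S} (r s : H ⊗ N ⟶ N) : Prop :=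
  H ◁ r ≫ s = br H H N ≫ H ◁ s ≫ r

/-- The action on `X ⊗ M` obtained by moving `H` past `X`. -/
def lact (X : S) {M : S} (r : H ⊗ M ⟶ M) : H ⊗ (X ⊗ M) ⟶ X ⊗ M :=
  br H X M ≫ X ◁ r

/-- The diagonal action of two commuting actions. -/
def diag {N : S} (r s : H ⊗ N ⟶ N) : H ⊗ N ⟶ N :=
  𝕕 N ≫ H ◁ s ≫ r

/-- `h ⊗ m ↦ h₁ ⊗ h₂ m`. -/
def vOp {M : S} (r : H ⊗ M ⟶ M) : H ⊗ M ⟶ H ⊗ M :=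
  𝕕 M ≫ H ◁ r

/-- `h ⊗ m ↦ h x₁ ⊗ x₂ m`. -/
def dOp (x : 𝟙_ S ⟶ H ⊗ H) {M : S} (r : H ⊗ M ⟶ M) : H ⊗ M ⟶ H ⊗ M :=
  H ◁ ins₂ x M ≫ 𝕞 (H ⊗ M) ≫ H ◁ r

/-- The action of `x` by two commuting actions. -/
def gOp (x : 𝟙_ S ⟶ H ⊗ H) {N : S} (r s : H ⊗ N ⟶ N) : N ⟶ N :=
  ins₂ x N ≫ H ◁ s ≫ r

/-- `h ⊗ a ↦ h₁ a ⊗ h₂`. -/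
def uOp {A : S} (r : H ⊗ A ⟶ A) (W : S) : H ⊗ (A ⊗ W) ⟶ A ⊗ (H ⊗ W) :=
  𝕕 (A ⊗ W) ≫ H ◁ br H A W ≫ fuse r (H ⊗ W)

lemma isAct_act (M : Mod S H) : IsAct (act M) where
  mul := by
    rw [fuse, Category.assoc, act_mul, Iso.inv_hom_id_assoc]
  one := by
    rw [ins, Category.assoc, act_one, Iso.inv_hom_id]

lemma isAct_reg (W : S) : IsAct (𝕞 W) where
  mul := mul_mul H W
  one := one_mul H W

lemma IsAct.lact {M : S} {r : H ⊗ M ⟶ M} (hr : IsAct r) (X : S) : IsAct (lact X r) where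
  mul := by
    rw [HopfExt.lact, fuse_braid_assoc, ← whiskerLeft_comp, hr.mul, whiskerLeft_comp,
      whiskerLeft_comp, Category.assoc, br_nat_assoc]
  one := by
    rw [HopfExt.lact, ins_braid_assoc, ← whiskerLeft_comp, hr.one, whiskerLeft_id]

lemma fuse_fuse {A : S} (r : H ⊗ A ⟶ A) (W : S) :
    H ◁ fuse r W ≫ fuse r W = (H ◁ (α_ H A W).inv ≫ (α_ H (H ⊗ A) W).inv) ≫
      (H ◁ r ≫ r) ▷ W := by
  simp only [fuse]
  monoidal

lemma IsAct.fuse {A : S} {r : H ⊗ A ⟶ A} (hr : IsAct r) (W : S) : IsAct (fuse r W) where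
  mul := by
    rw [fuse_fuse, ← hr.mul]
    simp only [HopfExt.fuse, comp_whiskerRight, Category.assoc]
    monoidal
  one := by
    have h := hr.one
    have h' : 𝕦 A ▷ W ≫ r ▷ W = 𝟙 _ := by
      rw [← comp_whiskerRight, h, id_whiskerRight]
    rw [← h', HopfExt.fuse]
    simp only [ins]
    monoidal

/-- The two actions live on disjoint strands, so exchanging them only braids the two copies of `H`.
The commutation hypotheses needed for the pentagons come from this case. -/
lemma comm_fuse_lact {A M : S} (r : H ⊗ A ⟶ A) (s : H ⊗ M ⟶ M) :
    Comm (fuse r M) (lact A s) := by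
  rw [Comm, lact, braid_fuse_assoc, ← fuse_nat, whiskerLeft_comp, Category.assoc]

lemma Comm.lact {N : S} {r s : H ⊗ N ⟶ N} (h : Comm r s) (X : S) :
    Comm (lact X r) (lact X s) := by
  rw [Comm] at h ⊢
  simp only [HopfExt.lact, whiskerLeft_comp, Category.assoc]
  rw [br_nat_assoc, ← whiskerLeft_comp, h, br_nat_assoc, whiskerLeft_comp, br_br_br_assoc,
    whiskerLeft_comp]

lemma IsAct.diag {N : S} {r s : H ⊗ N ⟶ N} (hr : IsAct r) (hs : IsAct s) (h : Comm r s) :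
    IsAct (diag r s) where
  mul := by
    simp only [HopfExt.diag, whiskerLeft_comp, Category.assoc]
    rw [mul_comul_assoc, ← whiskerLeft_comp_assoc _ (𝕞 N), hs.mul, ← fuse_nat_assoc, hr.mul]
    simp only [whiskerLeft_comp, Category.assoc]
    rw [← whiskerLeft_comp_assoc H (br H H (H ⊗ N)), ← br_nat, whiskerLeft_comp_assoc,
      ← whiskerLeft_comp_assoc H (H ◁ s), ← whiskerLeft_comp_assoc H (br H H N), ← h]
    simp only [whiskerLeft_comp_assoc, fork_nat_assoc]
  one := by
    rw [HopfExt.diag, one_comul_assoc, ← ins_nat_assoc, reassoc_of% hs.one, hr.one]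

/-! ### Naturality -/

section Naturality

variable {M M' : S} {r s : H ⊗ M ⟶ M} {r' s' : H ⊗ M' ⟶ M'} {f : M ⟶ M'}

lemma vOp_natural (h : r ≫ f = H ◁ f ≫ r') : H ◁ f ≫ vOp r' = vOp r ≫ H ◁ f := by
  rw [vOp, fork_nat_assoc, ← whiskerLeft_comp, ← h, whiskerLeft_comp, vOp, Category.assoc]

lemma dOp_natural (x : 𝟙_ S ⟶ H ⊗ H) (h : r ≫ f = H ◁ f ≫ r') :
    H ◁ f ≫ dOp x r' = dOp x r ≫ H ◁ f := by
  rw [dOp, ← whiskerLeft_comp_assoc, ins₂_nat, whiskerLeft_comp_assoc, fuse_nat_assoc,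
    ← whiskerLeft_comp, ← h, whiskerLeft_comp, dOp, Category.assoc, Category.assoc]

lemma gOp_natural (x : 𝟙_ S ⟶ H ⊗ H) (hr : r ≫ f = H ◁ f ≫ r') (hs : s ≫ f = H ◁ f ≫ s') :
    f ≫ gOp x r' s' = gOp x r s ≫ f := by
  rw [gOp, ins₂_nat_assoc, ← whiskerLeft_comp_assoc, ← hs, whiskerLeft_comp_assoc, ← hr, gOp,
    Category.assoc, Category.assoc]

lemma lact_natural (X : S) (h : r ≫ f = H ◁ f ≫ r') :
    lact X r ≫ X ◁ f = H ◁ X ◁ f ≫ lact X r' := by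
  rw [lact, lact, br_nat_assoc, ← whiskerLeft_comp, ← h, whiskerLeft_comp, Category.assoc]

lemma lact_whiskerRight {X Y : S} (k : X ⟶ Y) (r : H ⊗ M ⟶ M) :
    lact X r ≫ k ▷ M = H ◁ k ▷ M ≫ lact Y r := by
  rw [lact, lact, braid_whisker_assoc, Category.assoc, whisker_exchange]

end Naturality

/-! ### Compatibility with passing a strand -/

lemma vOp_lact (A : S) {M : S} (r : H ⊗ M ⟶ M) :
    vOp (lact A r) ≫ br H A M = br H A M ≫ A ◁ vOp r := by
  rw [vOp, vOp, lact, whiskerLeft_comp, whiskerLeft_comp, fork_braid_assoc, Category.assoc,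
    Category.assoc, br_nat]

lemma dOp_lact (x : 𝟙_ S ⟶ H ⊗ H) (A : S) {M : S} (r : H ⊗ M ⟶ M) :
    dOp x (lact A r) ≫ br H A M = br H A M ≫ A ◁ dOp x r := by
  simp only [dOp, lact, whiskerLeft_comp, Category.assoc]
  rw [br_nat, ← fuse_nat_assoc, fuse_braid_assoc, ← br_nat_assoc H A (ins₂ x M), ← ins₂_braid x A M]
  simp only [whiskerLeft_comp, Category.assoc]

lemma gOp_lact (x : 𝟙_ S ⟶ H ⊗ H) (A : S) {M : S} (r s : H ⊗ M ⟶ M) :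
    gOp x (lact A r) (lact A s) = A ◁ gOp x r s := by
  simp only [gOp, lact, whiskerLeft_comp, Category.assoc]
  rw [br_nat_assoc, ins₂_braid_assoc]

/-- The action of `x` commutes with an action further to the left. -/
lemma gOp_comm_left (x : 𝟙_ S ⟶ H ⊗ H) {N : S} {t r s : H ⊗ N ⟶ N} (hr : Comm t r)
    (hs : Comm t s) : t ≫ gOp x r s = H ◁ gOp x r s ≫ t := by
  rw [Comm] at hr hs
  rw [gOp, ins₂_nat_assoc, ← whiskerLeft_comp_assoc, hs, whiskerLeft_comp_assoc,
    whiskerLeft_comp_assoc, hr, br_nat_assoc, ins₂_braid_assoc]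
  simp only [whiskerLeft_comp, Category.assoc]

/-- The action of `x` commutes with an action further to the right. -/
lemma gOp_comm_right (x : 𝟙_ S ⟶ H ⊗ H) {N : S} {t r s : H ⊗ N ⟶ N} (hr : Comm r t)
    (hs : Comm s t) : t ≫ gOp x r s = H ◁ gOp x r s ≫ t := by
  rw [Comm] at hr hs
  rw [gOp, whiskerLeft_comp, whiskerLeft_comp, Category.assoc, Category.assoc, hr,
    br_nat_assoc, ← whiskerLeft_comp_assoc, hs, whiskerLeft_comp_assoc, braid_ins₂_assoc,
    ins₂_nat_assoc, whiskerLeft_comp_assoc]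

/-! ### Identities that follow from coassociativity -/

lemma vOp_diag {N : S} (r s : H ⊗ N ⟶ N) : vOp (diag r s) = vOp s ≫ vOp r := by
  simp only [vOp, diag, whiskerLeft_comp, Category.assoc]
  rw [fork_nat_assoc, comul_comul_assoc]

lemma uOp_vOp {A M : S} (r : H ⊗ A ⟶ A) (s : H ⊗ M ⟶ M) :
    uOp r M ≫ A ◁ vOp s = vOp (lact A s) ≫ uOp r M := by
  simp only [vOp, uOp, lact, whiskerLeft_comp, Category.assoc]
  rw [← fuse_nat_assoc, ← whiskerLeft_comp_assoc _ (br H A M), fork_braid, fork_nat_assoc,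
    fork_nat_assoc, comul_comul_assoc, ← whiskerLeft_comp_assoc _ _ (br H A M), br_nat]
  simp only [whiskerLeft_comp, Category.assoc, fuse_nat]

/-- `h ⊗ m ↦ h₁ ⊗ S(h₂) m`. -/
def vInv {M : S} (r : H ⊗ M ⟶ M) : H ⊗ M ⟶ H ⊗ M :=
  𝕕 M ≫ H ◁ 𝕤 ▷ M ≫ H ◁ r

lemma vOp_vInv {M : S} {r : H ⊗ M ⟶ M} (hr : IsAct r) : vOp r ≫ vInv r = 𝟙 _ := by
  rw [vOp, vInv, Category.assoc, fork_nat_assoc, comul_comul_assoc,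
    ← whiskerLeft_comp_assoc _ _ (𝕤 ▷ M), whisker_exchange, whiskerLeft_comp_assoc,
    ← whiskerLeft_comp _ _ r, ← hr.mul]
  simp only [← whiskerLeft_comp]
  rw [antipode_left_assoc, hr.one, Category.comp_id, comul_counit_right]

lemma vInv_vOp {M : S} {r : H ⊗ M ⟶ M} (hr : IsAct r) : vInv r ≫ vOp r = 𝟙 _ := by
  rw [vOp, vInv, Category.assoc, Category.assoc, fork_nat_assoc, fork_nat_assoc, comul_comul_assoc,
    ← whiskerLeft_comp _ _ r, ← hr.mul]
  simp only [← whiskerLeft_comp]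
  rw [antipode_right_assoc, hr.one, Category.comp_id, comul_counit_right]

/-! ### Linearity -/

/-- This lemma and the next two are the reason why the associators of degree 110, 101 and, through
its inverse, 011 are morphisms of `H`-modules. -/
lemma vOp_linear {M : S} {s : H ⊗ M ⟶ M} (hs : IsAct s) :
    𝕞 M ≫ vOp s = H ◁ vOp s ≫ diag (𝕞 M) (lact H s) := by
  simp only [vOp, diag, lact, whiskerLeft_comp, Category.assoc]
  rw [mul_comul_assoc, ← whiskerLeft_comp H (𝕞 M), hs.mul]
  simp only [fork_nat_assoc]
  rw [← whiskerLeft_comp_assoc _ (H ◁ H ◁ s), br_nat, whiskerLeft_comp_assoc]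
  simp only [whiskerLeft_comp, Category.assoc, fuse_nat, fuse_nat_assoc]

lemma dOp_linear (x : 𝟙_ S ⟶ H ⊗ H) {M : S} (s : H ⊗ M ⟶ M) :
    𝕞 M ≫ dOp x s = H ◁ dOp x s ≫ 𝕞 M := by
  simp only [dOp, whiskerLeft_comp, Category.assoc]
  rw [← fuse_nat_assoc, mul_mul_assoc, fuse_nat]

lemma uOp_linear {A : S} {r : H ⊗ A ⟶ A} (hr : IsAct r) (W : S) :
    𝕞 (A ⊗ W) ≫ uOp r W = H ◁ uOp r W ≫ diag (fuse r (H ⊗ W)) (lact A (𝕞 W)) := by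
  simp only [uOp, diag, lact, whiskerLeft_comp, Category.assoc]
  rw [mul_comul_assoc, ← whiskerLeft_comp_assoc _ (𝕞 (A ⊗ W)), fuse_braid, ← fuse_nat_assoc,
    (hr.fuse _).mul, fork_nat_assoc, fork_nat_assoc, ← whiskerLeft_comp_assoc _ (H ◁ fuse r _),
    braid_fuse]
  simp only [whiskerLeft_comp, Category.assoc, fuse_nat, fuse_nat_assoc, fork_nat_assoc]
  simp only [whiskerLeft_br_nat_assoc, whiskerLeft_fuse_nat_assoc, fuse_nat]

/-! ### The inverse of `uOp` -/

section

variable [IsIso (HopfObj.antipode (X := H))]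

/-- `a ⊗ h ↦ h₂ ⊗ S⁻¹(h₁) a`. -/
noncomputable def tOp {A : S} (r : H ⊗ A ⟶ A) (W : S) : A ⊗ (H ⊗ W) ⟶ H ⊗ (A ⊗ W) :=
  bri H A W ≫ 𝕕 (A ⊗ W) ≫ bri H H (A ⊗ W) ≫ H ◁ inv 𝕤 ▷ (A ⊗ W) ≫ H ◁ fuse r W

lemma uOp_bri {A : S} (r : H ⊗ A ⟶ A) (W : S) :
    uOp r W ≫ bri H A W = 𝕕 (A ⊗ W) ≫ bri H H (A ⊗ W) ≫ H ◁ fuse r W := by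
  rw [uOp, Category.assoc, Category.assoc, bri_fuse, whiskerLeft_br_bri_assoc]

lemma uOp_bri_assoc : type_of% (reassoc_of% @uOp_bri) := @(reassoc_of% @uOp_bri)

/-- On elements, $h_3\otimes S^{-1}(h_2)h_1=h\otimes 1$. -/
lemma comul_bri_comul (W : S) :
    𝕕 W ≫ bri H H W ≫ 𝕕 (H ⊗ W) ≫ bri H H (H ⊗ W) ≫ H ◁ inv 𝕤 ▷ (H ⊗ W) ≫ H ◁ 𝕞 W =
      H ◁ 𝕦 W := by
  rw [bri_fork_assoc, ← comul_comul_assoc, bri_bri_bri_assoc, ← fork_bri_assoc]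
  simp only [← whiskerLeft_comp]
  rw [← whisker_bri_assoc, inv_antipode_right, whiskerLeft_comp, cap_bri_assoc,
    comul_counit_left_assoc]

/-- On elements, $h_2S^{-1}(h_1)\otimes h_3=1\otimes h$. -/
lemma comul_inv_antipode_comul (W : S) :
    𝕕 W ≫ bri H H W ≫ H ◁ inv 𝕤 ▷ W ≫ 𝕕 (H ⊗ W) ≫ H ◁ br H H W ≫ 𝕞 (H ⊗ W) = 𝕦 (H ⊗ W) := by
  rw [← bri_whisker_assoc, bri_fork_assoc, whiskerLeft_bri_br_assoc, ← whisker_exchange_assoc,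
    ← comul_comul_assoc, inv_antipode_left, comul_counit_left_assoc]

lemma uOp_tOp {A : S} {r : H ⊗ A ⟶ A} (hr : IsAct r) (W : S) : uOp r W ≫ tOp r W = 𝟙 _ := by
  rw [tOp, uOp_bri_assoc, fork_nat_assoc, bri_nat_assoc, ← whiskerLeft_comp_assoc _ _ (inv 𝕤 ▷ _),
    whisker_exchange, whiskerLeft_comp_assoc, ← whiskerLeft_comp, ← (hr.fuse W).mul,
    whiskerLeft_comp, reassoc_of% comul_bri_comul, ← whiskerLeft_comp, (hr.fuse W).one,
    whiskerLeft_id]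

lemma tOp_uOp {A : S} {r : H ⊗ A ⟶ A} (hr : IsAct r) (W : S) : tOp r W ≫ uOp r W = 𝟙 _ := by
  simp only [tOp, uOp, Category.assoc]
  rw [fork_nat_assoc, ← whiskerLeft_comp_assoc _ (H ◁ fuse r W), braid_fuse]
  simp only [whiskerLeft_comp, Category.assoc]
  rw [← (hr.fuse (H ⊗ W)).mul, fuse_nat_assoc, reassoc_of% comul_inv_antipode_comul,
    ← ins_nat_assoc,
    (hr.fuse (H ⊗ W)).one, Category.comp_id, bri_br]

end

end Actions

/-! ### Hopf copairings and the inverse of their action -/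

section Copairing

variable {S : Type u} [Category.{v} S] [MonoidalCategory S] [BraidedCategory S]
variable {H : S} [HopfObj H]

local notation "𝕞" => fuse (MonObj.mul (X := H))
local notation "𝕕" => fork (ComonObj.comul (X := H))
local notation "𝕦" => ins (MonObj.one (X := H))
local notation "𝕖" => cap (ComonObj.counit (X := H))
local notation "𝕤" => HopfObj.antipode (X := H)

/-- A nondegenerate Hopf copairing `e₁ ⊗ e₂`, with the second tensor leg multiplied in the opposite
order. -/
structure IsHopfCopairing (E : 𝟙_ S ⟶ H ⊗ H) : Prop where
  comul_left (W : S) :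
    ins₂ E W ≫ 𝕕 (H ⊗ W) = ins₂ E W ≫ H ◁ ins₂ E (H ⊗ W) ≫ H ◁ H ◁ 𝕞 W
  comul_right (W : S) :
    ins₂ E W ≫ H ◁ 𝕕 W = ins₂ E W ≫ H ◁ ins₂ E (H ⊗ W) ≫ 𝕞 (H ⊗ H ⊗ W)
  counit_left (W : S) : ins₂ E W ≫ 𝕖 (H ⊗ W) = 𝕦 W
  counit_right (W : S) : ins₂ E W ≫ H ◁ 𝕖 W = 𝕦 W
  antipode (W : S) : ins₂ E W ≫ 𝕤 ▷ (H ⊗ W) = ins₂ E W ≫ H ◁ 𝕤 ▷ W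
  cancel {W Z : S} (f f' : H ⊗ W ⟶ Z) (h : ins₂ E W ≫ H ◁ f = ins₂ E W ≫ H ◁ f') : f = f'

/-- `e₁ ⊗ S⁻¹(e₂)`. -/
noncomputable def gam [IsIso 𝕤] (E : 𝟙_ S ⟶ H ⊗ H) : 𝟙_ S ⟶ H ⊗ H :=
  E ≫ H ◁ inv 𝕤

/-- `e₁ ⊗ S(e₂) g`. -/
def del (E : 𝟙_ S ⟶ H ⊗ H) (g : 𝟙_ S ⟶ H) : 𝟙_ S ⟶ H ⊗ H :=
  E ≫ H ◁ (𝕤 ≫ mulR g)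

lemma ins₂_gam [IsIso 𝕤] (E : 𝟙_ S ⟶ H ⊗ H) (W : S) :
    ins₂ (gam E) W = ins₂ E W ≫ H ◁ inv 𝕤 ▷ W := by
  rw [gam, ins₂_right]

lemma ins₂_gam_assoc : type_of% (reassoc_of% @ins₂_gam) := @(reassoc_of% @ins₂_gam)

lemma ins₂_del (E : 𝟙_ S ⟶ H ⊗ H) (g : 𝟙_ S ⟶ H) (W : S) :
    ins₂ (del E g) W = ins₂ E W ≫ H ◁ 𝕤 ▷ W ≫ H ◁ mulR g ▷ W := by
  rw [del, ← ins₂_right, comp_whiskerRight, whiskerLeft_comp]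

lemma mulR_whiskerRight (g : 𝟙_ S ⟶ H) (W : S) : mulR g ▷ W = H ◁ ins g W ≫ 𝕞 W := by
  simp only [mulR, ins, fuse, comp_whiskerRight]
  monoidal

lemma mulL_whiskerRight (g : 𝟙_ S ⟶ H) (W : S) : mulL g ▷ W = ins g (H ⊗ W) ≫ 𝕞 W := by
  simp only [mulL, ins, fuse, comp_whiskerRight]
  monoidal

namespace IsHopfCopairing

variable {E : 𝟙_ S ⟶ H ⊗ H} (hE : IsHopfCopairing E)
include hE

/-- The antipode axiom of the copairing lets $S^{-1}$ change legs, so also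
$\gamma=S^{-1}(e_1)\otimes e_2$. -/
lemma ins₂_gam' [IsIso 𝕤] (W : S) : ins₂ (gam E) W = ins₂ E W ≫ inv 𝕤 ▷ (H ⊗ W) := by
  rw [ins₂_gam, ← cancel_mono (𝕤 ▷ (H ⊗ W))]
  simp only [Category.assoc, inv_antipode, Category.comp_id]
  rw [whisker_exchange, ← Category.assoc, hE.antipode, Category.assoc, ← whiskerLeft_comp,
    antipode_inv, whiskerLeft_id, Category.comp_id]

/-- $E\gamma=1\otimes1$ in the braided tensor product algebra $H\otimes H$. With $S^{-1}$ on the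
first leg of $\gamma$, the two copies of $E$ combine into $(\Delta\otimes\mathrm{id})E$, to which
the axiom for $S^{-1}$ applies. -/
lemma gam_mul [IsIso 𝕤] (W : S) :
    ins₂ (gam E) W ≫ ins₂ E (H ⊗ H ⊗ W) ≫ H ◁ br H H (H ⊗ W) ≫ 𝕞 (H ⊗ H ⊗ W) ≫ H ◁ 𝕞 W =
      𝕦 W ≫ 𝕦 (H ⊗ W) := by
  have h := ins₂_braid E H (H ⊗ W)
  rw [← cancel_mono (bri H H (H ⊗ H ⊗ W)), Category.assoc, Category.assoc, br_bri,
    Category.comp_id] at h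
  rw [reassoc_of% h, ← fuse_nat, ← bri_nat_assoc, hE.ins₂_gam', Category.assoc,
    ← whisker_exchange_assoc, ← whisker_exchange_assoc, ← reassoc_of% hE.comul_left W,
    inv_antipode_left, reassoc_of% hE.counit_left W]

lemma mul_gam [IsIso 𝕤] (W : S) :
    ins₂ E W ≫ ins₂ (gam E) (H ⊗ H ⊗ W) ≫ H ◁ br H H (H ⊗ W) ≫ 𝕞 (H ⊗ H ⊗ W) ≫ H ◁ 𝕞 W =
      𝕦 W ≫ 𝕦 (H ⊗ W) := by
  have h := ins₂_braid (gam E) H (H ⊗ W)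
  rw [← cancel_mono (bri H H (H ⊗ H ⊗ W)), Category.assoc, Category.assoc, br_bri,
    Category.comp_id] at h
  rw [reassoc_of% h, ← fuse_nat, ← bri_nat_assoc, hE.ins₂_gam', whiskerLeft_comp_assoc,
    ← whiskerLeft_comp_assoc _ (inv 𝕤 ▷ (H ⊗ H ⊗ W)), ← whisker_exchange, whiskerLeft_comp_assoc,
    ← reassoc_of% hE.comul_left W, inv_antipode_right, reassoc_of% hE.counit_left W]

end IsHopfCopairing

/-- Two commuting actions amount to an action of the braided tensor product algebra $H\otimes H$;
the bracket on the right is the product $yx$. -/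
lemma gOp_comp (x y : 𝟙_ S ⟶ H ⊗ H) {N : S} {r s : H ⊗ N ⟶ N} (hr : IsAct r) (hs : IsAct s)
    (h : Comm r s) :
    gOp x r s ≫ gOp y r s = (ins₂ x N ≫ ins₂ y (H ⊗ H ⊗ N) ≫ H ◁ br H H (H ⊗ N) ≫
      𝕞 (H ⊗ H ⊗ N) ≫ H ◁ 𝕞 N) ≫ H ◁ s ≫ r := by
  rw [Comm] at h
  simp only [gOp, Category.assoc]
  rw [ins₂_nat_assoc, ins₂_nat_assoc, ← whiskerLeft_comp_assoc _ _ s, h, whiskerLeft_comp_assoc,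
    whiskerLeft_comp_assoc, ← hr.mul, ← whiskerLeft_comp_assoc _ _ (br H H N), br_nat,
    whiskerLeft_comp_assoc, ← whiskerLeft_comp_assoc _ _ (H ◁ s), ← whiskerLeft_comp, ← hs.mul,
    whiskerLeft_comp, whiskerLeft_comp_assoc, fuse_nat_assoc, fuse_nat_assoc]

lemma gOp_one {N : S} {r s : H ⊗ N ⟶ N} (hr : IsAct r) (hs : IsAct s) :
    (𝕦 N ≫ 𝕦 (H ⊗ N)) ≫ H ◁ s ≫ r = 𝟙 N := by
  rw [Category.assoc, ← ins_nat_assoc, reassoc_of% hs.one, hr.one]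

namespace IsHopfCopairing

variable {E : 𝟙_ S ⟶ H ⊗ H} (hE : IsHopfCopairing E)
include hE

lemma gOp_gam_comp [IsIso 𝕤] {N : S} {r s : H ⊗ N ⟶ N} (hr : IsAct r) (hs : IsAct s)
    (h : Comm r s) : gOp (gam E) r s ≫ gOp E r s = 𝟙 N := by
  rw [gOp_comp _ _ hr hs h, hE.gam_mul, gOp_one hr hs]

lemma gOp_comp_gam [IsIso 𝕤] {N : S} {r s : H ⊗ N ⟶ N} (hr : IsAct r) (hs : IsAct s)
    (h : Comm r s) : gOp E r s ≫ gOp (gam E) r s = 𝟙 N := by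
  rw [gOp_comp _ _ hr hs h, hE.mul_gam, gOp_one hr hs]

/-- The bicharacter property $(\Delta\otimes\mathrm{id})E=e_1\otimes e'_1\otimes e'_2e_2$, once the
action of one copy of `E` has been moved past `r₁`. -/
lemma gOp_diag_left {N : S} {r₁ r₂ r₃ : H ⊗ N ⟶ N} (hr : IsAct r₃) (h₁₂ : Comm r₁ r₂)
    (h₁₃ : Comm r₁ r₃) : gOp E (diag r₁ r₂) r₃ = gOp E r₁ r₃ ≫ gOp E r₂ r₃ := by
  have h := gOp_comm_left E h₁₂ h₁₃
  simp only [gOp, Category.assoc] at h ⊢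
  rw [h, diag, fork_nat_assoc, reassoc_of% hE.comul_left, ← whiskerLeft_comp_assoc _ (H ◁ 𝕞 N),
    ← whiskerLeft_comp, hr.mul]
  simp only [whiskerLeft_comp, Category.assoc]
  rw [← whiskerLeft_comp_assoc _ r₃ (ins₂ E N), ins₂_nat, whiskerLeft_comp_assoc]

lemma gOp_diag_right {N : S} {r₁ r₂ r₃ : H ⊗ N ⟶ N} (hr : IsAct r₁) (h₁₃ : Comm r₁ r₃)
    (h₂₃ : Comm r₂ r₃) : gOp E r₁ (diag r₂ r₃) = gOp E r₁ r₂ ≫ gOp E r₁ r₃ := by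
  have h := gOp_comm_right E h₁₃ h₂₃
  rw [show gOp E r₁ r₃ = ins₂ E N ≫ H ◁ r₃ ≫ r₁ from rfl, ins₂_nat_assoc,
    ← whiskerLeft_comp_assoc, ← h]
  simp only [gOp, diag]
  simp only [whiskerLeft_comp, Category.assoc]
  rw [reassoc_of% hE.comul_right, ← fuse_nat_assoc, ← fuse_nat_assoc, hr.mul,
    ← whiskerLeft_comp_assoc _ r₃ (ins₂ E N), ins₂_nat, whiskerLeft_comp_assoc]

end IsHopfCopairing

end Copairing

/-! ### Coproducts of the two legs of δ -/

section

variable {S : Type u} [Category.{v} S] [MonoidalCategory S] [BraidedCategory S]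
variable {H : S} [HopfObj H]

local notation "𝕞" => fuse (MonObj.mul (X := H))
local notation "𝕕" => fork (ComonObj.comul (X := H))
local notation "𝕦" => ins (MonObj.one (X := H))
local notation "𝕖" => cap (ComonObj.counit (X := H))
local notation "𝕤" => HopfObj.antipode (X := H)

/-- `h ↦ S(h) g`. -/
def antiR (g : 𝟙_ S ⟶ H) : H ⟶ H := 𝕤 ≫ mulR g

variable (H) in
/-- A nondegenerate Hopf copairing together with a normalised cointegral whose distinguished element
relates the two tensor legs of the copairing. -/
structure HopfDatum [IsIso (HopfObj.antipode (X := H))] (E : 𝟙_ S ⟶ H ⊗ H) (lam : H ⟶ 𝟙_ S)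
    (g gi : 𝟙_ S ⟶ H) : Prop extends IsHopfCopairing E where
  cointegral (W : S) : 𝕕 W ≫ cap lam (H ⊗ W) = cap lam W ≫ 𝕦 W
  distinguished (W : S) : 𝕕 W ≫ H ◁ cap lam W = cap lam W ≫ ins g W
  normalised (W : S) : ins₂ E W ≫ H ◁ cap lam W ≫ cap lam W = 𝟙 W
  symm (W : S) : ins₂ (del E g) W ≫ br H H W = ins₂ (gam E) W ≫ ins g (H ⊗ H ⊗ W) ≫ 𝕞 (H ⊗ W)
  g_counit (W : S) : ins g W ≫ 𝕖 W = 𝟙 W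
  g_comul (W : S) : ins g W ≫ 𝕕 W = ins g W ≫ ins g (H ⊗ W)
  gi_g (W : S) : ins gi W ≫ ins g (H ⊗ W) ≫ 𝕞 W = 𝕦 W
  g_gi (W : S) : ins g W ≫ ins gi (H ⊗ W) ≫ 𝕞 W = 𝕦 W

lemma mul_mulR (g : 𝟙_ S ⟶ H) (W : S) : 𝕞 W ≫ mulR g ▷ W = H ◁ mulR g ▷ W ≫ 𝕞 W := by
  simp only [mulR_whiskerRight, whiskerLeft_comp, Category.assoc]
  rw [← mul_mul, fuse_nat_assoc]

lemma mulL_mul (g : 𝟙_ S ⟶ H) (W : S) : mulL g ▷ (H ⊗ W) ≫ 𝕞 W = 𝕞 W ≫ mulL g ▷ W := by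
  simp only [mulL_whiskerRight, Category.assoc]
  rw [mul_mul, ins_nat_assoc]

lemma ins₂_del_antiR (E : 𝟙_ S ⟶ H ⊗ H) (g : 𝟙_ S ⟶ H) (W : S) :
    ins₂ (del E g) W = ins₂ E W ≫ H ◁ antiR g ▷ W := by
  rw [del, ← ins₂_right, antiR]

lemma mul_antiR (g : 𝟙_ S ⟶ H) (W : S) :
    𝕞 W ≫ antiR g ▷ W = H ◁ 𝕤 ▷ W ≫ antiR g ▷ (H ⊗ W) ≫ br H H W ≫ 𝕞 W := by
  rw [antiR, comp_whiskerRight, mul_antipode_assoc, mul_mulR, comp_whiskerRight,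
    ← whisker_braid_assoc, Category.assoc]

namespace HopfDatum

variable [IsIso (HopfObj.antipode (X := H))] {E : 𝟙_ S ⟶ H ⊗ H} {lam : H ⟶ 𝟙_ S}
  {g gi : 𝟙_ S ⟶ H} (D : HopfDatum H E lam g gi)
include D

lemma mulR_comul (W : S) :
    mulR g ▷ W ≫ 𝕕 W = 𝕕 W ≫ mulR g ▷ (H ⊗ W) ≫ H ◁ mulR g ▷ W := by
  simp only [mulR_whiskerRight, whiskerLeft_comp, Category.assoc]
  rw [mul_comul, ← whiskerLeft_comp_assoc, D.g_comul]
  simp only [whiskerLeft_comp, Category.assoc, fork_nat_assoc]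
  rw [← whiskerLeft_comp_assoc _ _ (br H H (H ⊗ W)), braid_ins,
    ← whiskerLeft_comp_assoc _ _ (ins g (H ⊗ H ⊗ W)), ins_nat]
  simp only [whiskerLeft_comp, Category.assoc, fuse_nat_assoc]

lemma antiR_comul (W : S) :
    antiR g ▷ W ≫ 𝕕 W = 𝕕 W ≫ br H H W ≫ antiR g ▷ (H ⊗ W) ≫ H ◁ antiR g ▷ W := by
  simp only [antiR, comp_whiskerRight, whiskerLeft_comp, Category.assoc]
  rw [D.mulR_comul, antipode_comul_assoc, whisker_exchange_assoc]

/-- $g$ is grouplike and $S$ reverses the coproduct. The reversal exchanges the two second legs,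
whereas the first legs are multiplied as for $E$. -/
lemma del_comul_right (W : S) :
    ins₂ (del E g) W ≫ H ◁ 𝕕 W =
      ins₂ (del E g) W ≫ H ◁ ins₂ (del E g) (H ⊗ W) ≫ H ◁ H ◁ br H H W ≫ 𝕞 (H ⊗ H ⊗ W) := by
  simp only [ins₂_del_antiR, whiskerLeft_comp, Category.assoc]
  rw [← whiskerLeft_comp, D.antiR_comul, whiskerLeft_comp, reassoc_of% D.comul_right]
  simp only [← whiskerLeft_comp, ← whiskerLeft_comp_assoc, Category.assoc]
  rw [ins₂_nat_assoc]
  simp only [← whiskerLeft_comp, ← whiskerLeft_comp_assoc, Category.assoc]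
  rw [whisker_exchange_assoc, braid_whisker, whisker_braid_assoc]
  simp only [whiskerLeft_comp, Category.assoc, fork_nat, fork_nat_assoc, fuse_nat, fuse_nat_assoc,
    br_nat, br_nat_assoc, bri_nat, bri_nat_assoc, cap_nat, cap_nat_assoc, whisker_exchange,
    whisker_exchange_assoc, whiskerLeft_fork_nat, whiskerLeft_fork_nat_assoc,
    whiskerLeft_fuse_nat, whiskerLeft_fuse_nat_assoc, whiskerLeft_br_nat,
    whiskerLeft_br_nat_assoc, whiskerLeft_cap_nat, whiskerLeft_whisker_exchange,
    whiskerLeft_whisker_exchange_assoc, whiskerLeft₂_br_nat, whiskerLeft₂_br_nat_assoc]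

/-- Only one of the two factors produced by the coproduct of $e_1$ keeps the $g$; the other second
leg appears as a bare $S(e_2)$. -/
lemma del_comul_left (W : S) :
    ins₂ (del E g) W ≫ 𝕕 (H ⊗ W) = ins₂ E W ≫ H ◁ 𝕤 ▷ W ≫ H ◁ ins₂ (del E g) (H ⊗ W) ≫
      H ◁ H ◁ br H H W ≫ H ◁ H ◁ 𝕞 W := by
  rw [ins₂_del_antiR, Category.assoc, fork_nat, reassoc_of% D.comul_left]
  rw [← whiskerLeft_comp H (H ◁ 𝕞 W), ← whiskerLeft_comp H (𝕞 W), mul_antiR, ins₂_del_antiR]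
  simp only [whiskerLeft_comp, Category.assoc, whiskerLeft_ins₂_nat_assoc]

/-- The right side is $\delta_1\otimes\delta_2\gamma_1\otimes\gamma_2$. This is where the
self-duality of the copairing is needed: braiding the second copy of $\delta$ turns it into
$g\gamma_1\otimes\gamma_2$, and the $g$ completes the bare $S(e_2)$ to $\delta_2$. -/
lemma del_braid (W : S) :
    ins₂ (del E g) W ≫ 𝕕 (H ⊗ W) ≫ H ◁ br H H W =
      ins₂ (gam E) W ≫ ins₂ (del E g) (H ⊗ H ⊗ W) ≫ H ◁ 𝕞 (H ⊗ W) := by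
  rw [reassoc_of% D.del_comul_left, ← whiskerLeft_comp H (H ◁ 𝕞 W), braid_fuse]
  simp only [← whiskerLeft_comp, ← whiskerLeft_comp_assoc, Category.assoc]
  rw [ins₂_braid_assoc]
  simp only [whiskerLeft_comp, Category.assoc]
  have h := congrArg (fun f => H ◁ H ◁ f) (D.symm W)
  simp only [whiskerLeft_comp, Category.assoc] at h
  rw [reassoc_of% h]
  have h2 := congrArg (fun f => H ◁ f) (mul_mul H (H ⊗ W))
  simp only [whiskerLeft_comp, Category.assoc] at h2
  have h3 := congrArg (fun f => H ◁ f) (mulR_whiskerRight g (H ⊗ H ⊗ W))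
  simp only [whiskerLeft_comp, Category.assoc] at h3
  rw [← h2, ← reassoc_of% h3, ins₂_nat_assoc, ins₂_del_antiR, antiR]
  simp only [comp_whiskerRight, whiskerLeft_comp, Category.assoc,
    whiskerLeft_whisker_exchange_assoc]

lemma mul_del_comul_braid (W : S) :
    H ◁ ins₂ (del E g) W ≫ 𝕞 (H ⊗ W) ≫ 𝕕 (H ⊗ W) ≫ H ◁ br H H W =
      𝕕 W ≫ H ◁ H ◁ ins₂ (gam E) W ≫ H ◁ ins₂ (del E g) (H ⊗ H ⊗ H ⊗ W) ≫
        𝕞 (H ⊗ H ⊗ H ⊗ H ⊗ W) ≫ H ◁ H ◁ br H H (H ⊗ W) ≫ H ◁ 𝕞 (H ⊗ H ⊗ W) ≫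
        H ◁ H ◁ 𝕞 W := by
  rw [mul_comul_assoc, ← whiskerLeft_comp H (𝕞 (H ⊗ W)), fuse_braid]
  simp only [whiskerLeft_comp, Category.assoc]
  rw [← fuse_nat_assoc, ← whiskerLeft_br_nat_assoc, ← fork_nat_assoc]
  simp only [← whiskerLeft_comp, ← whiskerLeft_comp_assoc, Category.assoc]
  rw [D.del_braid]
  simp only [whiskerLeft_comp, Category.assoc]
  rw [fork_nat_assoc, fork_nat_assoc, fork_nat_assoc, whiskerLeft_br_nat_assoc, fuse_nat_assoc,
    ← whiskerLeft_comp_assoc _ _ (br H H _), braid_ins₂_left]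
  have h := congrArg (fun f => H ◁ f) (braid_fuse (MonObj.mul (X := H)) H (H ⊗ W))
  simp only [whiskerLeft_comp, Category.assoc] at h
  simp only [whiskerLeft_comp, Category.assoc]
  rw [reassoc_of% h, ← fuse_nat_assoc, ← whiskerLeft_comp_assoc H (H ◁ bri H H _),
    whiskerLeft_bri_br,
    whiskerLeft_id, Category.id_comp]
  

end HopfDatum

end

/-! ### Relations between the operators of γ and δ -/

section

variable {S : Type u} [Category.{v} S] [MonoidalCategory S] [BraidedCategory S]
variable {H : S} [HopfObj H]

local notation "𝕞" => fuse (MonObj.mul (X := H))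
local notation "𝕕" => fork (ComonObj.comul (X := H))
local notation "𝕦" => ins (MonObj.one (X := H))
local notation "𝕖" => cap (ComonObj.counit (X := H))
local notation "𝕤" => HopfObj.antipode (X := H)

lemma mulR_mul (g : 𝟙_ S ⟶ H) (W : S) : mulR g ▷ (H ⊗ W) ≫ 𝕞 W = H ◁ mulL g ▷ W ≫ 𝕞 W := by
  simp only [mulR_whiskerRight, mulL_whiskerRight, whiskerLeft_comp, Category.assoc]
  rw [mul_mul]

/-- The composite is the operator of $x_1y_1\otimes y_2x_2$: the second legs multiply in the
opposite order. -/
lemma dOp_comp (x y : 𝟙_ S ⟶ H ⊗ H) {M : S} {r : H ⊗ M ⟶ M} (hr : IsAct r) :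
    dOp x r ≫ dOp y r = H ◁ (ins₂ x M ≫ H ◁ ins₂ y (H ⊗ M) ≫ 𝕞 (H ⊗ H ⊗ M) ≫ H ◁ 𝕞 M) ≫
      𝕞 (H ⊗ M) ≫ H ◁ r := by
  simp only [dOp, whiskerLeft_comp, Category.assoc]
  rw [← whiskerLeft_comp_assoc _ r, ins₂_nat]
  simp only [whiskerLeft_comp, Category.assoc, fuse_nat_assoc]
  rw [← fuse_nat_assoc, mul_mul_assoc, ← whiskerLeft_comp _ _ r, ← hr.mul]
  simp only [whiskerLeft_comp, Category.assoc]

lemma dOp_one {M : S} {r : H ⊗ M ⟶ M} (hr : IsAct r) :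
    H ◁ (𝕦 M ≫ H ◁ 𝕦 M) ≫ 𝕞 (H ⊗ M) ≫ H ◁ r = 𝟙 _ := by
  rw [whiskerLeft_comp_assoc, fuse_nat_assoc, mul_one_assoc, ← whiskerLeft_comp, hr.one,
    whiskerLeft_id]

namespace IsHopfCopairing

variable {E : 𝟙_ S ⟶ H ⊗ H} (hE : IsHopfCopairing E)
include hE

/-- $e_1e'_1\otimes e'_2\otimes e_2$ is $(\mathrm{id}\otimes\Delta)E$, so $S$ on the middle leg
collapses it. Together with the next lemma this makes $E$ and $e_1\otimes S(e_2)$ inverse for the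
product $x_1y_1\otimes y_2x_2$. -/
lemma antipode_left_convolution (W : S) :
    ins₂ E W ≫ H ◁ ins₂ E (H ⊗ W) ≫ 𝕞 (H ⊗ H ⊗ W) ≫ H ◁ 𝕤 ▷ (H ⊗ W) ≫ H ◁ 𝕞 W =
      𝕦 W ≫ H ◁ 𝕦 W := by
  rw [← reassoc_of% hE.comul_right]
  simp only [← whiskerLeft_comp, ← whiskerLeft_comp_assoc, Category.assoc]
  rw [antipode_left, whiskerLeft_comp, reassoc_of% hE.counit_right]

lemma antipode_right_convolution (W : S) :
    ins₂ E W ≫ H ◁ ins₂ E (H ⊗ W) ≫ 𝕞 (H ⊗ H ⊗ W) ≫ H ◁ H ◁ 𝕤 ▷ W ≫ H ◁ 𝕞 W =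
      𝕦 W ≫ H ◁ 𝕦 W := by
  rw [← reassoc_of% hE.comul_right]
  simp only [← whiskerLeft_comp, ← whiskerLeft_comp_assoc, Category.assoc]
  rw [antipode_right, whiskerLeft_comp, reassoc_of% hE.counit_right]

end IsHopfCopairing

namespace HopfDatum

variable [IsIso (HopfObj.antipode (X := H))] {E : 𝟙_ S ⟶ H ⊗ H} {lam : H ⟶ 𝟙_ S}
  {g gi : 𝟙_ S ⟶ H} (D : HopfDatum H E lam g gi)
include D

lemma one_mulR_mulL (W : S) : 𝕦 W ≫ mulR g ▷ W ≫ mulL gi ▷ W = 𝕦 W := by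
  rw [mulR_whiskerRight, mulL_whiskerRight, Category.assoc, ← ins_nat_assoc, one_mul_assoc, D.g_gi]

lemma mulL_mulL (W : S) : mulL gi ▷ W ≫ mulL g ▷ W = 𝟙 _ := by
  rw [mulL_whiskerRight, mulL_whiskerRight, Category.assoc, ins_nat_assoc, ← mul_mul,
    reassoc_of% D.gi_g, one_mul]

/-- The inverse of $e_1\otimes S(e_2)g$ for the product $x_1y_1\otimes y_2x_2$ is $e_1\otimes
g^{-1}e_2$. -/
lemma dOp_dInv {M : S} {r : H ⊗ M ⟶ M} (hr : IsAct r) :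
    dOp (del E g) r ≫ dOp (E ≫ H ◁ mulL gi) r = 𝟙 _ := by
  rw [dOp_comp _ _ hr, ← dOp_one hr]
  congr 2
  rw [← ins₂_right, ins₂_del]
  simp only [whiskerLeft_comp, Category.assoc, whiskerLeft_ins₂_nat_assoc, fuse_nat_assoc]
  have h1 := congrArg (fun f => H ◁ f) (mulL_mul gi M)
  simp only [whiskerLeft_comp, Category.assoc] at h1
  have h2 := congrArg (fun f => H ◁ f) (mul_mulR g M)
  simp only [whiskerLeft_comp, Category.assoc] at h2
  rw [h1, ← reassoc_of% h2]
  rw [reassoc_of% D.antipode_right_convolution]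
  simp only [← whiskerLeft_comp, ← whiskerLeft_comp_assoc, Category.assoc]
  rw [D.one_mulR_mulL]

lemma dInv_dOp {M : S} {r : H ⊗ M ⟶ M} (hr : IsAct r) :
    dOp (E ≫ H ◁ mulL gi) r ≫ dOp (del E g) r = 𝟙 _ := by
  rw [dOp_comp _ _ hr, ← dOp_one hr]
  congr 2
  rw [← ins₂_right, ins₂_del, ← D.antipode_left_convolution]
  simp only [whiskerLeft_comp, Category.assoc, whiskerLeft_ins₂_nat_assoc, fuse_nat_assoc]
  have h1 := congrArg (fun f => H ◁ f) (mulR_mul g M)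
  simp only [whiskerLeft_comp, Category.assoc] at h1
  have h2 := congrArg (fun f => H ◁ H ◁ f) (D.mulL_mulL M)
  simp only [whiskerLeft_comp, Category.assoc] at h2
  rw [whiskerLeft_whisker_exchange_assoc, h1, reassoc_of% h2, whiskerLeft_id, whiskerLeft_id,
    Category.id_comp]

lemma dOp_diag {N : S} {r s : H ⊗ N ⟶ N} (h : Comm r s) :
    dOp (del E g) (diag r s) = dOp (del E g) r ≫ dOp (del E g) s := by
  simp only [dOp, diag, whiskerLeft_comp, Category.assoc]
  rw [← fuse_nat_assoc]
  have h1 := congrArg (fun f => H ◁ f) (D.del_comul_right N)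
  simp only [whiskerLeft_comp, Category.assoc] at h1
  rw [reassoc_of% h1, ← mul_mul_assoc]
  rw [← whiskerLeft_comp_assoc H r (ins₂ _ _), ins₂_nat]
  simp only [whiskerLeft_comp, Category.assoc]
  rw [fuse_nat_assoc, fuse_nat_assoc]
  rw [Comm] at h
  have h2 := congrArg (fun f => H ◁ f) (h)
  simp only [whiskerLeft_comp, Category.assoc] at h2
  rw [fuse_nat_assoc, fuse_nat_assoc, ← h2]

/-- The factor $\gamma$ that appears when $\Delta(h\delta_1)$ is braided past $\delta_2$ acts on the
module before the other operators. This is the content of pentagon 1010. -/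
lemma dOp_vOp {M : S} {r s : H ⊗ M ⟶ M} (hr : IsAct r) (hs : IsAct s) (h : Comm r s) :
    dOp (del E g) r ≫ vOp s = H ◁ gOp (gam E) r s ≫ vOp s ≫ dOp (del E g) r := by
  rw [Comm] at h
  simp only [dOp, vOp, gOp, whiskerLeft_comp, Category.assoc, fork_nat_assoc]
  have h1 := congrArg (fun f => H ◁ f) (h)
  simp only [whiskerLeft_comp, Category.assoc] at h1
  rw [h1, reassoc_of% D.mul_del_comul_braid, ← whiskerLeft_comp_assoc H s (ins₂ _ _), ins₂_nat]
  have h3 := congrArg (fun f => H ◁ H ◁ f) (h)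
  simp only [whiskerLeft_comp, Category.assoc] at h3
  simp only [whiskerLeft_comp, Category.assoc]
  have h4 := congrArg (fun f => H ◁ f) (hr.mul)
  simp only [whiskerLeft_comp, Category.assoc] at h4
  have h5 := congrArg (fun f => H ◁ H ◁ f) (hs.mul)
  simp only [whiskerLeft_comp, Category.assoc] at h5
  simp only [whiskerLeft_ins₂_nat_assoc, fuse_nat_assoc]
  rw [reassoc_of% h5, reassoc_of% h3, whiskerLeft₂_br_nat_assoc, ← whiskerLeft_fuse_nat_assoc,
    ← whiskerLeft_fuse_nat_assoc, h4]

/-- The bare $S(e_2)$ in the coproduct of $\delta_1$ is cancelled by the additional copy of `E`,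
leaving $1\otimes\delta_1\otimes\delta_2$. -/
lemma del_cancel (W : S) :
    ins₂ (del E g) W ≫ 𝕕 (H ⊗ W) ≫ H ◁ H ◁ ins₂ E (H ⊗ W) ≫ H ◁ H ◁ H ◁ 𝕞 W ≫
      H ◁ br H H (H ⊗ W) ≫ 𝕞 (H ⊗ H ⊗ W) = ins₂ (del E g) W ≫ 𝕦 (H ⊗ H ⊗ W) := by
  rw [reassoc_of% D.del_comul_left]
  have h1 := congrArg (fun f => H ◁ f) (ins₂_braid_right (del E g) H W)
  simp only [whiskerLeft_comp, Category.assoc] at h1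
  rw [reassoc_of% h1]
  have h2 := congrArg (fun f => H ◁ H ◁ f) (ins₂_nat E (𝕞 W))
  simp only [whiskerLeft_comp, Category.assoc] at h2
  rw [reassoc_of% h2]
  have h4 := congrArg (fun f => H ◁ H ◁ f) (congrArg (fun f => H ◁ f) (mul_mul H W))
  simp only [whiskerLeft_comp, Category.assoc] at h4
  rw [← reassoc_of% h4]
  have h3 : bri H H (H ⊗ W) ≫ H ◁ ins₂ E (H ⊗ H ⊗ W) ≫ H ◁ H ◁ 𝕞 (H ⊗ W) ≫ H ◁ H ◁ 𝕞 W ≫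
      br H H (H ⊗ W) = ins₂ E (H ⊗ H ⊗ H ⊗ W) ≫ H ◁ 𝕞 (H ⊗ H ⊗ W) ≫ H ◁ bri H H (H ⊗ W) ≫
      H ◁ H ◁ 𝕞 W := by
    rw [br_nat, br_nat_assoc, braid_ins₂_left_assoc, ins₂_nat_assoc]
    simp only [← whiskerLeft_comp, ← whiskerLeft_comp_assoc, Category.assoc]
    rw [bri_fuse_assoc]
    simp only [whiskerLeft_comp, Category.assoc]
  have h3' := congrArg (fun f => H ◁ f) (h3)
  simp only [whiskerLeft_comp, Category.assoc] at h3'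
  rw [reassoc_of% h3', whiskerLeft_ins₂_nat_assoc, whiskerLeft_ins₂_nat_assoc]
  simp only [fuse_nat_assoc, fuse_nat]
  rw [whiskerLeft_fuse_nat_assoc, reassoc_of% D.antipode_right_convolution]
  simp only [← whiskerLeft_comp, ← whiskerLeft_comp_assoc, Category.assoc]
  rw [← ins_nat_assoc, bri_ins_assoc]
  simp only [← whiskerLeft_comp, ← whiskerLeft_comp_assoc, Category.assoc]
  rw [one_mul, whiskerLeft_id, Category.comp_id, ins_nat]

lemma mul_del_cancel (W : S) :
    H ◁ ins₂ (del E g) W ≫ 𝕞 (H ⊗ W) ≫ 𝕕 (H ⊗ W) ≫ H ◁ H ◁ ins₂ E (H ⊗ W) ≫ H ◁ H ◁ H ◁ 𝕞 W ≫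
      H ◁ br H H (H ⊗ W) ≫ 𝕞 (H ⊗ H ⊗ W) = 𝕕 W ≫ H ◁ H ◁ ins₂ (del E g) W ≫ H ◁ 𝕞 (H ⊗ W) := by
  rw [mul_comul_assoc]
  have h1 := congrArg (fun f => H ◁ f) (braid_fuse (MonObj.mul (X := H)) H (H ⊗ H ⊗ W))
  simp only [whiskerLeft_comp, Category.assoc] at h1
  rw [← whiskerLeft_fuse_nat_assoc, ← whiskerLeft_fuse_nat_assoc,
    ← whiskerLeft_comp_assoc _ (𝕞 (H ⊗ H ⊗ W)), fuse_braid]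
  simp only [whiskerLeft_comp, Category.assoc]
  rw [fuse_nat, ← fuse_nat_assoc, ← fuse_nat_assoc, ← fuse_nat_assoc, ← fuse_nat_assoc,
    mul_mul_assoc, ← whiskerLeft_br_nat_assoc, ← whiskerLeft_br_nat_assoc,
    ← whiskerLeft_br_nat_assoc, ← reassoc_of% h1, ← fork_nat_assoc, ← fork_nat_assoc,
    ← fork_nat_assoc, ← fork_nat_assoc]
  have h2 := congrArg (fun f => H ◁ f) (D.del_cancel W)
  simp only [whiskerLeft_comp, Category.assoc] at h2
  rw [reassoc_of% h2]
  rw [fork_nat_assoc, ← whiskerLeft_comp_assoc _ _ (br _ _ _), braid_ins, fork_nat_assoc,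
    mul_one_assoc]

/-- The content of pentagon 0101, with the associators 011 and 010 replaced by their inverses. -/
lemma dOp_uOp {A M : S} {r : H ⊗ A ⟶ A} {s : H ⊗ M ⟶ M} (hr : IsAct r) (hs : IsAct s) :
    dOp (del E g) (lact A s) ≫ H ◁ gOp E (fuse r M) (lact A s) ≫ uOp r M =
      uOp r M ≫ A ◁ dOp (del E g) s := by
  -- The identity $(h\delta_1)_1e_1\otimes(h\delta_1)_2\otimes e_2\delta_2=h_1\otimes
  -- h_2\delta_1\otimes\delta_2$, with the last leg acting.
  have key : dOp (del E g) (lact A s) ≫ 𝕕 (A ⊗ M) ≫ H ◁ H ◁ ins₂ E (A ⊗ M) ≫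
      H ◁ H ◁ H ◁ lact A s ≫ H ◁ br H H (A ⊗ M) ≫ 𝕞 (H ⊗ A ⊗ M) =
      𝕕 (A ⊗ M) ≫ H ◁ dOp (del E g) (lact A s) := by
    have h1 := congrArg (fun f => H ◁ H ◁ f) (ins₂_nat E (lact A s))
    simp only [whiskerLeft_comp, Category.assoc] at h1
    have h2 := congrArg (fun f => H ◁ H ◁ f) (congrArg (fun f => H ◁ f) (hs.lact A).mul)
    simp only [whiskerLeft_comp, Category.assoc] at h2
    have h3 := congrArg (fun f => f ≫ H ◁ H ◁ lact A s) (D.mul_del_cancel (A ⊗ M))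
    simp only [Category.assoc] at h3
    simp only [dOp, whiskerLeft_comp, Category.assoc]
    rw [← h3, fork_nat_assoc, reassoc_of% h1, ← reassoc_of% h2]
    simp only [whiskerLeft_br_nat_assoc, fuse_nat]
  have h1 := dOp_lact (del E g) A s
  have h2 : H ◁ fuse r M ≫ uOp r M = 𝕕 (H ⊗ A ⊗ M) ≫ H ◁ br H H (A ⊗ M) ≫ 𝕞 (H ⊗ A ⊗ M) ≫ H ◁ br H A M ≫ fuse r (H ⊗ M) := by
    rw [uOp, fork_nat_assoc, ← whiskerLeft_comp_assoc, braid_fuse]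
    simp only [whiskerLeft_comp, Category.assoc]
    rw [← (hr.fuse _).mul, fuse_nat_assoc]
  rw [gOp]
  simp only [whiskerLeft_comp, Category.assoc]
  rw [h2]
  simp only [fork_nat_assoc]
  rw [reassoc_of% key, ← whiskerLeft_comp_assoc, h1, whiskerLeft_comp_assoc, fuse_nat, uOp]
  simp only [whiskerLeft_comp, Category.assoc]

end HopfDatum

end

/-! ### The Fourier map and the integral -/

section

variable {S : Type u} [Category.{v} S] [MonoidalCategory S] [BraidedCategory S]
variable {H : S} [HopfObj H]

local notation "𝕞" => fuse (MonObj.mul (X := H))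
local notation "𝕕" => fork (ComonObj.comul (X := H))
local notation "𝕦" => ins (MonObj.one (X := H))
local notation "𝕖" => cap (ComonObj.counit (X := H))
local notation "𝕤" => HopfObj.antipode (X := H)

/-- `h ↦ e₁ λ(e₂ h)`. -/
def fourier (E : 𝟙_ S ⟶ H ⊗ H) (lam : H ⟶ 𝟙_ S) : H ⟶ H :=
  (λ_ H).inv ≫ E ▷ H ≫ (α_ H H H).hom ≫ H ◁ (MonObj.mul ≫ lam) ≫ (ρ_ H).hom

/-- `λ(e₁) e₂`. -/
def integral (E : 𝟙_ S ⟶ H ⊗ H) (lam : H ⟶ 𝟙_ S) : 𝟙_ S ⟶ H :=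
  E ≫ lam ▷ H ≫ (λ_ H).hom

lemma fourier_whiskerRight (E : 𝟙_ S ⟶ H ⊗ H) (lam : H ⟶ 𝟙_ S) (W : S) :
    fourier E lam ▷ W = ins₂ E (H ⊗ W) ≫ H ◁ 𝕞 W ≫ H ◁ cap lam W := by
  simp only [fourier, ins₂, fuse, cap, comp_whiskerRight, whiskerLeft_comp]
  monoidal

lemma ins_integral (E : 𝟙_ S ⟶ H ⊗ H) (lam : H ⟶ 𝟙_ S) (W : S) :
    ins (integral E lam) W = ins₂ E W ≫ cap lam (H ⊗ W) := by
  simp only [integral, ins₂, ins, cap, comp_whiskerRight]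
  monoidal

lemma ins₂_mulL (x : 𝟙_ S ⟶ H ⊗ H) (y : 𝟙_ S ⟶ H) (W : S) :
    ins₂ x W ≫ mulL y ▷ (H ⊗ W) = ins₂ x W ≫ ins y (H ⊗ H ⊗ W) ≫ 𝕞 (H ⊗ W) := by
  rw [mulL_whiskerRight]

/-- An element of $H\otimes H$ is recovered from its action on $1\otimes1$, so invertibility of an
action can be used to cancel elements. -/
lemma ins₂_eq_gOp (x : 𝟙_ S ⟶ H ⊗ H) (W : S) :
    ins₂ x W = (𝕦 W ≫ 𝕦 (H ⊗ W)) ≫ gOp x (𝕞 (H ⊗ W)) (lact H (𝕞 W)) := by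
  rw [gOp, ins₂_nat_assoc, lact]
  have h1 := congrArg (fun f => H ◁ f) (braid_ins (MonObj.one (X := H)) H (H ⊗ W))
  simp only [whiskerLeft_comp, Category.assoc] at h1
  have h2 := congrArg (fun f => H ◁ f) (mul_one H W)
  simp only [whiskerLeft_comp, Category.assoc] at h2
  simp only [whiskerLeft_comp, Category.assoc]
  rw [reassoc_of% h1, ← whiskerLeft_ins_nat_assoc, reassoc_of% h2, whiskerLeft_id,
    Category.id_comp, mul_one, Category.comp_id]

namespace HopfDatum

variable [IsIso (HopfObj.antipode (X := H))] {E : 𝟙_ S ⟶ H ⊗ H} {lam : H ⟶ 𝟙_ S}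
  {g gi : 𝟙_ S ⟶ H} (D : HopfDatum H E lam g gi)
include D

/-- The cointegral property for $e_2h$: expanding $\Delta(e_2h)$ and recognising
$(\mathrm{id}\otimes\Delta)E$ gives $e_1F(h_1)\otimes e_2h_2=F(h)\otimes1$. -/
lemma comul_fourier_mul (W : S) :
    𝕕 W ≫ fourier E lam ▷ (H ⊗ W) ≫ ins₂ E (H ⊗ H ⊗ W) ≫ H ◁ br H H (H ⊗ W) ≫ 𝕞 (H ⊗ H ⊗ W) ≫
      H ◁ 𝕞 W = fourier E lam ▷ W ≫ H ◁ 𝕦 W := by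
  have h1 : bri H H (H ⊗ H ⊗ W) ≫ H ◁ 𝕞 (H ⊗ W) ≫ H ◁ cap lam (H ⊗ W) =
      H ◁ br H H (H ⊗ W) ≫ 𝕞 (H ⊗ H ⊗ W) ≫ cap lam (H ⊗ H ⊗ W) := by
    rw [← cap_bri lam H (H ⊗ W), bri_fuse_assoc, whiskerLeft_br_bri_assoc]
  have h1' := congrArg (fun f => H ◁ f) (h1)
  simp only [whiskerLeft_comp, Category.assoc] at h1'
  have h2 := congrArg (fun f => H ◁ f) (braid_ins₂_left E H (H ⊗ H ⊗ W))
  simp only [whiskerLeft_comp, Category.assoc] at h2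
  have h3 := congrArg (fun f => H ◁ f) (mul_comul H W)
  simp only [whiskerLeft_comp, Category.assoc] at h3
  have h4 := congrArg (fun f => H ◁ f) (D.cointegral W)
  simp only [whiskerLeft_comp, Category.assoc] at h4
  rw [fourier_whiskerRight, fourier_whiskerRight]
  simp only [whiskerLeft_comp, Category.assoc]
  rw [← h4, reassoc_of% h3, ins₂_nat_assoc E (H ◁ cap lam (H ⊗ W)),
    ins₂_nat_assoc E (H ◁ 𝕞 (H ⊗ W)),
    ins₂_nat_assoc E (ins₂ E (H ⊗ H ⊗ W)), ins₂_nat_assoc E (𝕕 W)]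
  rw [whiskerLeft_br_nat_assoc, whiskerLeft_br_nat_assoc, reassoc_of% h2, fuse_nat_assoc,
    fuse_nat_assoc, fuse_nat_assoc, whiskerLeft_ins₂_nat_assoc, fuse_nat_assoc,
    ← reassoc_of% D.comul_right, ← whiskerLeft_fork_nat_assoc, reassoc_of% h1', whiskerLeft_cap_nat]

lemma fourier_comul (W : S) :
    fourier E lam ▷ W ≫ 𝕕 W = ins₂ E (H ⊗ W) ≫ H ◁ 𝕞 W ≫ H ◁ fourier E lam ▷ W := by
  have h1 := congrArg (fun f => H ◁ f) (ins₂_nat E (𝕞 W))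
  simp only [whiskerLeft_comp, Category.assoc] at h1
  have h2 := congrArg (fun f => H ◁ H ◁ f) (mul_mul H W)
  simp only [whiskerLeft_comp, Category.assoc] at h2
  simp only [fourier_whiskerRight, whiskerLeft_comp, Category.assoc]
  rw [fork_nat, fork_nat_assoc, reassoc_of% D.comul_left, reassoc_of% h2, reassoc_of% h1]

lemma fourier_counit (W : S) : fourier E lam ▷ W ≫ 𝕖 W = cap lam W := by
  rw [fourier_whiskerRight, Category.assoc, Category.assoc, cap_nat, cap_nat_assoc,
    reassoc_of% D.counit_left, one_mul_assoc]

/-- The counterpart of `comul_fourier_mul` with $\lambda$ on the other leg of $\Delta(e_2h)$; hence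
$g$ replaces the unit. -/
lemma comul_bri_fourier_mul (W : S) :
    𝕕 W ≫ bri H H W ≫ fourier E lam ▷ (H ⊗ W) ≫ H ◁ ins₂ E (H ⊗ W) ≫ 𝕞 (H ⊗ H ⊗ W) ≫ H ◁ 𝕞 W =
      fourier E lam ▷ W ≫ H ◁ ins g W := by
  have h1 : H ◁ bri H H W ≫ 𝕞 (H ⊗ W) ≫ cap lam (H ⊗ W) =
      br H H (H ⊗ W) ≫ H ◁ 𝕞 W ≫ H ◁ cap lam W := by
    rw [← cap_braid, fuse_braid_assoc, whiskerLeft_bri_br_assoc]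
  have h1' := congrArg (fun f => H ◁ H ◁ f) (h1)
  simp only [whiskerLeft_comp, Category.assoc] at h1'
  have h2 := congrArg (fun f => H ◁ f) (D.distinguished W)
  simp only [whiskerLeft_comp, Category.assoc] at h2
  have h3 := congrArg (fun f => H ◁ f) (mul_comul H W)
  simp only [whiskerLeft_comp, Category.assoc] at h3
  rw [fourier_whiskerRight, fourier_whiskerRight]
  simp only [whiskerLeft_comp, Category.assoc]
  rw [← h2, reassoc_of% h3, ins₂_nat_assoc E (bri H H W), ins₂_nat_assoc E (𝕕 W),
    whiskerLeft_ins₂_nat_assoc, whiskerLeft_ins₂_nat_assoc, whiskerLeft_ins₂_nat_assoc,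
    whiskerLeft_ins₂_nat_assoc, fuse_nat_assoc, fuse_nat_assoc, fuse_nat_assoc, fuse_nat_assoc,
    ← reassoc_of% D.comul_right, ← whiskerLeft_fork_nat_assoc, reassoc_of% h1',
    whiskerLeft_fuse_nat, whiskerLeft_fuse_nat_assoc]

/-- On elements, $F(h_2)\otimes h_1=F(h)\delta_1\otimes\delta_2$. This explains the form of
$\delta$: the $g$ of the distinguished property, corrected by the convolution inverse of `E`. -/
lemma comul_bri_fourier (W : S) :
    𝕕 W ≫ bri H H W ≫ fourier E lam ▷ (H ⊗ W) =
      fourier E lam ▷ W ≫ H ◁ ins₂ (del E g) W ≫ 𝕞 (H ⊗ W) := by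
  -- Multiplication by $e_1\otimes S(e_2)$ removes the copy of `E` on the left side of
  -- `comul_bri_fourier_mul`.
  have h := congrArg (fun f => f ≫ H ◁ (ins₂ E (H ⊗ W) ≫ H ◁ (𝕤 ▷ (H ⊗ W) ≫ 𝕞 W)) ≫ 𝕞 (H ⊗ W))
    (D.comul_bri_fourier_mul W)
  have h1 := congrArg (fun f => H ◁ H ◁ f) (whisker_exchange 𝕤 (𝕞 W))
  simp only [whiskerLeft_comp, Category.assoc] at h1
  have h2 := congrArg (fun f => H ◁ H ◁ f) (mul_mul H W)
  simp only [whiskerLeft_comp, Category.assoc] at h2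
  have h3 := congrArg (fun f => H ◁ f) (D.antipode_left_convolution (H ⊗ W))
  simp only [whiskerLeft_comp, Category.assoc] at h3
  have h4 := congrArg (fun f => H ◁ H ◁ f) (one_mul H W)
  simp only [whiskerLeft_comp, Category.assoc] at h4
  have h5 := congrArg (fun f => H ◁ H ◁ f) (mulR_whiskerRight g W)
  simp only [whiskerLeft_comp, Category.assoc] at h5
  have h6 := congrArg (fun f => H ◁ H ◁ f) (whisker_exchange 𝕤 (ins g W))
  simp only [whiskerLeft_comp, Category.assoc] at h6
  simp only [whiskerLeft_comp, Category.assoc] at h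
  rw [whiskerLeft_ins₂_nat_assoc, reassoc_of% h1, ← reassoc_of% h2] at h
  rw [fuse_nat, fuse_nat_assoc, fuse_nat_assoc, ← fuse_nat_assoc, mul_mul_assoc,
    ← fuse_nat_assoc, ← fuse_nat_assoc, ← fuse_nat] at h
  rw [reassoc_of% h3, reassoc_of% h4, whiskerLeft_id, whiskerLeft_id, Category.id_comp, mul_one,
    Category.comp_id, whiskerLeft_ins₂_nat_assoc, reassoc_of% h6, ← reassoc_of% h5] at h
  rw [h, ins₂_del]
  simp only [whiskerLeft_comp, Category.assoc]

lemma vOp_fourier_gOp {N : S} {s : H ⊗ N ⟶ N} (hs : IsAct s) :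
    vOp s ≫ fourier E lam ▷ N ≫ gOp E (𝕞 N) (lact H s) = fourier E lam ▷ N := by
  have h1 := congrArg (fun f => H ◁ H ◁ f) (hs.mul)
  simp only [whiskerLeft_comp, Category.assoc] at h1
  have h2 := congrArg (fun f => H ◁ f) (hs.one)
  simp only [whiskerLeft_comp, Category.assoc] at h2
  simp only [vOp, gOp, lact, whiskerLeft_comp, Category.assoc]
  rw [whisker_exchange_assoc, ins₂_nat_assoc, whiskerLeft_br_nat_assoc, ← reassoc_of% h1,
    fuse_nat, fuse_nat_assoc]
  have h3 := D.comul_fourier_mul N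
  rw [reassoc_of% h3, h2, whiskerLeft_id, Category.comp_id]

lemma fourier_uOp {A : S} (r : H ⊗ A ⟶ A) (W : S) :
    fourier E lam ▷ (A ⊗ W) ≫ uOp r W =
      br H A W ≫ gOp E (fuse r (H ⊗ W)) (lact A (𝕞 W)) ≫ A ◁ fourier E lam ▷ W := by
  have h1 := congrArg (fun f => H ◁ f) (whisker_braid (fourier E lam) A W)
  simp only [whiskerLeft_comp, Category.assoc] at h1
  have h2 := congrArg (fun f => H ◁ f) (fuse_braid (MonObj.mul (X := H)) A W)
  simp only [whiskerLeft_comp, Category.assoc] at h2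
  simp only [uOp, gOp, lact, whiskerLeft_comp, Category.assoc]
  rw [reassoc_of% D.fourier_comul, reassoc_of% h1, fuse_nat, reassoc_of% h2, ins₂_nat_assoc]

lemma uOp_bri_fourier {A : S} (r : H ⊗ A ⟶ A) (W : S) :
    uOp r W ≫ bri H A W ≫ fourier E lam ▷ (A ⊗ W) =
      fourier E lam ▷ (A ⊗ W) ≫ dOp (del E g) (fuse r W) := by
  rw [uOp_bri_assoc, whisker_exchange, reassoc_of% D.comul_bri_fourier, dOp]

/-- `integral E lam` is a left integral. By nondegeneracy it is enough to pair with `E`, where the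
cointegral property gives $e_1\otimes e_2\Lambda=1\otimes\Lambda$. -/
lemma mul_integral (W : S) :
    H ◁ ins (integral E lam) W ≫ 𝕞 W = 𝕖 W ≫ ins (integral E lam) W := by
  apply D.cancel
  have h := congrArg (fun f => f ≫ cap lam (H ⊗ H ⊗ W)) (D.comul_left W)
  simp only [whiskerLeft_comp, Category.assoc] at h
  rw [D.cointegral, cap_nat, cap_nat_assoc, ← Category.assoc, ← ins_integral, ← Category.assoc,
    ← ins_integral, ins₂_nat_assoc, ins_nat] at h
  simp only [whiskerLeft_comp, Category.assoc]
  rw [← h, ← D.counit_right, Category.assoc]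

lemma integral_cap (W : S) : ins (integral E lam) W ≫ cap lam W = 𝟙 W := by
  rw [ins_integral, Category.assoc, ← D.normalised W, cap_nat]

/-- Applying $\lambda$ to the second leg of $\Delta(e_1)$ produces $g\otimes\Lambda$ by the
distinguished property and $e_1\otimes\Lambda e_2$ by the bicharacter property. -/
lemma copairing_integral (W : S) :
    ins₂ E W ≫ H ◁ mulL (integral E lam) ▷ W = ins g W ≫ H ◁ ins (integral E lam) W := by
  have h := congrArg (fun f => f ≫ H ◁ cap lam (H ⊗ W)) (D.comul_left W)
  simp only [whiskerLeft_comp, Category.assoc] at h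
  rw [D.distinguished, whiskerLeft_cap_nat, ← Category.assoc, ← ins_integral, ins_nat] at h
  rw [h, mulL_whiskerRight, ins_integral]
  simp only [whiskerLeft_comp, Category.assoc]

/-- Left multiplication of the second leg of $E\gamma=1\otimes1$ by $\Lambda$, where
$e_1\otimes\Lambda e_2=g\otimes\Lambda$. -/
lemma gam_integral (W : S) :
    ins₂ (gam E) W ≫ mulL g ▷ (H ⊗ W) ≫ H ◁ mulL (integral E lam) ▷ W =
      𝕦 W ≫ H ◁ ins (integral E lam) W := by
  have h := congrArg (fun f => f ≫ H ◁ mulL (integral E lam) ▷ W) (D.gam_mul W)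
  have h1 := congrArg (fun f => H ◁ f) (mulL_mul (integral E lam) W)
  simp only [whiskerLeft_comp, Category.assoc] at h1
  have h2 := congrArg (fun f => H ◁ f) (whisker_braid (mulL (integral E lam)) H (H ⊗ W))
  simp only [whiskerLeft_comp, Category.assoc] at h2
  have h3 := congrArg (fun f => H ◁ f) (ins_braid (integral E lam) H (H ⊗ W))
  simp only [whiskerLeft_comp, Category.assoc] at h3
  have h4 := congrArg (fun f => H ◁ f) (mulL_whiskerRight (integral E lam) W)
  simp only [whiskerLeft_comp, Category.assoc] at h4
  have h5 : 𝕦 W ≫ mulL (integral E lam) ▷ W = ins (integral E lam) W := by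
    rw [mulL_whiskerRight, ins_nat_assoc, mul_one, Category.comp_id]
  simp only [whiskerLeft_comp, Category.assoc] at h
  rw [← h1, ← fuse_nat_assoc, ← reassoc_of% h2, reassoc_of% D.copairing_integral,
    reassoc_of% h3, fuse_nat_assoc, ← h4, ← ins_nat, reassoc_of% h5, ins_nat] at h
  rw [← h, mulL_whiskerRight g]
  simp only [whiskerLeft_comp, Category.assoc]

lemma integral_fourier (W : S) : ins (integral E lam) W ≫ fourier E lam ▷ W = 𝕦 W := by
  rw [fourier_whiskerRight, ins₂_nat_assoc]
  simp only [← whiskerLeft_comp, ← whiskerLeft_comp_assoc, Category.assoc]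
  rw [reassoc_of% D.mul_integral, D.integral_cap, Category.comp_id, D.counit_right]

end HopfDatum

end

/-! ### The second Fourier map, and invertibility of the first -/

section

variable {S : Type u} [Category.{v} S] [MonoidalCategory S] [BraidedCategory S]
variable {H : S} [HopfObj H]

local notation "𝕞" => fuse (MonObj.mul (X := H))
local notation "𝕕" => fork (ComonObj.comul (X := H))
local notation "𝕦" => ins (MonObj.one (X := H))
local notation "𝕖" => cap (ComonObj.counit (X := H))
local notation "𝕤" => HopfObj.antipode (X := H)

/-- `h ↦ λ(h δ₁) δ₂`. -/
def fourier' (E : 𝟙_ S ⟶ H ⊗ H) (lam : H ⟶ 𝟙_ S) (g : 𝟙_ S ⟶ H) : H ⟶ H :=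
  (ρ_ H).inv ≫ H ◁ del E g ≫ (α_ H H H).inv ≫ (MonObj.mul ≫ lam) ▷ H ≫ (λ_ H).hom

lemma fourier'_whiskerRight (E : 𝟙_ S ⟶ H ⊗ H) (lam : H ⟶ 𝟙_ S) (g : 𝟙_ S ⟶ H) (W : S) :
    fourier' E lam g ▷ W = H ◁ ins₂ (del E g) W ≫ 𝕞 (H ⊗ W) ≫ cap lam (H ⊗ W) := by
  simp only [fourier', ins₂, fuse, cap, comp_whiskerRight, whiskerLeft_comp]
  monoidal

lemma isAct_mul : IsAct (MonObj.mul (X := H)) where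
  mul := by
    rw [fuse, Category.assoc, MonObj.mul_assoc, Iso.inv_hom_id_assoc]
  one := by
    rw [ins, Category.assoc, MonObj.one_mul, Iso.inv_hom_id]

lemma mulR_comp (x y : 𝟙_ S ⟶ H) (W : S) : mulR x ▷ W ≫ mulR y ▷ W =
    H ◁ ins y W ≫ H ◁ ins x (H ⊗ W) ≫ H ◁ 𝕞 W ≫ 𝕞 W := by
  rw [mulR_whiskerRight, mulR_whiskerRight, Category.assoc, ← fuse_nat_assoc, mul_mul]
  simp only [← whiskerLeft_comp_assoc, ins_nat_assoc, ins_nat, Category.assoc]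

namespace HopfDatum

variable [IsIso (HopfObj.antipode (X := H))] {E : 𝟙_ S ⟶ H ⊗ H} {lam : H ⟶ 𝟙_ S}
  {g gi : 𝟙_ S ⟶ H} (D : HopfDatum H E lam g gi)
include D

/-- Self-duality rewrites $\lambda(\Lambda\delta_1)\delta_2$ as $g\gamma_1\lambda(\Lambda\gamma_2)$,
and then `gam_integral` applies. -/
lemma integral_fourier' (W : S) :
    ins (integral E lam) W ≫ fourier' E lam g ▷ W = 𝕦 W := by
  have h1 := whisker_braid (mulL (integral E lam)) H W
  have h2 := congrArg (fun f => H ◁ f) (D.integral_cap W)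
  simp only [whiskerLeft_comp, Category.assoc] at h2
  rw [fourier'_whiskerRight, ← ins_nat_assoc, ← cap_braid, ← reassoc_of% mulL_whiskerRight,
    reassoc_of% h1, reassoc_of% D.symm, ← reassoc_of% mulL_whiskerRight,
      reassoc_of% D.gam_integral, h2,
    whiskerLeft_id, Category.comp_id]

/-- $F'(h_1)\gamma_1\otimes h_2\gamma_2=F'(h)\otimes1$, by applying $\lambda$ to the first leg of
$\Delta(h\delta_1)$ in `mul_del_comul_braid`. -/
lemma comul_fourier'_mul (W : S) :
    𝕕 W ≫ fourier' E lam g ▷ (H ⊗ W) ≫ H ◁ H ◁ ins₂ (gam E) W ≫ H ◁ br H H (H ⊗ W) ≫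
      𝕞 (H ⊗ H ⊗ W) ≫ H ◁ 𝕞 W = fourier' E lam g ▷ W ≫ H ◁ 𝕦 W := by
  have h := congrArg (fun f => f ≫ cap lam (H ⊗ H ⊗ W)) (D.mul_del_comul_braid W)
  simp only [whiskerLeft_comp, Category.assoc] at h
  rw [cap_nat, reassoc_of% D.cointegral, ins_braid, cap_nat, cap_nat_assoc, cap_nat_assoc] at h
  have h' := fourier'_whiskerRight E lam g (H ⊗ H ⊗ H ⊗ W)
  rw [← reassoc_of% h', whisker_exchange_assoc, ← Category.assoc (𝕞 (H ⊗ W)),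
    ← Category.assoc (H ◁ ins₂ _ _), ← fourier'_whiskerRight] at h
  exact h.symm

/-- A left inverse of $\gamma$ in $H\otimes H$ is `E`, because $\gamma$ has `E` as a two-sided
inverse on the regular module. -/
lemma eq_copairing {y : 𝟙_ S ⟶ H ⊗ H} (h : ∀ W, ins₂ (gam E) W ≫ ins₂ y (H ⊗ H ⊗ W) ≫
    H ◁ br H H (H ⊗ W) ≫ 𝕞 (H ⊗ H ⊗ W) ≫ H ◁ 𝕞 W = 𝕦 W ≫ H ◁ 𝕦 W) (W : S) : ins₂ y W = ins₂ E W := by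
  have hr := isAct_reg (H := H) (H ⊗ W)
  have hs := (isAct_reg (H := H) W).lact H
  have hc := comm_fuse_lact (MonObj.mul (X := H)) (𝕞 W)
  have h1 : gOp (gam E) (𝕞 (H ⊗ W)) (lact H (𝕞 W)) ≫ gOp y (𝕞 (H ⊗ W)) (lact H (𝕞 W)) = 𝟙 _ := by
    rw [gOp_comp _ _ hr hs hc, h, ← ins_nat, gOp_one hr hs]
  have h2 := D.gOp_comp_gam hr hs hc
  have h3 : gOp y (𝕞 (H ⊗ W)) (lact H (𝕞 W)) = gOp E (𝕞 (H ⊗ W)) (lact H (𝕞 W)) := by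
    rw [← Category.id_comp (gOp y _ _), ← h2, Category.assoc, h1, Category.comp_id]
  rw [ins₂_eq_gOp, h3, ← ins₂_eq_gOp]

lemma eq_gam {y : 𝟙_ S ⟶ H ⊗ H} (h : ∀ W, ins₂ y W ≫ ins₂ E (H ⊗ H ⊗ W) ≫
    H ◁ br H H (H ⊗ W) ≫ 𝕞 (H ⊗ H ⊗ W) ≫ H ◁ 𝕞 W = 𝕦 W ≫ H ◁ 𝕦 W) (W : S) :
    ins₂ y W = ins₂ (gam E) W := by
  have hr := isAct_reg (H := H) (H ⊗ W)
  have hs := (isAct_reg (H := H) W).lact H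
  have hc := comm_fuse_lact (MonObj.mul (X := H)) (𝕞 W)
  have h1 : gOp y (𝕞 (H ⊗ W)) (lact H (𝕞 W)) ≫ gOp E (𝕞 (H ⊗ W)) (lact H (𝕞 W)) = 𝟙 _ := by
    rw [gOp_comp _ _ hr hs hc, h, ← ins_nat, gOp_one hr hs]
  have h2 := D.gOp_comp_gam hr hs hc
  have h3 : gOp y (𝕞 (H ⊗ W)) (lact H (𝕞 W)) = gOp (gam E) (𝕞 (H ⊗ W)) (lact H (𝕞 W)) := by
    rw [← Category.comp_id (gOp y _ _), ← h2, reassoc_of% h1]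
  rw [ins₂_eq_gOp, h3, ← ins₂_eq_gOp]

/-- At $h=\Lambda$, where $F'(\Lambda)=1$, `comul_fourier'_mul` says that
$F'(\Lambda_1)\otimes\Lambda_2$ is a left inverse of $\gamma$. -/
lemma integral_comul_fourier' (W : S) :
    ins (integral E lam) W ≫ 𝕕 W ≫ fourier' E lam g ▷ (H ⊗ W) = ins₂ E W := by
  have h0 (W : S) : ins₂ (integral E lam ≫ ComonObj.comul ≫ fourier' E lam g ▷ H) W =
      ins (integral E lam) W ≫ 𝕕 W ≫ fourier' E lam g ▷ (H ⊗ W) := by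
    rw [← Category.assoc, ← ins₂_left, ← ins_fork, Category.assoc]
  rw [← h0]
  refine D.eq_copairing (fun W => ?_) W
  rw [ins₂_nat_assoc, h0, Category.assoc, Category.assoc, D.comul_fourier'_mul,
    reassoc_of% D.integral_fourier']

/-- At $h=\Lambda$, where $F(\Lambda)=1$, `comul_fourier_mul` says that
$F(\Lambda_1)\otimes\Lambda_2$ is a right inverse of `E`. -/
lemma integral_comul_fourier (W : S) :
    ins (integral E lam) W ≫ 𝕕 W ≫ fourier E lam ▷ (H ⊗ W) = ins₂ (gam E) W := by
  have h0 (W : S) : ins₂ (integral E lam ≫ ComonObj.comul ≫ fourier E lam ▷ H) W =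
      ins (integral E lam) W ≫ 𝕕 W ≫ fourier E lam ▷ (H ⊗ W) := by
    rw [← Category.assoc, ← ins₂_left, ← ins_fork, Category.assoc]
  rw [← h0]
  refine D.eq_gam (fun W => ?_) W
  rw [h0, Category.assoc, Category.assoc, D.comul_fourier_mul, reassoc_of% D.integral_fourier]

/-- $S(h)g=\Lambda_1\lambda(h\Lambda_2)$. Write $g=\Lambda_1\lambda(\Lambda_2)$, replace
$S(h)\otimes\Lambda$ by $S(h_1)\otimes h_2\Lambda$, and cancel after expanding $\Delta(h_2\Lambda)$.
It allows endomorphisms of `H` to be compared on the first leg of $\Delta(\Lambda)$. -/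
lemma antiR_eq (W : S) :
    antiR g ▷ W = H ◁ ins (integral E lam) W ≫ H ◁ 𝕕 W ≫ br H H (H ⊗ W) ≫ H ◁ 𝕞 W ≫
      H ◁ cap lam W := by
  have h1 := congrArg (fun f => H ◁ f) (mul_comul H W)
  simp only [whiskerLeft_comp, Category.assoc] at h1
  have h2 := congrArg (fun f => H ◁ f) (D.mul_integral W)
  simp only [whiskerLeft_comp, Category.assoc] at h2
  have h3 := congrArg (fun f => H ◁ f) (D.distinguished W)
  simp only [whiskerLeft_comp, Category.assoc] at h3
  have h4 := congrArg (fun f => H ◁ f) (D.integral_cap W)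
  simp only [whiskerLeft_comp, Category.assoc] at h4
  have h5 : antiR g ▷ W = 𝕕 W ≫ 𝕤 ▷ (H ⊗ W) ≫ H ◁ H ◁ ins (integral E lam) W ≫ H ◁ 𝕞 W ≫
      H ◁ 𝕕 W ≫ H ◁ H ◁ cap lam W ≫ 𝕞 W := by
    rw [reassoc_of% h3, reassoc_of% h2, reassoc_of% h4, whiskerLeft_id, Category.id_comp,
      ← whisker_exchange_assoc, comul_counit_right_assoc, antiR, comp_whiskerRight,
      mulR_whiskerRight]
  rw [h5, reassoc_of% h1, fuse_nat, fuse_nat_assoc, ← mul_mul_assoc, fuse_nat_assoc,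
    ← whisker_exchange_assoc, ← whisker_exchange_assoc, ← whisker_exchange_assoc, ← fork_nat_assoc,
    ← fork_nat_assoc, ← comul_comul_assoc, antipode_left_assoc, comul_counit_left_assoc,
    ← ins_nat_assoc, one_mul_assoc]

lemma antiR_comp (k : H ⟶ H) (W : S) :
    antiR g ▷ W ≫ k ▷ W = H ◁ (ins (integral E lam) W ≫ 𝕕 W ≫ k ▷ (H ⊗ W)) ≫ br H H (H ⊗ W) ≫
      H ◁ 𝕞 W ≫ H ◁ cap lam W := by
  rw [D.antiR_eq]
  simp only [whiskerLeft_comp, Category.assoc]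
  rw [whisker_exchange, whisker_exchange_assoc, ← braid_whisker_assoc]

lemma mulR_mulR (W : S) : mulR g ▷ W ≫ mulR gi ▷ W = 𝟙 _ := by
  have h := congrArg (fun f => H ◁ f) (D.gi_g W)
  simp only [whiskerLeft_comp, Category.assoc] at h
  rw [mulR_comp, reassoc_of% h, mul_one]

lemma mulR_mulR' (W : S) : mulR gi ▷ W ≫ mulR g ▷ W = 𝟙 _ := by
  have h := congrArg (fun f => H ◁ f) (D.g_gi W)
  simp only [whiskerLeft_comp, Category.assoc] at h
  rw [mulR_comp, reassoc_of% h, mul_one]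

lemma antiR_counit (W : S) : antiR g ▷ W ≫ 𝕖 W = 𝕖 W := by
  have h := congrArg (fun f => H ◁ f) (D.g_counit W)
  simp only [whiskerLeft_comp, Category.assoc] at h
  rw [antiR, comp_whiskerRight, mulR_whiskerRight, Category.assoc, Category.assoc, mul_counit,
    reassoc_of% h, whiskerLeft_id, Category.id_comp, antipode_counit]

lemma isIso_antiR : IsIso (antiR g) := by
  have : IsIso (mulR g) := ⟨mulR gi,
    ext_whiskerRight fun W => by rw [comp_whiskerRight, D.mulR_mulR, id_whiskerRight],
    ext_whiskerRight fun W => by rw [comp_whiskerRight, D.mulR_mulR', id_whiskerRight]⟩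
  exact inferInstanceAs (IsIso (𝕤 ≫ mulR g))

/-- On the first leg of $\Delta(\Lambda)$ the two maps give $\gamma$ followed by $S$, and `E`; these
agree. `antiR_comp` carries this over to all of `H`, as $h\mapsto S(h)g$ is invertible. -/
lemma fourier_antipode (W : S) : fourier E lam ▷ W ≫ 𝕤 ▷ W = fourier' E lam g ▷ W := by
  have := D.isIso_antiR
  rw [← cancel_epi (antiR g ▷ W), ← comp_whiskerRight, D.antiR_comp, D.antiR_comp,
    D.integral_comul_fourier', comp_whiskerRight, reassoc_of% D.integral_comul_fourier,
    D.ins₂_gam', Category.assoc, inv_antipode, Category.comp_id]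

/-- $F(h\delta_1)\delta_2=e_1F'(e_2h)=e_1S(F(e_2h))=F(h)_1S(F(h)_2)=\lambda(h)$. -/
lemma mul_del_fourier_mul (W : S) :
    H ◁ ins₂ (del E g) W ≫ 𝕞 (H ⊗ W) ≫ fourier E lam ▷ (H ⊗ W) ≫ 𝕞 W = cap lam W ≫ 𝕦 W := by
  have h1 := congrArg (fun f => H ◁ f) (mul_mul H (H ⊗ W))
  simp only [whiskerLeft_comp, Category.assoc] at h1
  have h2 := congrArg (fun f => H ◁ f) (fourier'_whiskerRight E lam g W)
  simp only [whiskerLeft_comp, Category.assoc] at h2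
  have h3 := congrArg (fun f => H ◁ f) (D.fourier_antipode W)
  simp only [whiskerLeft_comp, Category.assoc] at h3
  rw [fourier_whiskerRight, Category.assoc, Category.assoc, ins₂_nat_assoc, ins₂_nat_assoc,
    ← reassoc_of% h1, whiskerLeft_fuse_nat_assoc, ← reassoc_of% h2, ← reassoc_of% h3,
    ← reassoc_of% D.fourier_comul, antipode_right, reassoc_of% D.fourier_counit]

lemma mul_del_fourier_comul (W : S) :
    H ◁ ins₂ (del E g) W ≫ 𝕞 (H ⊗ W) ≫ fourier E lam ▷ (H ⊗ W) ≫ 𝕕 (H ⊗ W) ≫ H ◁ 𝕞 W =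
      fourier E lam ▷ W ≫ H ◁ 𝕦 W := by
  have h1 := congrArg (fun f => H ◁ f) (mul_mul H (H ⊗ W))
  simp only [whiskerLeft_comp, Category.assoc] at h1
  have h2 := congrArg (fun f => H ◁ f) (D.mul_del_fourier_mul W)
  simp only [whiskerLeft_comp, Category.assoc] at h2
  rw [reassoc_of% D.fourier_comul, ins₂_nat_assoc, ins₂_nat_assoc,
    ← reassoc_of% h1, whiskerLeft_fuse_nat_assoc, h2, fourier_whiskerRight]
  simp only [whiskerLeft_comp, Category.assoc]

lemma dOp_fourier_vOp {M : S} {s : H ⊗ M ⟶ M} (hs : IsAct s) :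
    dOp (del E g) s ≫ fourier E lam ▷ M ≫ vOp s = fourier E lam ▷ M := by
  have h1 := congrArg (fun f => H ◁ f) (hs.mul)
  simp only [whiskerLeft_comp, Category.assoc] at h1
  have h2 := congrArg (fun f => H ◁ f) (hs.one)
  simp only [whiskerLeft_comp, Category.assoc] at h2
  simp only [dOp, vOp, Category.assoc]
  rw [whisker_exchange_assoc, fork_nat_assoc, ← h1, reassoc_of% D.mul_del_fourier_comul, h2,
    whiskerLeft_id, Category.comp_id]

lemma del_fourier_mul (W : S) :
    ins₂ (del E g) (H ⊗ W) ≫ H ◁ 𝕞 W ≫ H ◁ fourier E lam ▷ W ≫ 𝕞 W =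
      mulL g ▷ W ≫ cap lam W ≫ 𝕦 W := by
  have h1 := congrArg (fun f => H ◁ f) (mulR_mul g W)
  simp only [whiskerLeft_comp, Category.assoc] at h1
  have h2 := congrArg (fun f => H ◁ H ◁ f) (mul_mul H W)
  simp only [whiskerLeft_comp, Category.assoc] at h2
  have h3 := congrArg (fun f => H ◁ f) (one_mul H W)
  simp only [whiskerLeft_comp, Category.assoc] at h3
  simp only [ins₂_del, fourier_whiskerRight, whiskerLeft_comp, Category.assoc]
  rw [reassoc_of% h1, ← whiskerLeft_whisker_exchange_assoc, ← ins₂_nat_assoc,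
    whiskerLeft_ins₂_nat_assoc, whiskerLeft_ins₂_nat_assoc, ← reassoc_of% h2, fuse_nat,
    fuse_nat_assoc, fuse_nat_assoc, fuse_nat_assoc, reassoc_of% D.antipode_right_convolution,
    reassoc_of% h3, whiskerLeft_id, Category.id_comp, ins_nat]

lemma integral_antipode_mul (W : S) :
    ins (integral E lam) (H ⊗ W) ≫ 𝕤 ▷ (H ⊗ W) ≫ 𝕞 W = 𝕖 W ≫ ins (integral E lam) W ≫ 𝕤 ▷ W := by
  have h := congrArg (fun f => f ≫ 𝕤 ▷ W) (D.mul_integral W)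
  simp only [whiskerLeft_comp, Category.assoc] at h
  rw [← cancel_epi (𝕤 ▷ W), antipode_counit_assoc, ← h, mul_antipode, whisker_braid_assoc,
    braid_whisker_assoc, braid_ins_assoc, ins_nat_assoc, whisker_exchange_assoc]

/-- $S(\Lambda)=S(\Lambda)g$ because $S(\Lambda)$ is a right integral. By `antiR_eq` the value is
then $\lambda(\Lambda_1)\lambda(\Lambda\Lambda_2)$, and the cointegral property reduces it to
$\lambda(\Lambda)$. -/
lemma integral_antipode_cap (W : S) :
    ins (integral E lam) W ≫ 𝕤 ▷ W ≫ cap lam W = 𝟙 W := by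
  have h1 : ins (integral E lam) W ≫ 𝕤 ▷ W = ins (integral E lam) W ≫ antiR g ▷ W := by
    rw [antiR, comp_whiskerRight, mulR_whiskerRight, ← whisker_exchange_assoc, ← ins_nat_assoc,
      D.integral_antipode_mul, reassoc_of% D.g_counit]
  have h2 := congrArg (fun f => H ◁ f) (D.cointegral W)
  simp only [whiskerLeft_comp, Category.assoc] at h2
  have h3 := congrArg (fun f => H ◁ f) (D.integral_cap W)
  simp only [whiskerLeft_comp, Category.assoc] at h3
  rw [reassoc_of% h1, D.antiR_eq]
  simp only [whiskerLeft_comp, Category.assoc]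
  rw [cap_nat, cap_nat_assoc, braid_cap_assoc, reassoc_of% h2, reassoc_of% h3, whiskerLeft_id,
    Category.id_comp, mul_one_assoc, D.integral_cap]

/-- $\lambda(gF(h))=\varepsilon(h)$. With $S(h)g$ in place of $h$, the left side is
$\lambda(g\gamma_1)\lambda(h\gamma_2)$, by self-duality $\lambda(F'(h))$, and by `fourier_antipode`
$\lambda(S(F(h)))$. -/
lemma fourier_mulL_cap (W : S) : fourier E lam ▷ W ≫ mulL g ▷ W ≫ cap lam W = 𝕖 W := by
  have := D.isIso_antiR
  have h1 := congrArg (fun f => H ◁ f) (ins₂_mulL (gam E) g W)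
  simp only [whiskerLeft_comp, Category.assoc] at h1
  have h2 := congrArg (fun f => H ◁ f) (D.symm W)
  simp only [whiskerLeft_comp, Category.assoc] at h2
  have h3 := congrArg (fun f => H ◁ f) (braid_cap lam H W)
  simp only [whiskerLeft_comp, Category.assoc] at h3
  have h4 := D.antiR_comp (fourier E lam) W
  have h5 := fourier'_whiskerRight E lam g W
  -- Here $\lambda(S(e_1))\lambda(e_2h)=\lambda(S(\Lambda)h)=\varepsilon(h)\lambda(S(\Lambda))$,
  -- with $S$ moved from one leg of `E` to the other.
  have h6 : fourier E lam ▷ W ≫ 𝕤 ▷ W ≫ cap lam W = 𝕖 W := by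
    have h := ins_integral E lam (H ⊗ W)
    rw [fourier_whiskerRight, Category.assoc, Category.assoc, whisker_exchange_assoc,
      whisker_exchange_assoc, cap_nat, cap_nat_assoc, reassoc_of% D.antipode, cap_nat_assoc,
      ← reassoc_of% h, reassoc_of% D.integral_antipode_mul, D.integral_antipode_cap,
      Category.comp_id]
  rw [D.integral_comul_fourier] at h4
  rw [← cancel_epi (antiR g ▷ W), reassoc_of% h4, D.antiR_counit, whisker_exchange_assoc,
    whisker_exchange_assoc, cap_nat, cap_nat_assoc, ← braid_whisker_assoc, braid_cap_assoc,
    reassoc_of% h1, ← reassoc_of% h2, reassoc_of% h3, fuse_nat_assoc, cap_nat,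
    ← reassoc_of% h5, ← reassoc_of% D.fourier_antipode, h6]

/-- `comul_fourier_mul` solved for $F(h_1)\otimes h_2$ with the inverse $\gamma$ of `E`. -/
lemma comul_fourier (W : S) :
    𝕕 W ≫ fourier E lam ▷ (H ⊗ W) = fourier E lam ▷ W ≫ ins₂ (gam E) (H ⊗ W) ≫ H ◁ br H H W ≫
      𝕞 (H ⊗ W) := by
  have hr := isAct_reg (H := H) (H ⊗ W)
  have hs := (isAct_reg (H := H) W).lact H
  have hc := comm_fuse_lact (MonObj.mul (X := H)) (𝕞 W)
  have h1 : 𝕕 W ≫ fourier E lam ▷ (H ⊗ W) ≫ gOp E (𝕞 (H ⊗ W)) (lact H (𝕞 W)) =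
      fourier E lam ▷ W ≫ H ◁ 𝕦 W := by
    rw [← D.comul_fourier_mul, gOp, lact]
    simp only [whiskerLeft_comp, Category.assoc]
    rw [fuse_nat]
  have h2 := congrArg (fun f => H ◁ H ◁ f) (mul_one H W)
  simp only [whiskerLeft_comp, Category.assoc] at h2
  rw [← Category.comp_id (fourier E lam ▷ (H ⊗ W)), ← D.gOp_comp_gam hr hs hc, reassoc_of% h1,
    gOp, lact, ins₂_nat_assoc]
  simp only [whiskerLeft_comp, Category.assoc]
  rw [whiskerLeft_br_nat_assoc, reassoc_of% h2, whiskerLeft_id, whiskerLeft_id, Category.id_comp]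

/-- Pentagon 1111 evaluated on the unit. Braiding $\Delta(\delta_1)$ past $\delta_2$ yields $\delta$
and $\gamma$; the $\delta$ is consumed by $\delta_1F(\delta_2h)=\lambda(gh)$, the $\gamma$ restores
$F(h_1)\otimes h_2$, and $\lambda(gF(h_1))=\varepsilon(h_1)$. -/
lemma fourier_del_fourier_uOp (W : S) :
    fourier E lam ▷ W ≫ ins₂ (del E g) (H ⊗ W) ≫ H ◁ 𝕞 W ≫ H ◁ fourier E lam ▷ W ≫
      uOp MonObj.mul W = 𝕦 (H ⊗ W) := by
  have h1 := congrArg (fun f => H ◁ f) (braid_whisker (fourier E lam) H W)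
  simp only [whiskerLeft_comp, Category.assoc] at h1
  have h2 := congrArg (fun f => H ◁ f) (braid_fuse (MonObj.mul (X := H)) H W)
  simp only [whiskerLeft_comp, Category.assoc] at h2
  have h3 := congrArg (fun f => H ◁ f) (mul_mul H (H ⊗ W))
  simp only [whiskerLeft_comp, Category.assoc] at h3
  rw [uOp, fork_nat_assoc, fork_nat_assoc, reassoc_of% h1, reassoc_of% h2,
    reassoc_of% D.del_braid, ← whiskerLeft_fuse_nat_assoc, reassoc_of% h3, ← ins₂_nat_assoc,
    ← ins₂_nat_assoc, D.del_fourier_mul, ← reassoc_of% D.comul_fourier,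
    reassoc_of% D.fourier_mulL_cap, comul_counit_left_assoc]

lemma fourier_dOp_fourier_uOp (W : S) :
    H ◁ fourier E lam ▷ W ≫ dOp (del E g) (𝕞 W) ≫ H ◁ fourier E lam ▷ W ≫ uOp MonObj.mul W =
      vOp (𝕞 W) := by
  have hm := isAct_mul (H := H)
  have h1 := vOp_linear (isAct_reg (H := H) W)
  have h2 := uOp_linear hm W
  have h3 := dOp_linear (del E g) (𝕞 W)
  set F := H ◁ fourier E lam ▷ W ≫ dOp (del E g) (𝕞 W) ≫ H ◁ fourier E lam ▷ W ≫ uOp MonObj.mul W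
    with hF
  have h4 : 𝕞 (H ⊗ W) ≫ F = H ◁ F ≫ diag (𝕞 (H ⊗ W)) (lact H (𝕞 W)) := by
    rw [hF, ← fuse_nat_assoc, reassoc_of% h3, ← fuse_nat_assoc, h2]
    simp only [whiskerLeft_comp, Category.assoc]
  have h5 : 𝕦 (H ⊗ W) ≫ F = 𝕦 (H ⊗ W) := by
    rw [hF, ← ins_nat_assoc, dOp, Category.assoc, Category.assoc, ← ins_nat_assoc, one_mul_assoc,
      D.fourier_del_fourier_uOp]
  have h6 : 𝕦 (H ⊗ W) ≫ vOp (𝕞 W) = 𝕦 (H ⊗ W) := by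
    rw [vOp, one_comul_assoc, ← ins_nat, one_mul_assoc]
  -- A linear map out of the free module is determined by its value on the unit.
  have h7 {F : H ⊗ H ⊗ W ⟶ H ⊗ H ⊗ W} (h : 𝕞 (H ⊗ W) ≫ F = H ◁ F ≫ diag (𝕞 (H ⊗ W)) (lact H (𝕞 W)))
      (h' : 𝕦 (H ⊗ W) ≫ F = 𝕦 (H ⊗ W)) :
      F = H ◁ 𝕦 (H ⊗ W) ≫ diag (𝕞 (H ⊗ W)) (lact H (𝕞 W)) := by
    rw [← h', whiskerLeft_comp_assoc, ← h, mul_one_assoc]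
  rw [h7 h4 h5, h7 h1 h6]

/-- $F(gF(h))=S^{-1}(h)$ exhibits $F$ as having inverses on both sides. -/
lemma isIso_fourier : IsIso (fourier E lam) := by
  have h (W : S) : fourier E lam ▷ W ≫ mulL g ▷ W ≫ fourier E lam ▷ W = inv 𝕤 ▷ W := by
    have hm := isAct_mul (H := H)
    -- Undo `uOp` in `fourier_del_fourier_uOp` and apply the counit to the first leg, where
    -- $\varepsilon(\delta_1)\delta_2=g$; on $1\otimes h$ this leaves $S^{-1}(h)$.
    have h1 := congrArg (fun f => f ≫ tOp MonObj.mul W ≫ 𝕖 (H ⊗ W)) (D.fourier_del_fourier_uOp W)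
    have h2 := uOp_tOp hm W
    have h3 : ins₂ (del E g) (H ⊗ W) ≫ 𝕖 (H ⊗ H ⊗ W) = ins g (H ⊗ W) := by
      rw [ins₂_del_antiR, Category.assoc, cap_nat, reassoc_of% D.counit_left, antiR,
        comp_whiskerRight, one_antipode_assoc, mulR_whiskerRight, ← ins_nat_assoc, one_mul,
        Category.comp_id]
    simp only [whiskerLeft_comp, Category.assoc] at h1
    rw [reassoc_of% h2, cap_nat, cap_nat_assoc, reassoc_of% h3,
      ← reassoc_of% mulL_whiskerRight] at h1
    rw [h1, tOp]
    simp only [whiskerLeft_comp, Category.assoc]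
    rw [bri_ins_assoc, cap_nat, cap_nat_assoc, bri_cap_assoc, comul_counit_right_assoc,
      whisker_exchange_assoc, mul_one, Category.comp_id]
  have h' : fourier E lam ≫ mulL g ≫ fourier E lam = inv 𝕤 :=
    ext_whiskerRight fun W => by simpa only [comp_whiskerRight] using h W
  have h1 : fourier E lam ≫ mulL g ≫ fourier E lam ≫ 𝕤 = 𝟙 H := by
    rw [reassoc_of% h', IsIso.inv_hom_id]
  have h2 : 𝕤 ≫ fourier E lam ≫ mulL g ≫ fourier E lam = 𝟙 H := by
    rw [h', IsIso.hom_inv_id]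
  refine ⟨mulL g ≫ fourier E lam ≫ 𝕤, h1, ?_⟩
  have h3 : mulL g ≫ fourier E lam ≫ 𝕤 = 𝕤 ≫ fourier E lam ≫ mulL g := by
    refine ((reassoc_of% h2) (mulL g ≫ fourier E lam ≫ 𝕤)).symm.trans ?_
    rw [h1, Category.comp_id]
  rw [h3]
  simpa only [Category.assoc] using h2

end HopfDatum

end

/-! ### From isomorphisms with the dual to copairings -/

section

variable {S : Type u} [Category.{v} S] [MonoidalCategory S] [BraidedCategory S]
variable {H : S} [HopfObj H]

local notation "𝕞" => fuse (MonObj.mul (X := H))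
local notation "𝕕" => fork (ComonObj.comul (X := H))
local notation "𝕦" => ins (MonObj.one (X := H))
local notation "𝕖" => cap (ComonObj.counit (X := H))
local notation "𝕤" => HopfObj.antipode (X := H)

section

variable {X Y Z : S}

lemma ins₂_comp (x : 𝟙_ S ⟶ X ⊗ Y) (f : Y ⟶ Z) (W : S) :
    ins₂ (x ≫ X ◁ f) W = ins₂ x W ≫ X ◁ f ▷ W := (ins₂_right x f W).symm

/-- The adjunction between $X\otimes-$ and $Y\otimes-$; it is the source of the nondegeneracy of the
copairing. -/
lemma coevaluation_cancel [ExactPairing X Y] {W : S} {f f' : Y ⊗ W ⟶ Z}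
    (h : ins₂ (η_ X Y) W ≫ X ◁ f = ins₂ (η_ X Y) W ≫ X ◁ f') : f = f' := by
  apply (tensorLeftHomEquiv W X Y Z).injective
  simpa [tensorLeftHomEquiv, ins₂] using h

lemma coevaluation_ext [ExactPairing X Y] {f f' : Y ⟶ Z}
    (h : η_ X Y ≫ X ◁ f = η_ X Y ≫ X ◁ f') : f = f' := by
  apply ext_whiskerRight
  intro W
  apply coevaluation_cancel (X := X)
  rw [ins₂_right, ins₂_right, h]

lemma ins₂_coevaluation_tensor [ExactPairing X Y] (k : Y ⊗ Y ⟶ Z) (W : S) :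
    ins₂ (η_ (X ⊗ X) (Y ⊗ Y) ≫ (X ⊗ X) ◁ k) W ≫ (α_ X X (Z ⊗ W)).hom =
      ins₂ (η_ X Y) W ≫ X ◁ ins₂ (η_ X Y) (Y ⊗ W) ≫ X ◁ X ◁ fuse k W := by
  rw [ExactPairing.tensor_coevaluation, ins₂_comp]
  simp only [ins₂, fuse, comp_whiskerRight, whiskerLeft_comp]
  monoidal

end

section Rigid

variable [RightRigidCategory S]

/-- The copairing `(id ⊗ Γ) ∘ coev`. -/
def copairing (Γ : (Hᘁ : S) ⟶ H) : 𝟙_ S ⟶ H ⊗ H := η_ H (Hᘁ : S) ≫ H ◁ Γ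

lemma copairing_cancel {Γ : (Hᘁ : S) ⟶ H} [IsIso Γ] {W Z : S} (f f' : H ⊗ W ⟶ Z)
    (h : ins₂ (copairing Γ) W ≫ H ◁ f = ins₂ (copairing Γ) W ≫ H ◁ f') : f = f' := by
  simp only [copairing, ins₂_comp, Category.assoc, ← whiskerLeft_comp] at h
  exact (cancel_epi _).1 (coevaluation_cancel h)

/-- The product of the dual is the mate of $\Delta$, so along coevaluation it becomes $\Delta$ on
the first leg. The nested duality of $H\otimes H$ is what reverses the products in the second leg.
-/
lemma copairing_mul_iff (Γ : (Hᘁ : S) ⟶ H) :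
    dualMul H ≫ Γ = (Γ ⊗ₘ Γ) ≫ MonObj.mul ↔ ∀ W, ins₂ (copairing Γ) W ≫ 𝕕 (H ⊗ W) =
      ins₂ (copairing Γ) W ≫ H ◁ ins₂ (copairing Γ) (H ⊗ W) ≫ H ◁ H ◁ 𝕞 W := by
  have h1 : η_ (H ⊗ H) ((Hᘁ : S) ⊗ (Hᘁ : S)) ≫ (H ⊗ H) ◁ dualMul H =
      η_ H (Hᘁ : S) ≫ ComonObj.comul ▷ (Hᘁ : S) :=
    @coevaluation_comp_rightAdjointMate S _ _ H (H ⊗ H) _ hasRightDualTensor ComonObj.comul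
  have h2 (W : S) : ins₂ (copairing Γ) W ≫ 𝕕 (H ⊗ W) =
      ins₂ (η_ (H ⊗ H) ((Hᘁ : S) ⊗ (Hᘁ : S)) ≫ (H ⊗ H) ◁ (dualMul H ≫ Γ)) W ≫ (α_ H H (H ⊗ W)).hom := by
    rw [whiskerLeft_comp, reassoc_of% h1, ← whisker_exchange, copairing, fork,
      reassoc_of% ins₂_left,
      Category.assoc]
  have h3 (W : S) : ins₂ (copairing Γ) W ≫ H ◁ ins₂ (copairing Γ) (H ⊗ W) ≫ H ◁ H ◁ 𝕞 W =
      ins₂ (η_ (H ⊗ H) ((Hᘁ : S) ⊗ (Hᘁ : S)) ≫ (H ⊗ H) ◁ ((Γ ⊗ₘ Γ) ≫ MonObj.mul)) W ≫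
        (α_ H H (H ⊗ W)).hom := by
    rw [ins₂_coevaluation_tensor, copairing, ins₂_comp, ins₂_comp]
    simp only [← whiskerLeft_comp, ← whiskerLeft_comp_assoc, Category.assoc]
    rw [ins₂_nat_assoc]
    simp only [← whiskerLeft_comp, Category.assoc]
    have h4 : (Hᘁ : S) ◁ Γ ▷ W ≫ Γ ▷ (H ⊗ W) ≫ 𝕞 W = fuse ((Γ ⊗ₘ Γ) ≫ MonObj.mul) W := by
      rw [MonoidalCategory.tensorHom_def']
      simp [fuse]
    rw [h4]
  refine ⟨fun h W => by rw [h2, h3, h],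
    fun h => coevaluation_ext (X := H ⊗ H) (ext_ins₂ fun W => ?_)⟩
  have := h W
  rw [h2, h3] at this
  exact (cancel_mono _).1 this

lemma copairing_comul_iff (Γ : (Hᘁ : S) ⟶ H) :
    Γ ≫ ComonObj.comul = dualComul H ≫ (Γ ⊗ₘ Γ) ↔ ∀ W, ins₂ (copairing Γ) W ≫ H ◁ 𝕕 W =
      ins₂ (copairing Γ) W ≫ H ◁ ins₂ (copairing Γ) (H ⊗ W) ≫ 𝕞 (H ⊗ H ⊗ W) := by
  have h1 : η_ H (Hᘁ : S) ≫ H ◁ dualComul H =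
      η_ (H ⊗ H) ((Hᘁ : S) ⊗ (Hᘁ : S)) ≫ MonObj.mul ▷ ((Hᘁ : S) ⊗ (Hᘁ : S)) :=
    @coevaluation_comp_rightAdjointMate S _ _ (H ⊗ H) H hasRightDualTensor _ MonObj.mul
  have h2 (W : S) : ins₂ (copairing Γ) W ≫ H ◁ 𝕕 W =
      ins₂ (η_ H (Hᘁ : S) ≫ H ◁ (Γ ≫ ComonObj.comul)) W ≫ H ◁ (α_ H H W).hom := by
    rw [copairing, ins₂_comp, ins₂_comp, fork]
    simp
  have h4 (W : S) : ins₂ (η_ (H ⊗ H) ((Hᘁ : S) ⊗ (Hᘁ : S))) W =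
      ins₂ (η_ H (Hᘁ : S)) W ≫ H ◁ ins₂ (η_ H (Hᘁ : S)) ((Hᘁ : S) ⊗ W) ≫
        (α_ H H _).inv ≫ (H ⊗ H) ◁ (α_ _ _ W).inv := by
    have := ins₂_coevaluation_tensor (X := H) (𝟙 ((Hᘁ : S) ⊗ (Hᘁ : S))) W
    rw [whiskerLeft_id, Category.comp_id] at this
    rw [← cancel_mono (α_ _ _ _).hom, this]
    simp [fuse]
  have h3 (W : S) : ins₂ (copairing Γ) W ≫ H ◁ ins₂ (copairing Γ) (H ⊗ W) ≫ 𝕞 (H ⊗ H ⊗ W) =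
      ins₂ (η_ H (Hᘁ : S) ≫ H ◁ (dualComul H ≫ (Γ ⊗ₘ Γ))) W ≫ H ◁ (α_ H H W).hom := by
    rw [whiskerLeft_comp, reassoc_of% h1, ← Category.assoc (η_ _ _), ins₂_comp, ← ins₂_left, h4,
      copairing,
      ins₂_comp, ins₂_comp, MonoidalCategory.tensorHom_def']
    simp only [← whiskerLeft_comp, ← whiskerLeft_comp_assoc, Category.assoc]
    have h5 : (Hᘁ : S) ◁ Γ ▷ W ≫ Γ ▷ (H ⊗ W) =
        (α_ _ _ W).inv ≫ ((Hᘁ : S) ◁ Γ ≫ Γ ▷ H) ▷ W ≫ (α_ _ _ _).hom := by simp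
    rw [ins₂_nat_assoc]
    simp only [whiskerLeft_comp, Category.assoc, fuse_nat, fuse_nat_assoc]
    simp only [fuse, whisker_exchange_assoc, Category.assoc]
    simp only [← whiskerLeft_comp, h5]
  refine ⟨fun h W => by rw [h2, h3, h], fun h => coevaluation_ext (X := H) (ext_ins₂ fun W => ?_)⟩
  have := h W
  rw [h2, h3] at this
  exact (cancel_mono _).1 this

lemma copairing_one_iff (Γ : (Hᘁ : S) ⟶ H) :
    dualOne H ≫ Γ = MonObj.one ↔ ∀ W, ins₂ (copairing Γ) W ≫ 𝕖 (H ⊗ W) = 𝕦 W := by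
  have h1 : η_ (𝟙_ S) (𝟙_ S) ≫ 𝟙_ S ◁ dualOne H = η_ H (Hᘁ : S) ≫ ComonObj.counit ▷ (Hᘁ : S) :=
    @coevaluation_comp_rightAdjointMate S _ _ H (𝟙_ S) _ hasRightDualUnit ComonObj.counit
  have h2 (W : S) : ins₂ (copairing Γ) W ≫ 𝕖 (H ⊗ W) = ins (dualOne H ≫ Γ) W := by
    have h0 : η_ (𝟙_ S) (𝟙_ S) = (ρ_ (𝟙_ S)).inv := rfl
    rw [cap, reassoc_of% ins₂_left, copairing, Category.assoc, whisker_exchange, ← reassoc_of% h1,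
      h0]
    simp [ins₂, ins, unitors_inv_equal]
  exact ⟨fun h W => by rw [h2, h], fun h => ext_ins fun W => by rw [← h2, h]⟩

lemma copairing_counit_iff (Γ : (Hᘁ : S) ⟶ H) :
    Γ ≫ ComonObj.counit = dualCounit H ↔ ∀ W, ins₂ (copairing Γ) W ≫ H ◁ 𝕖 W = 𝕦 W := by
  have h1 : η_ H (Hᘁ : S) ≫ H ◁ dualCounit H = η_ (𝟙_ S) (𝟙_ S) ≫ MonObj.one ▷ (𝟙_ S) :=
    @coevaluation_comp_rightAdjointMate S _ _ (𝟙_ S) H hasRightDualUnit _ MonObj.one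
  have h0 : η_ (𝟙_ S) (𝟙_ S) = (ρ_ (𝟙_ S)).inv := rfl
  have h2 (W : S) : ins₂ (copairing Γ) W ≫ H ◁ 𝕖 W =
      ins₂ (η_ H (Hᘁ : S) ≫ H ◁ (Γ ≫ ComonObj.counit)) W ≫ H ◁ (λ_ W).hom := by
    rw [copairing, cap, ins₂_comp, ins₂_comp]
    simp
  have h3 (W : S) : 𝕦 W = ins₂ (η_ H (Hᘁ : S) ≫ H ◁ dualCounit H) W ≫ H ◁ (λ_ W).hom := by
    rw [h1, h0]
    simp [ins₂, ins, ← comp_whiskerRight]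
  refine ⟨fun h W => by rw [h2, h, h3], fun h => coevaluation_ext (X := H) (ext_ins₂ fun W => ?_)⟩
  have := h W
  rw [h2, h3] at this
  exact (cancel_mono _).1 this

lemma copairing_antipode_iff (Γ : (Hᘁ : S) ⟶ H) :
    rightAdjointMate 𝕤 ≫ Γ = Γ ≫ 𝕤 ↔
      ∀ W, ins₂ (copairing Γ) W ≫ 𝕤 ▷ (H ⊗ W) = ins₂ (copairing Γ) W ≫ H ◁ 𝕤 ▷ W := by
  have h2 (W : S) : ins₂ (copairing Γ) W ≫ 𝕤 ▷ (H ⊗ W) =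
      ins₂ (η_ H (Hᘁ : S) ≫ H ◁ (rightAdjointMate 𝕤 ≫ Γ)) W := by
    rw [ins₂_left, whiskerLeft_comp, coevaluation_comp_rightAdjointMate_assoc, ← whisker_exchange,
      copairing, Category.assoc]
  have h3 (W : S) : ins₂ (copairing Γ) W ≫ H ◁ 𝕤 ▷ W =
      ins₂ (η_ H (Hᘁ : S) ≫ H ◁ (Γ ≫ 𝕤)) W := by
    rw [ins₂_right, whiskerLeft_comp, copairing, Category.assoc]
  refine ⟨fun h W => by rw [h2, h3, h], fun h => coevaluation_ext (X := H) (ext_ins₂ fun W => ?_)⟩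
  rw [← h2, ← h3, h]

lemma isHopfCopairing_iff (Γ : (Hᘁ : S) ⟶ H) [IsIso Γ] :
    IsHopfCopairing (copairing Γ) ↔ IsDualHopfIso Γ := by
  refine ⟨fun h => ⟨inferInstance, (copairing_mul_iff Γ).2 h.comul_left,
    (copairing_one_iff Γ).2 h.counit_left, (copairing_comul_iff Γ).2 h.comul_right,
    (copairing_counit_iff Γ).2 h.counit_right, (copairing_antipode_iff Γ).2 h.antipode⟩,
    fun h => ⟨(copairing_mul_iff Γ).1 h.mul, (copairing_comul_iff Γ).1 h.comul,
    (copairing_one_iff Γ).1 h.one, (copairing_counit_iff Γ).1 h.counit,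
    (copairing_antipode_iff Γ).1 h.antipode, copairing_cancel⟩⟩

/-! ### Self-duality without the twist -/

section Ribbon

variable [RibbonCategory S]

/-- The comparison of the two right duals `H` and `Hᘁᘁ` of `Hᘁ`. -/
lemma twist_inv_toDoubleDual (X : S) :
    (RibbonCategory.twist X).inv ≫ toDoubleDual X =
      (rightDualIso (BraidedCategory.exactPairing_swap X (Xᘁ : S)) inferInstance).hom := by
  change _ = (ρ_ _).inv ≫ X ◁ η_ (Xᘁ : S) _ ≫ X ◁ (𝟙 (Xᘁ : S)) ▷ _ ≫ (α_ _ _ _).inv ≫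
    ((β_ X (Xᘁ : S)).hom ≫ ε_ X (Xᘁ : S)) ▷ _ ≫ (λ_ _).hom
  rw [toDoubleDual, rightUnitor_inv_naturality_assoc, ← whisker_exchange_assoc,
    whiskerRight_tensor_assoc, comp_whiskerRight_assoc, Iso.hom_inv_id_assoc,
    ← comp_whiskerRight_assoc]
  simp

/-- The twist inside $\delta_H$ cancels $\theta_H^{-1}$, and what remains is the comparison of `H`
and `Hᘁᘁ` as right duals of `Hᘁ`. Through it, a statement about $\Gamma^\vee$ becomes one about the
braided copairing. -/
lemma self_dual_iff (Γ T : (Hᘁ : S) ⟶ H) :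
    rightAdjointMate Γ = T ≫ (RibbonCategory.twist H).inv ≫ toDoubleDual H ↔
      copairing T ≫ (β_ H H).hom = copairing Γ := by
  rw [twist_inv_toDoubleDual]
  set u := (rightDualIso (BraidedCategory.exactPairing_swap H (Hᘁ : S))
    (inferInstance : ExactPairing (Hᘁ : S) ((Hᘁ : S)ᘁ : S))) with hu
  -- The comparison carries the braided coevaluation of `H` to the coevaluation of the double dual.
  have h1 : (η_ H (Hᘁ : S) ≫ (β_ (Hᘁ : S) H).inv) ≫ (Hᘁ : S) ◁ u.hom =
      η_ (Hᘁ : S) ((Hᘁ : S)ᘁ : S) ≫ (𝟙 (Hᘁ : S)) ▷ _ :=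
    @coevaluation_comp_rightAdjointMate S _ _ (Hᘁ : S) (Hᘁ : S) _
      (@HasRightDual.mk S _ _ (Hᘁ : S) H (BraidedCategory.exactPairing_swap H (Hᘁ : S))) (𝟙 _)
  rw [id_whiskerRight, Category.comp_id] at h1
  have h2 := coevaluation_comp_rightAdjointMate Γ
  rw [← h1, Category.assoc, whisker_exchange] at h2
  have h3 : (β_ (Hᘁ : S) H).inv ≫ Γ ▷ H = H ◁ Γ ≫ (β_ H H).inv := by
    simp
  simp only [Category.assoc] at h2
  rw [reassoc_of% h3] at h2
  constructor
  · intro h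
    rw [h, whiskerLeft_comp] at h2
    have h4 : η_ H (Hᘁ : S) ≫ H ◁ T = η_ H (Hᘁ : S) ≫ H ◁ Γ ≫ (β_ H H).inv := by
      rw [← cancel_mono (H ◁ u.hom)]
      simpa using h2
    rw [copairing, h4, copairing]
    simp
  · intro h
    apply coevaluation_ext (X := H)
    have h4 : η_ H (Hᘁ : S) ≫ H ◁ Γ = η_ H (Hᘁ : S) ≫ H ◁ T ≫ (β_ H H).hom := by
      simpa only [copairing, Category.assoc] using h.symm
    rw [h2, reassoc_of% h4]
    simp

end Ribbon

end Rigid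

/-! ### Extracting the Hopf datum -/

section Admissible

variable [RightRigidCategory S]

lemma isMulInverse_iff (x y : 𝟙_ S ⟶ H) : IsMulInverse x y ↔
    (∀ W, ins y W ≫ ins x (H ⊗ W) ≫ 𝕞 W = 𝕦 W) ∧ (∀ W, ins x W ≫ ins y (H ⊗ W) ≫ 𝕞 W = 𝕦 W) := by
  have h (x y : 𝟙_ S ⟶ H) (W : S) : ins y W ≫ ins x (H ⊗ W) ≫ 𝕞 W =
      ins ((λ_ (𝟙_ S)).inv ≫ (x ⊗ₘ y) ≫ MonObj.mul) W := by
    rw [MonoidalCategory.tensorHom_def']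
    simp only [ins, fuse, comp_whiskerRight]
    monoidal
  simp only [IsMulInverse, h]
  exact ⟨fun h => ⟨fun W => by rw [h.1], fun W => by rw [h.2]⟩, fun h => ⟨ext_ins h.1, ext_ins h.2⟩⟩

variable {lam : H ⟶ 𝟙_ S} {g : 𝟙_ S ⟶ H}

lemma isRightCointegral_iff : IsRightCointegral H lam ↔
    ∀ W, 𝕕 W ≫ cap lam (H ⊗ W) = cap lam W ≫ 𝕦 W := by
  have h (W : S) : 𝕕 W ≫ cap lam (H ⊗ W) = (ComonObj.comul ≫ lam ▷ H ≫ (λ_ H).hom) ▷ W := by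
    simp [fork, cap]
  simp only [IsRightCointegral, h, cap_ins]
  exact ⟨fun h W => by rw [h], ext_whiskerRight⟩

lemma isDistinguished_iff : IsDistinguished lam g ↔
    ∀ W, 𝕕 W ≫ H ◁ cap lam W = cap lam W ≫ ins g W := by
  have h (W : S) : 𝕕 W ≫ H ◁ cap lam W = (ComonObj.comul ≫ H ◁ lam ≫ (ρ_ H).hom) ▷ W := by
    simp [fork, cap]
  simp only [IsDistinguished, h, cap_ins]
  exact ⟨fun h W => by rw [h], ext_whiskerRight⟩

lemma normalised_iff (E : 𝟙_ S ⟶ H ⊗ H) :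
    E ≫ (lam ⊗ₘ lam) ≫ (λ_ (𝟙_ S)).hom = 𝟙 (𝟙_ S) ↔
      ∀ W, ins₂ E W ≫ H ◁ cap lam W ≫ cap lam W = 𝟙 W := by
  have h (W : S) : ins₂ E W ≫ H ◁ cap lam W ≫ cap lam W =
      (λ_ W).inv ≫ (E ≫ (lam ⊗ₘ lam) ≫ (λ_ (𝟙_ S)).hom) ▷ W ≫ (λ_ W).hom := by
    rw [MonoidalCategory.tensorHom_def']
    simp only [ins₂, cap, comp_whiskerRight, whiskerLeft_comp]
    monoidal
  simp only [h]
  refine ⟨fun h W => by simp [h], fun h => ext_whiskerRight fun W => ?_⟩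
  rw [← cancel_epi (λ_ W).inv, ← cancel_mono (λ_ W).hom, Category.assoc, h]
  simp

/-- Because $\lambda$ can be cancelled on the left, the counit and coproduct axioms applied to
$(\mathrm{id}\otimes\lambda)\circ\Delta=g\circ\lambda$ make $g$ grouplike. -/
lemma distinguished_counit (h1 : ∀ W, 𝕕 W ≫ H ◁ cap lam W = cap lam W ≫ ins g W)
    (h2 : ∀ W, Epi (cap lam W)) (W : S) : ins g W ≫ 𝕖 W = 𝟙 W := by
  have := h2 W
  rw [← cancel_epi (cap lam W), ← Category.assoc, ← h1, Category.assoc, cap_nat,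
    comul_counit_left_assoc, Category.comp_id]

lemma distinguished_comul (h1 : ∀ W, 𝕕 W ≫ H ◁ cap lam W = cap lam W ≫ ins g W)
    (h2 : ∀ W, Epi (cap lam W)) (W : S) : ins g W ≫ 𝕕 W = ins g W ≫ ins g (H ⊗ W) := by
  have := h2 W
  rw [← cancel_epi (cap lam W), ← Category.assoc, ← h1, Category.assoc, fork_nat,
    comul_comul_assoc, ← whiskerLeft_comp, h1, whiskerLeft_comp, reassoc_of% h1, ← ins_nat]

lemma distinguished_antipode_left (h1 : ∀ W, 𝕕 W ≫ H ◁ cap lam W = cap lam W ≫ ins g W)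
    (h2 : ∀ W, Epi (cap lam W)) (W : S) :
    ins g W ≫ ins (g ≫ 𝕤) (H ⊗ W) ≫ 𝕞 W = 𝕦 W := by
  rw [← ins_comp, Category.assoc, ← reassoc_of% distinguished_comul h1 h2, antipode_left,
    reassoc_of% distinguished_counit h1 h2]

lemma distinguished_antipode_right (h1 : ∀ W, 𝕕 W ≫ H ◁ cap lam W = cap lam W ≫ ins g W)
    (h2 : ∀ W, Epi (cap lam W)) (W : S) :
    ins (g ≫ 𝕤) W ≫ ins g (H ⊗ W) ≫ 𝕞 W = 𝕦 W := by
  rw [← ins_comp, Category.assoc, ins_nat_assoc, ← reassoc_of% distinguished_comul h1 h2,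
    antipode_right, reassoc_of% distinguished_counit h1 h2]

variable [IsIso (HopfObj.antipode (X := H))] [RibbonCategory S] {Γ : (Hᘁ : S) ⟶ H}

lemma mulR_antipode (x : 𝟙_ S ⟶ H) : mulR x ≫ 𝕤 = 𝕤 ≫ mulL (x ≫ 𝕤) := by
  apply ext_whiskerRight
  intro W
  rw [comp_whiskerRight, comp_whiskerRight, mulR_whiskerRight, mulL_whiskerRight, Category.assoc,
    mul_antipode, ← whiskerLeft_comp_assoc, ins_comp, whisker_exchange_assoc, braid_ins_assoc]

lemma mulL_antipode (x : 𝟙_ S ⟶ H) : mulL x ≫ 𝕤 = 𝕤 ≫ mulR (x ≫ 𝕤) := by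
  apply ext_whiskerRight
  intro W
  rw [comp_whiskerRight, comp_whiskerRight, mulR_whiskerRight, mulL_whiskerRight, Category.assoc,
    mul_antipode, ← ins_nat_assoc, ins_comp_assoc, ins_braid_assoc]

lemma mulR_comp_mulL (x y : 𝟙_ S ⟶ H) : mulR x ≫ mulL y = mulL y ≫ mulR x := by
  apply ext_whiskerRight
  intro W
  simp only [comp_whiskerRight, mulR_whiskerRight, mulL_whiskerRight, Category.assoc]
  rw [ins_nat_assoc, ← mul_mul, ins_nat_assoc, fuse_nat_assoc]

lemma mulL_comp_eq_id {x y : 𝟙_ S ⟶ H} (h : ∀ W, ins x W ≫ ins y (H ⊗ W) ≫ 𝕞 W = 𝕦 W) :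
    mulL x ≫ mulL y = 𝟙 H := by
  apply ext_whiskerRight
  intro W
  simp only [comp_whiskerRight, mulL_whiskerRight, Category.assoc]
  rw [ins_nat_assoc, ← mul_mul, reassoc_of% h, one_mul, id_whiskerRight]

/-- $S(x)$ is invertible, and multiplying it by $x$ or by $S^2(x)$ gives the unit; hence the two
agree. -/
lemma antipode_inverse {x : 𝟙_ S ⟶ H}
    (h1 : ∀ W, ins (x ≫ 𝕤) W ≫ ins x (H ⊗ W) ≫ 𝕞 W = 𝕦 W)
    (h2 : ∀ W, ins x W ≫ ins (x ≫ 𝕤) (H ⊗ W) ≫ 𝕞 W = 𝕦 W) : (x ≫ 𝕤) ≫ 𝕤 = x := by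
  apply ext_ins
  intro W
  have h3 := congrArg (fun f => f ≫ 𝕤 ▷ W) (h2 W)
  simp only [whiskerLeft_comp, Category.assoc] at h3
  rw [mul_antipode, one_antipode, ← ins_nat_assoc, ins_comp_assoc, ins_comp_assoc,
    ins_braid_assoc, ← ins_nat_assoc] at h3
  have h4 := congrArg (fun f => f ▷ W) (mulL_comp_eq_id h1)
  simp only [comp_whiskerRight, id_whiskerRight] at h4
  have h5 : ins ((x ≫ 𝕤) ≫ 𝕤) W ≫ mulL (x ≫ 𝕤) ▷ W = ins x W ≫ mulL (x ≫ 𝕤) ▷ W := by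
    rw [mulL_whiskerRight, h2, h3]
  rw [← Category.comp_id (ins _ W), ← h4, ← Category.assoc, h5, Category.assoc, h4,
    Category.comp_id]

/-- Replace the `E` inside $\gamma$ by its flipped twisted form. The $S^{-1}$, placed on the other
leg, cancels one $S$ of $S^2$, and left multiplication by $g$ cancels the $g^{-1}$ of
$\mathrm{Ad}_{g^{-1}}$. What remains is $S$ followed by right multiplication by $g$, the second leg
of $\delta$. -/
lemma copairing_symm {E : 𝟙_ S ⟶ H ⊗ H} (hE : IsHopfCopairing E) {gi : 𝟙_ S ⟶ H}
    (h1 : mulL gi ≫ mulL g = 𝟙 H) (h2 : mulR g ≫ mulL gi ≫ 𝕤 ≫ 𝕤 = 𝕤 ≫ 𝕤 ≫ mulR g ≫ mulL gi)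
    (h3 : (E ≫ H ◁ (mulR g ≫ mulL gi ≫ 𝕤 ≫ 𝕤)) ≫ (β_ H H).hom = E) (W : S) :
    ins₂ (del E g) W ≫ br H H W = ins₂ (gam E) W ≫ ins g (H ⊗ H ⊗ W) ≫ 𝕞 (H ⊗ W) := by
  have h4 : ins₂ E W ≫ H ◁ (𝕤 ≫ 𝕤 ≫ mulR g ≫ mulL gi) ▷ W ≫ br H H W = ins₂ E W := by
    rw [← h2]
    conv_rhs => rw [← h3]
    rw [br, ins₂_right_assoc]
    simp only [ins₂, comp_whiskerRight, Category.assoc, Iso.hom_inv_id_assoc]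
  have h5 : inv 𝕤 ≫ (𝕤 ≫ 𝕤 ≫ mulR g ≫ mulL gi) ≫ mulL g = 𝕤 ≫ mulR g := by
    simp [h1]
  rw [ins₂_gam, ← mulL_whiskerRight]
  conv_rhs => rw [← h4]
  simp only [Category.assoc]
  rw [← whisker_braid_assoc, ← braid_whisker, whisker_exchange_assoc,
    ← reassoc_of% hE.ins₂_gam',
    ins₂_gam_assoc, del, ← h5, ← ins₂_right]
  simp only [comp_whiskerRight, whiskerLeft_comp, Category.assoc]

lemma IsAdmissible.hopfDatum (h : IsAdmissible Γ lam g) :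
    HopfDatum H (copairing Γ) lam g (g ≫ 𝕤) := by
  have := h.hopf_iso.isIso
  have hE := (isHopfCopairing_iff Γ).2 h.hopf_iso
  have hn := (normalised_iff (copairing Γ)).1 (by simpa [copairing] using h.normalised)
  have hd := isDistinguished_iff.1 h.distinguished
  -- By normalisation, inserting $\lambda(e_1)e_2$ is a section of $\lambda$.
  have he (W : S) : Epi (cap lam W) := by
    refine (SplitEpi.mk (ins₂ (copairing Γ) W ≫ cap lam (H ⊗ W)) ?_).epi
    rw [Category.assoc, ← cap_nat, hn]
  have h1 := distinguished_antipode_left hd he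
  have h2 := distinguished_antipode_right hd he
  have h3 := h.self_dual (g ≫ 𝕤) ((isMulInverse_iff _ _).2 ⟨h2, h1⟩)
  have h4 := (self_dual_iff Γ (Γ ≫ (mulR g ≫ mulL (g ≫ 𝕤)) ≫ 𝕤 ≫ 𝕤)).1 (by
    simpa only [Category.assoc] using h3)
  -- $S^2$ fixes $g$ and $g^{-1}=S(g)$, hence commutes with $\mathrm{Ad}_{g^{-1}}$.
  have h5 : mulR g ≫ mulL (g ≫ 𝕤) ≫ 𝕤 ≫ 𝕤 = 𝕤 ≫ 𝕤 ≫ mulR g ≫ mulL (g ≫ 𝕤) := by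
    rw [reassoc_of% mulL_antipode, antipode_inverse h2 h1, mulR_antipode, reassoc_of% mulR_antipode,
      reassoc_of% mulL_antipode, antipode_inverse h2 h1, mulR_comp_mulL]
  exact
    { hE with
      cointegral := isRightCointegral_iff.1 h.cointegral
      distinguished := hd
      normalised := hn
      g_counit := distinguished_counit hd he
      g_comul := distinguished_comul hd he
      g_gi := h1
      gi_g := h2
      symm := copairing_symm hE (mulL_comp_eq_id h2) h5 (by
        simpa only [copairing, whiskerLeft_comp, Category.assoc] using h4) }

end Admissible

section Coefficients

variable [RightRigidCategory S] [IsIso (HopfObj.antipode (X := H))]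

lemma gammaOf_eq (Γ : (Hᘁ : S) ⟶ H) : gammaOf Γ = gam (copairing Γ) := by
  simp [gammaOf, gam, copairing]

lemma deltaOf_eq (Γ : (Hᘁ : S) ⟶ H) (g : 𝟙_ S ⟶ H) : deltaOf Γ g = del (copairing Γ) g := by
  simp only [deltaOf, gammaOf, del, copairing, Category.assoc, ← whiskerLeft_comp,
    IsIso.inv_hom_id_assoc]

/-- With $S^{-1}$ moved to the first leg of $\gamma$, the $S$ in the definition of $\phi$ cancels
it. -/
lemma phiOf_eq {Γ : (Hᘁ : S) ⟶ H} (h : IsHopfCopairing (copairing Γ)) (lam : H ⟶ 𝟙_ S) :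
    phiOf Γ lam = fourier (copairing Γ) lam := by
  apply ext_whiskerRight
  intro W
  have h1 : phiOf Γ lam ▷ W = ins₂ (gam (copairing Γ)) (H ⊗ W) ≫ 𝕤 ▷ (H ⊗ H ⊗ W) ≫ H ◁ 𝕞 W ≫
      H ◁ cap lam W := by
    rw [phiOf, gammaOf_eq, MonoidalCategory.tensorHom_def]
    simp only [ins₂, fuse, cap, comp_whiskerRight, whiskerLeft_comp]
    monoidal
  rw [h1, h.ins₂_gam', Category.assoc, inv_antipode_assoc, fourier_whiskerRight]

end Coefficients

end

/-! ### Change of bracketing, and actions on tensor products -/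

section

variable {S : Type u} [Category.{v} S] [MonoidalCategory S] [BraidedCategory S]
variable {H : S} [HopfObj H]

local notation "𝕞" => fuse (MonObj.mul (X := H))
local notation "𝕕" => fork (ComonObj.comul (X := H))
local notation "𝕦" => ins (MonObj.one (X := H))
local notation "𝕖" => cap (ComonObj.counit (X := H))
local notation "𝕤" => HopfObj.antipode (X := H)

section Conj

variable {A B M M' N : S}

/-- An action transported along an isomorphism. -/
def conjAct (e : M ≅ M') (s : H ⊗ M' ⟶ M') : H ⊗ M ⟶ M := H ◁ e.hom ≫ s ≫ e.inv

lemma conjAct_hom (e : M ≅ M') (s : H ⊗ M' ⟶ M') : conjAct e s ≫ e.hom = H ◁ e.hom ≫ s := by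
  simp [conjAct]

/-- Bracketings are handled by writing an action on one bracketing as the transport of that on
another; operators are then conjugated by associators. -/
lemma conjAct_eq {e : M ≅ M'} {r : H ⊗ M ⟶ M} {s : H ⊗ M' ⟶ M'} (h : r ≫ e.hom = H ◁ e.hom ≫ s) :
    r = conjAct e s := by
  rw [conjAct, ← reassoc_of% h, Iso.hom_inv_id, Category.comp_id]

lemma vOp_conjAct (e : M ≅ M') (s : H ⊗ M' ⟶ M') :
    vOp (conjAct e s) = H ◁ e.hom ≫ vOp s ≫ H ◁ e.inv := by
  rw [reassoc_of% vOp_natural (conjAct_hom e s), ← whiskerLeft_comp, Iso.hom_inv_id,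
    whiskerLeft_id, Category.comp_id]

lemma dOp_conjAct (x : 𝟙_ S ⟶ H ⊗ H) (e : M ≅ M') (s : H ⊗ M' ⟶ M') :
    dOp x (conjAct e s) = H ◁ e.hom ≫ dOp x s ≫ H ◁ e.inv := by
  rw [reassoc_of% dOp_natural x (conjAct_hom e s), ← whiskerLeft_comp, Iso.hom_inv_id,
    whiskerLeft_id, Category.comp_id]

lemma gOp_conjAct (x : 𝟙_ S ⟶ H ⊗ H) (e : M ≅ M') (r s : H ⊗ M' ⟶ M') :
    gOp x (conjAct e r) (conjAct e s) = e.hom ≫ gOp x r s ≫ e.inv := by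
  rw [reassoc_of% gOp_natural x (conjAct_hom e r) (conjAct_hom e s), Iso.hom_inv_id,
    Category.comp_id]

lemma lact_conjAct (A : S) (e : M ≅ M') (s : H ⊗ M' ⟶ M') :
    lact A (conjAct e s) = conjAct (whiskerLeftIso A e) (lact A s) :=
  conjAct_eq (lact_natural A (conjAct_hom e s))

lemma diag_conjAct (e : M ≅ M') (r s : H ⊗ M' ⟶ M') :
    diag (conjAct e r) (conjAct e s) = conjAct e (diag r s) := by
  apply conjAct_eq
  rw [diag, Category.assoc, Category.assoc, conjAct_hom, ← whiskerLeft_comp_assoc, conjAct_hom,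
    whiskerLeft_comp_assoc, ← fork_nat_assoc, diag]

lemma fuse_whiskerLeftIso (r : H ⊗ M ⟶ M) {W W' : S} (e : W ≅ W') :
    fuse r W = conjAct (whiskerLeftIso M e) (fuse r W') :=
  conjAct_eq (fuse_nat r e.hom).symm

lemma br_tensor (A B W : S) : br H (A ⊗ B) W = H ◁ (α_ A B W).hom ≫ br H A (B ⊗ W) ≫
    A ◁ br H B W ≫ (α_ A B (H ⊗ W)).inv := by
  simp only [br, BraidedCategory.braiding_tensor_right_hom]
  monoidal

lemma bri_tensor (A B W : S) : bri H (A ⊗ B) W = (α_ A B (H ⊗ W)).hom ≫ A ◁ bri H B W ≫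
    bri H A (B ⊗ W) ≫ H ◁ (α_ A B W).inv := by
  rw [← cancel_epi (br H (A ⊗ B) W), br_bri, br_tensor]
  simp

lemma lact_tensor (A B : S) (s : H ⊗ M ⟶ M) :
    lact (A ⊗ B) s = conjAct (α_ A B M) (lact A (lact B s)) := by
  simp only [lact, br_tensor, conjAct, whiskerLeft_comp, Category.assoc, tensor_whiskerLeft,
    Iso.inv_hom_id_assoc]

lemma fuse_fuse_tensor (r : H ⊗ A ⟶ A) (B W : S) :
    fuse (fuse r B) W = conjAct (α_ A B W) (fuse r (B ⊗ W)) := by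
  simp only [fuse, conjAct, comp_whiskerRight]
  monoidal

lemma fuse_lact (s : H ⊗ M ⟶ M) (W : S) :
    fuse (lact A s) W = conjAct (α_ A M W) (lact A (fuse s W)) := by
  simp only [fuse, lact, br, conjAct, comp_whiskerRight, whiskerLeft_comp]
  monoidal

lemma fuse_diag (r s : H ⊗ M ⟶ M) (W : S) : fuse (diag r s) W = diag (fuse r W) (fuse s W) := by
  simp only [fuse, diag, fork, comp_whiskerRight, whiskerLeft_comp]
  monoidal

lemma lact_diag (A : S) (r s : H ⊗ M ⟶ M) : lact A (diag r s) = diag (lact A r) (lact A s) := by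
  simp only [lact, diag, whiskerLeft_comp, Category.assoc]
  rw [fork_braid_assoc, br_nat_assoc]

lemma diag_diag (r s t : H ⊗ M ⟶ M) : diag (diag r s) t = diag r (diag s t) := by
  simp only [diag, whiskerLeft_comp, Category.assoc]
  rw [fork_nat_assoc, comul_comul_assoc]

lemma vOp_whiskerRight (s : H ⊗ M ⟶ M) (W : S) :
    vOp s ▷ W = (α_ H M W).hom ≫ vOp (fuse s W) ≫ (α_ H M W).inv := by
  simp only [fuse, vOp, fork, comp_whiskerRight, whiskerLeft_comp]
  monoidal

lemma dOp_whiskerRight (x : 𝟙_ S ⟶ H ⊗ H) (s : H ⊗ M ⟶ M) (W : S) :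
    dOp x s ▷ W = (α_ H M W).hom ≫ dOp x (fuse s W) ≫ (α_ H M W).inv := by
  simp only [fuse, dOp, ins₂, comp_whiskerRight, whiskerLeft_comp]
  monoidal

lemma gOp_whiskerRight (x : 𝟙_ S ⟶ H ⊗ H) (r s : H ⊗ M ⟶ M) (W : S) :
    gOp x r s ▷ W = gOp x (fuse r W) (fuse s W) := by
  simp only [fuse, gOp, ins₂, comp_whiskerRight, whiskerLeft_comp]
  monoidal

lemma bri_whiskerRight (A W D : S) : bri H A W ▷ D = (α_ A (H ⊗ W) D).hom ≫ A ◁ (α_ H W D).hom ≫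
    bri H A (W ⊗ D) ≫ H ◁ (α_ A W D).inv ≫ (α_ H (A ⊗ W) D).inv := by
  simp only [bri, comp_whiskerRight, whiskerLeft_comp]
  monoidal

/-- Coassociativity: acting diagonally on $A\otimes B$ is passing first `A`, then `B`, each time
leaving one leg of the coproduct behind. -/
lemma uOp_diag (r : H ⊗ A ⟶ A) (s : H ⊗ B ⟶ B) (W : S) :
    uOp (diag (fuse r B) (lact A s)) W = H ◁ (α_ A B W).hom ≫ uOp r (B ⊗ W) ≫ A ◁ uOp s W ≫
      (α_ A B (H ⊗ W)).inv := by
  have h := congrArg (fun f => H ◁ f) (fork_braid (ComonObj.comul (X := H)) A (B ⊗ W))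
  simp only [whiskerLeft_comp, Category.assoc] at h
  rw [uOp, fuse_diag, fuse_fuse_tensor, fuse_lact, diag_conjAct, conjAct, br_tensor]
  simp only [uOp, diag, lact, whiskerLeft_comp, Category.assoc, fuse_nat_assoc, fuse_nat]
  rw [← whiskerLeft_comp_assoc H (α_ A B (H ⊗ W)).inv, Iso.inv_hom_id, whiskerLeft_id,
    Category.id_comp, ← fork_nat_assoc, fork_nat_assoc _ (A ◁ br H B W),
    fork_nat_assoc _ (br H A (B ⊗ W)), comul_comul_assoc]
  simp only [← fuse_nat_assoc]
  rw [reassoc_of% h, whiskerLeft_br_nat_assoc]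

lemma uOp_fuse (r : H ⊗ A ⟶ A) (B W : S) :
    uOp (fuse r B) W = H ◁ (α_ A B W).hom ≫ uOp r (B ⊗ W) ≫ A ◁ br H B W ≫
      (α_ A B (H ⊗ W)).inv := by
  rw [uOp, uOp, fuse_fuse_tensor, conjAct, br_tensor]
  simp only [Category.assoc]
  rw [← fuse_nat_assoc, fork_nat_assoc]
  simp

end Conj

end

/-! ### The thirteen nontrivial pentagon identities -/

section

variable {S : Type u} [Category.{v} S] [MonoidalCategory S] [BraidedCategory S]
variable {H : S} [HopfObj H]

local notation "𝕞" => fuse (MonObj.mul (X := H))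
local notation "𝕕" => fork (ComonObj.comul (X := H))
local notation "𝕦" => ins (MonObj.one (X := H))
local notation "𝕖" => cap (ComonObj.counit (X := H))
local notation "𝕤" => HopfObj.antipode (X := H)

section

variable {X Y : S} (e : X ≅ Y) (A B C : S)

@[simp]
lemma whiskerLeft₂_inv_hom : A ◁ B ◁ e.inv ≫ A ◁ B ◁ e.hom = 𝟙 _ := by
  rw [← whiskerLeft_comp, whiskerLeft_inv_hom, whiskerLeft_id]

@[simp]
lemma whiskerLeft₂_inv_hom_assoc : type_of% (reassoc_of% @whiskerLeft₂_inv_hom) := @(reassoc_of% @whiskerLeft₂_inv_hom)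

@[simp]
lemma whiskerLeft₃_inv_hom : A ◁ B ◁ C ◁ e.inv ≫ A ◁ B ◁ C ◁ e.hom = 𝟙 _ := by
  rw [← whiskerLeft_comp, whiskerLeft₂_inv_hom, whiskerLeft_id]

@[simp]
lemma whiskerLeft₃_inv_hom_assoc : type_of% (reassoc_of% @whiskerLeft₃_inv_hom) := @(reassoc_of% @whiskerLeft₃_inv_hom)

end

section TOp

variable [IsIso (HopfObj.antipode (X := H))] {A B M : S}

lemma tOp_nat (r : H ⊗ A ⟶ A) {W W' : S} (f : W ⟶ W') :
    A ◁ H ◁ f ≫ tOp r W' = tOp r W ≫ H ◁ A ◁ f := by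
  simp only [tOp, Category.assoc]
  rw [bri_nat_assoc, fork_nat_assoc, bri_nat_assoc, ← whiskerLeft_comp_assoc, whisker_exchange]
  simp only [whiskerLeft_comp, Category.assoc, whiskerLeft_fuse_nat]

lemma tOp_nat_assoc : type_of% (reassoc_of% @tOp_nat) := @(reassoc_of% @tOp_nat)

lemma tOp_eq {r : H ⊗ A ⟶ A} (hr : IsAct r) {W : S} {f : A ⊗ (H ⊗ W) ⟶ H ⊗ (A ⊗ W)}
    (h : uOp r W ≫ f = 𝟙 _) : tOp r W = f := by
  rw [← Category.comp_id (tOp r W), ← h, reassoc_of% tOp_uOp hr]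

lemma tOp_whiskerRight (r : H ⊗ A ⟶ A) (W D : S) :
    tOp r W ▷ D = (α_ A (H ⊗ W) D).hom ≫ A ◁ (α_ H W D).hom ≫ tOp r (W ⊗ D) ≫
      H ◁ (α_ A W D).inv ≫ (α_ H (A ⊗ W) D).inv := by
  simp only [tOp, fuse, fork, bri, comp_whiskerRight, whiskerLeft_comp]
  monoidal

/-- Inverse to `uOp_diag`, which avoids computing with $S^{-1}$. -/
lemma tOp_diag {r : H ⊗ A ⟶ A} {s : H ⊗ B ⟶ B} (hr : IsAct r) (hs : IsAct s) (W : S) :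
    tOp (diag (fuse r B) (lact A s)) W = (α_ A B (H ⊗ W)).hom ≫ A ◁ tOp s W ≫ tOp r (B ⊗ W) ≫
      H ◁ (α_ A B W).inv := by
  apply tOp_eq ((hr.fuse B).diag (hs.lact A) (comm_fuse_lact r s))
  rw [uOp_diag]
  simp only [Category.assoc, Iso.inv_hom_id_assoc]
  rw [← whiskerLeft_comp_assoc A, uOp_tOp hs, whiskerLeft_id, Category.id_comp,
    reassoc_of% uOp_tOp hr]
  simp

lemma tOp_fuse {r : H ⊗ A ⟶ A} (hr : IsAct r) (B W : S) :
    tOp (fuse r B) W = (α_ A B (H ⊗ W)).hom ≫ A ◁ bri H B W ≫ tOp r (B ⊗ W) ≫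
      H ◁ (α_ A B W).inv := by
  apply tOp_eq (hr.fuse B)
  rw [uOp_fuse]
  simp only [Category.assoc, Iso.inv_hom_id_assoc]
  rw [← whiskerLeft_comp_assoc A, br_bri, whiskerLeft_id, Category.id_comp,
    reassoc_of% uOp_tOp hr]
  simp

end TOp

lemma Comm.diag_left {N : S} {r₁ r₂ r₃ : H ⊗ N ⟶ N} (h₁ : Comm r₁ r₃) (h₂ : Comm r₂ r₃) :
    Comm (diag r₁ r₂) r₃ := by
  rw [Comm] at h₁ h₂ ⊢
  have h := congrArg (fun f => H ◁ f) (h₂)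
  simp only [whiskerLeft_comp, Category.assoc] at h
  simp only [diag, whiskerLeft_comp, Category.assoc]
  rw [h₁, br_nat_assoc, reassoc_of% h, fork_nat_assoc, braid_fork_assoc]

lemma Comm.diag_right {N : S} {r₁ r₂ r₃ : H ⊗ N ⟶ N} (h₁ : Comm r₁ r₂) (h₂ : Comm r₁ r₃) :
    Comm r₁ (diag r₂ r₃) := by
  rw [Comm] at h₁ h₂ ⊢
  have h := congrArg (fun f => H ◁ f) (h₂)
  simp only [whiskerLeft_comp, Category.assoc] at h
  simp only [diag, whiskerLeft_comp, Category.assoc]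
  rw [fork_nat_assoc, reassoc_of% h, h₁, br_nat_assoc, fork_braid_assoc]

namespace IsHopfCopairing

variable [IsIso (HopfObj.antipode (X := H))] {E : 𝟙_ S ⟶ H ⊗ H} (hE : IsHopfCopairing E)
  {N : S} {r s : H ⊗ N ⟶ N}
include hE

lemma gOp_gam_eq (hr : IsAct r) (hs : IsAct s) (h : Comm r s) {f : N ⟶ N}
    (hf : gOp E r s ≫ f = 𝟙 N) : gOp (gam E) r s = f := by
  rw [← Category.comp_id (gOp _ r s), ← hf, reassoc_of% hE.gOp_gam_comp hr hs h]

/-- The bicharacter property passed to inverses, which reverses the order of the two factors. -/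
lemma gOp_gam_diag_left {r₁ r₂ r₃ : H ⊗ N ⟶ N} (h₁ : IsAct r₁) (h₂ : IsAct r₂) (h₃ : IsAct r₃)
    (h₁₂ : Comm r₁ r₂) (h₁₃ : Comm r₁ r₃) (h₂₃ : Comm r₂ r₃) :
    gOp (gam E) (diag r₁ r₂) r₃ = gOp (gam E) r₂ r₃ ≫ gOp (gam E) r₁ r₃ := by
  apply hE.gOp_gam_eq (h₁.diag h₂ h₁₂) h₃ (h₁₃.diag_left h₂₃)
  rw [hE.gOp_diag_left h₃ h₁₂ h₁₃, Category.assoc, reassoc_of% hE.gOp_comp_gam h₂ h₃ h₂₃,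
    hE.gOp_comp_gam h₁ h₃ h₁₃]

lemma gOp_gam_diag_right {r₁ r₂ r₃ : H ⊗ N ⟶ N} (h₁ : IsAct r₁) (h₂ : IsAct r₂) (h₃ : IsAct r₃)
    (h₁₂ : Comm r₁ r₂) (h₁₃ : Comm r₁ r₃) (h₂₃ : Comm r₂ r₃) :
    gOp (gam E) r₁ (diag r₂ r₃) = gOp (gam E) r₁ r₃ ≫ gOp (gam E) r₁ r₂ := by
  apply hE.gOp_gam_eq h₁ (h₂.diag h₃ h₂₃) (h₁₂.diag_right h₁₃)
  rw [hE.gOp_diag_right h₁ h₁₃ h₂₃, Category.assoc, reassoc_of% hE.gOp_comp_gam h₁ h₃ h₁₃,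
    hE.gOp_comp_gam h₁ h₂ h₁₂]

end IsHopfCopairing

namespace HopfDatum

variable [IsIso (HopfObj.antipode (X := H))] {E : 𝟙_ S ⟶ H ⊗ H} {lam : H ⟶ 𝟙_ S}
  {g gi : 𝟙_ S ⟶ H} (hD : HopfDatum H E lam g gi)
  {A B C D : S} {a : H ⊗ A ⟶ A} {b : H ⊗ B ⟶ B} {c : H ⊗ C ⟶ C} {d : H ⊗ D ⟶ D}
include hD

/-- The digits are the degrees of `A`, `B`, `C`, `D`. Here $\gamma$ acts through the diagonal action
on $A\otimes B$, and splits. -/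
lemma pentagon_0010 (ha : IsAct a) (hb : IsAct b) (hd : IsAct d) :
    (α_ A B (C ⊗ D)).inv ≫ gOp (gam E) (fuse (diag (fuse a B) (lact A b)) (C ⊗ D))
      (lact (A ⊗ B) (lact C d)) ≫ (α_ (A ⊗ B) C D).inv =
    A ◁ (gOp (gam E) (fuse b (C ⊗ D)) (lact B (lact C d)) ≫ (α_ B C D).inv) ≫
      (gOp (gam E) (fuse a ((B ⊗ C) ⊗ D)) (lact A (lact (B ⊗ C) d)) ≫ (α_ A (B ⊗ C) D).inv) ≫
        (α_ A B C).inv ▷ D := by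
  rw [fuse_diag, fuse_fuse_tensor, fuse_lact, diag_conjAct, lact_tensor, gOp_conjAct, lact_tensor,
    lact_conjAct, fuse_whiskerLeftIso a (α_ B C D), gOp_conjAct,
    hD.gOp_gam_diag_left (ha.fuse _) ((hb.fuse _).lact A) (((hd.lact C).lact B).lact A)
      (comm_fuse_lact _ _) (comm_fuse_lact _ _) ((comm_fuse_lact _ _).lact A), gOp_lact]
  simp

lemma pentagon_0100 (ha : IsAct a) (hc : IsAct c) (hd : IsAct d) :
    gOp (gam E) (fuse a (B ⊗ (C ⊗ D))) (lact A (lact B (diag (fuse c D) (lact C d)))) ≫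
      (α_ A B (C ⊗ D)).inv ≫ (α_ (A ⊗ B) C D).inv =
    A ◁ (α_ B C D).inv ≫
      (gOp (gam E) (fuse a ((B ⊗ C) ⊗ D)) (lact A (lact (B ⊗ C) d)) ≫ (α_ A (B ⊗ C) D).inv) ≫
      (gOp (gam E) (fuse a (B ⊗ C)) (lact A (lact B c)) ≫ (α_ A B C).inv) ▷ D := by
  rw [lact_diag, lact_diag, hD.gOp_gam_diag_right (ha.fuse _) (((hc.fuse D).lact B).lact A)
      (((hd.lact C).lact B).lact A) (comm_fuse_lact _ _) (comm_fuse_lact _ _)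
      (((comm_fuse_lact _ _).lact B).lact A), lact_tensor,
    lact_conjAct, fuse_whiskerLeftIso a (α_ B C D), gOp_conjAct, comp_whiskerRight,
    gOp_whiskerRight, fuse_fuse_tensor, fuse_lact, fuse_lact, lact_conjAct,
    fuse_whiskerLeftIso a (α_ B C D), gOp_conjAct, gOp_conjAct]
  simp

lemma pentagon_0011 (ha : IsAct a) (hb : IsAct b) :
    (α_ A B (H ⊗ (C ⊗ D))).inv ≫ tOp (diag (fuse a B) (lact A b)) (C ⊗ D) ≫
      H ◁ (α_ (A ⊗ B) C D).inv =
    A ◁ (tOp b (C ⊗ D) ≫ H ◁ (α_ B C D).inv) ≫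
      (tOp a ((B ⊗ C) ⊗ D) ≫ H ◁ (α_ A (B ⊗ C) D).inv) ≫ H ◁ (α_ A B C).inv ▷ D := by
  rw [tOp_diag ha hb, whiskerLeft_comp]
  simp [tOp_nat_assoc]
  monoidal

/-- `dOp_uOp` with both `uOp` and the action of `E` inverted. -/
lemma pentagon_0101 (ha : IsAct a) (hc : IsAct c) :
    (tOp a (B ⊗ (C ⊗ D)) ≫ H ◁ (α_ A B (C ⊗ D)).inv) ≫
      dOp (del E g) (lact (A ⊗ B) (fuse c D)) ≫ H ◁ (α_ (A ⊗ B) C D).inv =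
    A ◁ (dOp (del E g) (lact B (fuse c D)) ≫ H ◁ (α_ B C D).inv) ≫
      (tOp a ((B ⊗ C) ⊗ D) ≫ H ◁ (α_ A (B ⊗ C) D).inv) ≫
        H ◁ (gOp (gam E) (fuse a (B ⊗ C)) (lact A (lact B c)) ≫ (α_ A B C).inv) ▷ D := by
  have hs := (hc.fuse D).lact B
  have h : tOp a (B ⊗ (C ⊗ D)) ≫ dOp (del E g) (lact A (lact B (fuse c D))) =
      A ◁ dOp (del E g) (lact B (fuse c D)) ≫ tOp a (B ⊗ (C ⊗ D)) ≫
        H ◁ gOp (gam E) (fuse a (B ⊗ (C ⊗ D))) (lact A (lact B (fuse c D))) := by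
    have h1 := hD.dOp_uOp ha hs
    have h2 := congrArg (fun f => H ◁ f) (hD.gOp_comp_gam (ha.fuse _) (hs.lact A) (comm_fuse_lact a (lact B (fuse c D))))
    simp only [whiskerLeft_comp, Category.assoc] at h2
    have h3 : dOp (del E g) (lact A (lact B (fuse c D))) = uOp a (B ⊗ (C ⊗ D)) ≫
        A ◁ dOp (del E g) (lact B (fuse c D)) ≫ tOp a (B ⊗ (C ⊗ D)) ≫
          H ◁ gOp (gam E) (fuse a (B ⊗ (C ⊗ D))) (lact A (lact B (fuse c D))) := by
      rw [← reassoc_of% h1, reassoc_of% uOp_tOp ha, h2, whiskerLeft_id, Category.comp_id]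
    rw [h3, reassoc_of% tOp_uOp ha]
  rw [lact_tensor, dOp_conjAct, comp_whiskerRight, gOp_whiskerRight, fuse_fuse_tensor, fuse_lact,
    fuse_lact, lact_conjAct, fuse_whiskerLeftIso a (α_ B C D), gOp_conjAct, gOp_conjAct]
  have h4 := reassoc_of% h
  simp [tOp_nat_assoc, h4]

/-- Coassociativity, in the form `uOp_vOp`, conjugated by the inverse of `uOp`. -/
lemma pentagon_0110 (ha : IsAct a) :
    (tOp a (B ⊗ (C ⊗ D)) ≫ H ◁ (α_ A B (C ⊗ D)).inv) ≫ vOp (lact (A ⊗ B) (lact C d)) ≫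
      H ◁ (α_ (A ⊗ B) C D).inv ≫ (α_ H ((A ⊗ B) ⊗ C) D).inv =
    A ◁ (vOp (lact B (lact C d)) ≫ H ◁ (α_ B C D).inv ≫ (α_ H (B ⊗ C) D).inv) ≫
      (α_ A (H ⊗ (B ⊗ C)) D).inv ≫ (tOp a (B ⊗ C) ≫ H ◁ (α_ A B C).inv) ▷ D := by
  have h : tOp a (B ⊗ (C ⊗ D)) ≫ vOp (lact A (lact B (lact C d))) =
      A ◁ vOp (lact B (lact C d)) ≫ tOp a (B ⊗ (C ⊗ D)) := by
    have h1 := uOp_vOp a (lact B (lact C d))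
    have h2 := tOp_uOp ha (B ⊗ (C ⊗ D))
    have h3 := uOp_tOp ha (B ⊗ (C ⊗ D))
    rw [← Category.comp_id (vOp _), ← h3, ← reassoc_of% h1, reassoc_of% h2]
  have h4 := reassoc_of% h
  rw [lact_tensor, vOp_conjAct, comp_whiskerRight, tOp_whiskerRight]
  simp [tOp_nat_assoc, h4]
  monoidal

/-- The coproduct of the second leg of $\delta$, through `dOp_diag`. -/
lemma pentagon_1001 :
    (dOp (del E g) (lact A (fuse b (C ⊗ D))) ≫ H ◁ (α_ A B (C ⊗ D)).inv) ≫
      dOp (del E g) (lact (A ⊗ B) (fuse c D)) ≫ H ◁ (α_ (A ⊗ B) C D).inv =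
    H ◁ A ◁ (α_ B C D).inv ≫
      (dOp (del E g) (lact A (fuse (diag (fuse b C) (lact B c)) D)) ≫
        H ◁ (α_ A (B ⊗ C) D).inv) ≫ H ◁ (α_ A B C).inv ▷ D := by
  rw [fuse_diag, fuse_fuse_tensor, fuse_lact, diag_conjAct, lact_conjAct, dOp_conjAct, lact_tensor,
    dOp_conjAct, lact_diag, hD.dOp_diag ((comm_fuse_lact _ _).lact A)]
  simp
  monoidal

lemma pentagon_1010 (hb : IsAct b) (hd : IsAct d) :
    (dOp (del E g) (lact A (fuse b (C ⊗ D))) ≫ H ◁ (α_ A B (C ⊗ D)).inv) ≫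
      vOp (lact (A ⊗ B) (lact C d)) ≫ H ◁ (α_ (A ⊗ B) C D).inv ≫ (α_ H ((A ⊗ B) ⊗ C) D).inv =
    H ◁ A ◁ (gOp (gam E) (fuse b (C ⊗ D)) (lact B (lact C d)) ≫ (α_ B C D).inv) ≫
      (vOp (lact A (lact (B ⊗ C) d)) ≫ H ◁ (α_ A (B ⊗ C) D).inv ≫
        (α_ H (A ⊗ (B ⊗ C)) D).inv) ≫
      (dOp (del E g) (lact A (fuse b C)) ≫ H ◁ (α_ A B C).inv) ▷ D := by
  have h := hD.dOp_vOp ((hb.fuse (C ⊗ D)).lact A) (((hd.lact C).lact B).lact A)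
    ((comm_fuse_lact _ _).lact A)
  have h4 := reassoc_of% h
  rw [lact_tensor, vOp_conjAct, comp_whiskerRight, dOp_whiskerRight, fuse_lact, fuse_fuse_tensor,
    lact_conjAct, dOp_conjAct, dOp_conjAct, lact_tensor, lact_conjAct, vOp_conjAct]
  simp [h4, gOp_lact]
  monoidal

lemma pentagon_1100 :
    (vOp (lact A (lact B (diag (fuse c D) (lact C d)))) ≫ H ◁ (α_ A B (C ⊗ D)).inv ≫
      (α_ H (A ⊗ B) (C ⊗ D)).inv) ≫ (α_ (H ⊗ (A ⊗ B)) C D).inv =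
    H ◁ A ◁ (α_ B C D).inv ≫ (vOp (lact A (lact (B ⊗ C) d)) ≫ H ◁ (α_ A (B ⊗ C) D).inv ≫
        (α_ H (A ⊗ (B ⊗ C)) D).inv) ≫
      (vOp (lact A (lact B c)) ≫ H ◁ (α_ A B C).inv ≫ (α_ H (A ⊗ B) C).inv) ▷ D := by
  rw [lact_diag, lact_diag, vOp_diag, comp_whiskerRight, vOp_whiskerRight, fuse_lact, fuse_lact,
    lact_conjAct, vOp_conjAct, vOp_conjAct, lact_tensor, lact_conjAct, vOp_conjAct]
  simp
  monoidal

/-- Equivalent to the right cointegral property, through `vOp_fourier_gOp` and the invertibility of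
the action of `E`. -/
lemma pentagon_1110 (hd : IsAct d) :
    (bri H A (B ⊗ (C ⊗ D)) ≫ fourier E lam ▷ (A ⊗ (B ⊗ (C ⊗ D))) ≫
        H ◁ (α_ A B (C ⊗ D)).inv ≫ (α_ H (A ⊗ B) (C ⊗ D)).inv) ≫
      gOp (gam E) (fuse (fuse MonObj.mul (A ⊗ B)) (C ⊗ D)) (lact (H ⊗ (A ⊗ B)) (lact C d)) ≫
        (α_ (H ⊗ (A ⊗ B)) C D).inv =
    A ◁ (vOp (lact B (lact C d)) ≫ H ◁ (α_ B C D).inv ≫ (α_ H (B ⊗ C) D).inv) ≫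
      (α_ A (H ⊗ (B ⊗ C)) D).inv ≫
      (bri H A (B ⊗ C) ≫ fourier E lam ▷ (A ⊗ (B ⊗ C)) ≫ H ◁ (α_ A B C).inv ≫
        (α_ H (A ⊗ B) C).inv) ▷ D := by
  have hs := (hd.lact C).lact B
  have h1 := hD.vOp_fourier_gOp (hs.lact A)
  have h2 := hD.gOp_comp_gam (isAct_reg (A ⊗ (B ⊗ (C ⊗ D)))) ((hs.lact A).lact H)
    (comm_fuse_lact _ _)
  have h3 : fourier E lam ▷ (A ⊗ (B ⊗ (C ⊗ D))) ≫
      gOp (gam E) (𝕞 (A ⊗ (B ⊗ (C ⊗ D)))) (lact H (lact A (lact B (lact C d)))) =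
      vOp (lact A (lact B (lact C d))) ≫ fourier E lam ▷ (A ⊗ (B ⊗ (C ⊗ D))) := by
    rw [← reassoc_of% h1, h2, Category.comp_id]
  have h4 : bri H A (B ⊗ (C ⊗ D)) ≫ vOp (lact A (lact B (lact C d))) =
      A ◁ vOp (lact B (lact C d)) ≫ bri H A (B ⊗ (C ⊗ D)) := by
    rw [← cancel_epi (br H A (B ⊗ (C ⊗ D))), br_bri_assoc, ← reassoc_of% vOp_lact]
    simp
  rw [fuse_fuse_tensor, fuse_whiskerLeftIso _ (α_ A B (C ⊗ D)), lact_tensor, lact_tensor,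
    lact_conjAct, gOp_conjAct, gOp_conjAct, comp_whiskerRight, bri_whiskerRight]
  simp only [Category.assoc, whiskerLeft_comp, comp_whiskerRight, Iso.inv_hom_id_assoc,
    whiskerLeftIso_hom, whiskerLeftIso_inv, whiskerLeft_inv_hom_assoc]
  have h5 := bri_nat H A (α_ B C D).inv
  rw [reassoc_of% h3, reassoc_of% h4, reassoc_of% h5]
  monoidal

/-- Rests on $S\circ F=F'$, through `dOp_fourier_vOp`. -/
lemma pentagon_1101 (hc : IsAct c) :
    (bri H A (B ⊗ (C ⊗ D)) ≫ fourier E lam ▷ (A ⊗ (B ⊗ (C ⊗ D))) ≫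
        H ◁ (α_ A B (C ⊗ D)).inv ≫ (α_ H (A ⊗ B) (C ⊗ D)).inv) ≫ (α_ (H ⊗ (A ⊗ B)) C D).inv =
    A ◁ (dOp (del E g) (lact B (fuse c D)) ≫ H ◁ (α_ B C D).inv) ≫
      (bri H A ((B ⊗ C) ⊗ D) ≫ fourier E lam ▷ (A ⊗ ((B ⊗ C) ⊗ D)) ≫
        H ◁ (α_ A (B ⊗ C) D).inv ≫ (α_ H (A ⊗ (B ⊗ C)) D).inv) ≫
      (vOp (lact A (lact B c)) ≫ H ◁ (α_ A B C).inv ≫ (α_ H (A ⊗ B) C).inv) ▷ D := by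
  have hs := ((hc.fuse D).lact B).lact A
  have h1 := hD.dOp_fourier_vOp hs
  have h2 : A ◁ dOp (del E g) (lact B (fuse c D)) ≫ bri H A (B ⊗ (C ⊗ D)) =
      bri H A (B ⊗ (C ⊗ D)) ≫ dOp (del E g) (lact A (lact B (fuse c D))) := by
    rw [← cancel_epi (br H A (B ⊗ (C ⊗ D))), br_bri_assoc, ← reassoc_of% dOp_lact]
    simp
  have h3 := bri_nat H A (α_ B C D).inv
  have h4 := whisker_exchange (fourier E lam) (A ◁ (α_ B C D).inv)
  rw [comp_whiskerRight, vOp_whiskerRight, fuse_lact, fuse_lact, lact_conjAct, vOp_conjAct,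
    vOp_conjAct]
  simp only [Category.assoc, whiskerLeft_comp, comp_whiskerRight, Iso.inv_hom_id_assoc,
    whiskerLeftIso_hom, whiskerLeftIso_inv, whiskerLeft_inv_hom_assoc]
  rw [reassoc_of% h3, reassoc_of% h4, reassoc_of% h2, whiskerLeft₂_inv_hom_assoc, reassoc_of% h1]
  monoidal

/-- Rests on the distinguished property, through `uOp_bri_fourier`. -/
lemma pentagon_1011 (hb : IsAct b) :
    (α_ A B (H ⊗ (C ⊗ D))).inv ≫ bri H (A ⊗ B) (C ⊗ D) ≫ fourier E lam ▷ ((A ⊗ B) ⊗ (C ⊗ D)) ≫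
      H ◁ (α_ (A ⊗ B) C D).inv ≫ (α_ H ((A ⊗ B) ⊗ C) D).inv =
    A ◁ (tOp b (C ⊗ D) ≫ H ◁ (α_ B C D).inv) ≫
      (bri H A ((B ⊗ C) ⊗ D) ≫ fourier E lam ▷ (A ⊗ ((B ⊗ C) ⊗ D)) ≫
        H ◁ (α_ A (B ⊗ C) D).inv ≫ (α_ H (A ⊗ (B ⊗ C)) D).inv) ≫
      (dOp (del E g) (lact A (fuse b C)) ≫ H ◁ (α_ A B C).inv) ▷ D := by
  have h1 := hD.uOp_bri_fourier b (C ⊗ D)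
  have h2 : A ◁ dOp (del E g) (fuse b (C ⊗ D)) ≫ bri H A (B ⊗ (C ⊗ D)) =
      bri H A (B ⊗ (C ⊗ D)) ≫ dOp (del E g) (lact A (fuse b (C ⊗ D))) := by
    rw [← cancel_epi (br H A (B ⊗ (C ⊗ D))), br_bri_assoc, ← reassoc_of% dOp_lact]
    simp
  have h3 := bri_nat H A (α_ B C D).inv
  have h4 := whisker_exchange (fourier E lam) (A ◁ (α_ B C D).inv)
  have h5 := bri_whisker (fourier E lam) A (B ⊗ (C ⊗ D))
  have h5' := whisker_bri (fourier E lam) A (B ⊗ (C ⊗ D))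
  have h6 : bri H B (C ⊗ D) ≫ fourier E lam ▷ (B ⊗ (C ⊗ D)) =
      tOp b (C ⊗ D) ≫ fourier E lam ▷ (B ⊗ (C ⊗ D)) ≫ dOp (del E g) (fuse b (C ⊗ D)) := by
    rw [← h1, reassoc_of% tOp_uOp hb]
  have h7 := congrArg (fun f => A ◁ f) h6
  simp only [whiskerLeft_comp] at h7
  have h8 := whisker_exchange (fourier E lam) ((α_ A B (C ⊗ D)).inv)
  rw [comp_whiskerRight, dOp_whiskerRight, fuse_lact, fuse_fuse_tensor, lact_conjAct, dOp_conjAct,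
    dOp_conjAct, bri_tensor]
  simp only [Category.assoc, whiskerLeft_comp, comp_whiskerRight, Iso.inv_hom_id_assoc,
    whiskerLeftIso_hom, whiskerLeftIso_inv, whiskerLeft_inv_hom_assoc]
  rw [reassoc_of% h3, reassoc_of% h4, reassoc_of% h8, ← reassoc_of% h5', reassoc_of% h7,
    reassoc_of% h2, reassoc_of% h5']
  monoidal

/-- Rests on $\Delta F(h)=e_1\otimes F(e_2h)$, through `fourier_uOp`. -/
lemma pentagon_0111 (ha : IsAct a) :
    gOp (gam E) (fuse a (B ⊗ (H ⊗ (C ⊗ D)))) (lact A (lact B (𝕞 (C ⊗ D)))) ≫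
      (α_ A B (H ⊗ (C ⊗ D))).inv ≫ bri H (A ⊗ B) (C ⊗ D) ≫
        fourier E lam ▷ ((A ⊗ B) ⊗ (C ⊗ D)) ≫ H ◁ (α_ (A ⊗ B) C D).inv ≫
          (α_ H ((A ⊗ B) ⊗ C) D).inv =
    A ◁ (bri H B (C ⊗ D) ≫ fourier E lam ▷ (B ⊗ (C ⊗ D)) ≫ H ◁ (α_ B C D).inv ≫
        (α_ H (B ⊗ C) D).inv) ≫ (α_ A (H ⊗ (B ⊗ C)) D).inv ≫
      (tOp a (B ⊗ C) ≫ H ◁ (α_ A B C).inv) ▷ D := by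
  have h1 := hD.fourier_uOp a (B ⊗ (C ⊗ D))
  have h2 := hD.gOp_gam_comp (ha.fuse (H ⊗ (B ⊗ (C ⊗ D)))) ((isAct_reg (B ⊗ (C ⊗ D))).lact A)
    (comm_fuse_lact _ _)
  have h3 : gOp (gam E) (fuse a (H ⊗ (B ⊗ (C ⊗ D)))) (lact A (𝕞 (B ⊗ (C ⊗ D)))) ≫
      bri H A (B ⊗ (C ⊗ D)) ≫ fourier E lam ▷ (A ⊗ (B ⊗ (C ⊗ D))) =
      A ◁ fourier E lam ▷ (B ⊗ (C ⊗ D)) ≫ tOp a (B ⊗ (C ⊗ D)) := by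
    rw [← Category.comp_id (fourier E lam ▷ _), ← uOp_tOp ha, reassoc_of% h1, bri_br_assoc,
      reassoc_of% h2]
  have h4 : lact B (𝕞 (C ⊗ D)) ≫ bri H B (C ⊗ D) = H ◁ bri H B (C ⊗ D) ≫ 𝕞 (B ⊗ (C ⊗ D)) := by
    rw [lact, Category.assoc, fuse_bri, br_bri_assoc]
  have h5 := gOp_natural (gam E) (fuse_nat a (bri H B (C ⊗ D))).symm (lact_natural A h4)
  have h8 := whisker_exchange (fourier E lam) ((α_ A B (C ⊗ D)).inv)
  rw [comp_whiskerRight, tOp_whiskerRight, bri_tensor]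
  simp only [Category.assoc, whiskerLeft_comp, comp_whiskerRight, Iso.inv_hom_id_assoc,
    whiskerLeftIso_hom, whiskerLeftIso_inv, whiskerLeft_inv_hom_assoc]
  rw [reassoc_of% h8, ← reassoc_of% h5, reassoc_of% h3]
  simp [tOp_nat_assoc]
  monoidal

/-- `fourier_dOp_fourier_uOp` on the tail $A\otimes(B\otimes(C\otimes D))$, after every copy of `H`
has been braided to the front. -/
lemma pentagon_1111 :
    (vOp (lact A (lact B (𝕞 (C ⊗ D)))) ≫ H ◁ (α_ A B (H ⊗ (C ⊗ D))).inv ≫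
        (α_ H (A ⊗ B) (H ⊗ (C ⊗ D))).inv) ≫
      tOp (𝕞 (A ⊗ B)) (C ⊗ D) ≫ H ◁ (α_ (H ⊗ (A ⊗ B)) C D).inv =
    H ◁ A ◁ (bri H B (C ⊗ D) ≫ fourier E lam ▷ (B ⊗ (C ⊗ D)) ≫ H ◁ (α_ B C D).inv ≫
        (α_ H (B ⊗ C) D).inv) ≫
      (dOp (del E g) (lact A (fuse (𝕞 (B ⊗ C)) D)) ≫ H ◁ (α_ A (H ⊗ (B ⊗ C)) D).inv) ≫
        H ◁ (bri H A (B ⊗ C) ≫ fourier E lam ▷ (A ⊗ (B ⊗ C)) ≫ H ◁ (α_ A B C).inv ≫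
          (α_ H (A ⊗ B) C).inv) ▷ D := by
  have h1 := hD.fourier_dOp_fourier_uOp (A ⊗ (B ⊗ (C ⊗ D)))
  have h2 : H ◁ fourier E lam ▷ (A ⊗ (B ⊗ (C ⊗ D))) ≫ dOp (del E g) (𝕞 (A ⊗ (B ⊗ (C ⊗ D)))) ≫
      H ◁ fourier E lam ▷ (A ⊗ (B ⊗ (C ⊗ D))) =
      vOp (𝕞 (A ⊗ (B ⊗ (C ⊗ D)))) ≫ tOp MonObj.mul (A ⊗ (B ⊗ (C ⊗ D))) := by
    rw [← h1]
    simp only [Category.assoc]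
    rw [uOp_tOp isAct_mul, Category.comp_id]
  have h3 (X Y : S) : lact X (𝕞 Y) ≫ bri H X Y = H ◁ bri H X Y ≫ 𝕞 (X ⊗ Y) := by
    rw [lact, Category.assoc, fuse_bri, br_bri_assoc]
  have h4 := vOp_natural (lact_natural A (h3 B (C ⊗ D)))
  have h5 := vOp_natural (h3 A (B ⊗ (C ⊗ D)))
  have h6 := dOp_natural (del E g) (h3 A (B ⊗ (C ⊗ D)))
  have h7 := congrArg (fun f => H ◁ f) (whisker_bri (fourier E lam) A (B ⊗ (C ⊗ D)))
  simp only [whiskerLeft_comp] at h7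
  have h8 := congrArg (fun f => H ◁ f) (bri_nat H A (α_ B C D).inv)
  simp only [whiskerLeft_comp] at h8
  rw [tOp_fuse isAct_mul, bri_tensor, fuse_fuse_tensor,
    fuse_whiskerLeftIso _ (α_ B C D), lact_conjAct, lact_conjAct, dOp_conjAct, dOp_conjAct,
    comp_whiskerRight, bri_whiskerRight]
  simp only [Category.assoc, whiskerLeft_comp, comp_whiskerRight, Iso.inv_hom_id_assoc,
    whiskerLeftIso_hom, whiskerLeftIso_inv, whiskerLeft_inv_hom_assoc]
  rw [tOp_nat_assoc, ← reassoc_of% h4, ← reassoc_of% h5, ← reassoc_of% h2]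
  simp only [whiskerLeft₂_inv_hom_assoc, whiskerLeft₃_inv_hom_assoc]
  rw [reassoc_of% h8, ← reassoc_of% h6, reassoc_of% h7]
  monoidal

end HopfDatum

end

/-! ### The prescribed associators as operators -/

section

variable {S : Type u} [Category.{v} S] [MonoidalCategory S] [BraidedCategory S]
variable {H : S} [HopfObj H]

local notation "𝕞" => fuse (MonObj.mul (X := H))
local notation "𝕕" => fork (ComonObj.comul (X := H))
local notation "𝕦" => ins (MonObj.one (X := H))
local notation "𝕖" => cap (ComonObj.counit (X := H))
local notation "𝕤" => HopfObj.antipode (X := H)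

section NestedForms

lemma braid_fuse_lact (B : S) {C : S} (c : H ⊗ C ⟶ C) :
    fuse c B ≫ (β_ C B).hom = H ◁ (β_ C B).hom ≫ lact B c := by
  simp only [fuse, lact, br, Category.assoc, BraidedCategory.braiding_naturality_left,
    BraidedCategory.braiding_tensor_left_hom, Iso.inv_hom_id_assoc]

lemma actBy_eq (x : 𝟙_ S ⟶ H ⊗ H) (A C : Mod S H) : actBy x A C = gOp x (fuse (act A) C.X) (lact A.X (act C)) := by
  simp only [actBy, act₂, gOp, fuse, lact, br, ins₂, tensorμ, MonoidalCategory.tensorHom_def']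
  monoidal

lemma tensorMod_act (A C : Mod S H) :
    act (tensorMod A C) = diag (fuse (act A) C.X) (lact A.X (act C)) := by
  change ComonObj.comul ▷ (A.X ⊗ C.X) ≫ act₂ A C = _
  simp only [act₂, diag, fork, fuse, lact, br, tensorμ, MonoidalCategory.tensorHom_def']
  monoidal

variable [IsIso (HopfObj.antipode (X := H))] (x y : 𝟙_ S ⟶ H ⊗ H) (p : H ⟶ H)

/-- Conjugation by $c_{C,B}$ puts `C` next to `A`; by naturality this amounts to moving the second
leg of `x` across `B`. -/
lemma assocM_010 (A C : Mod S H) (B : S) :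
    assocM x y p (.inl A) (.inr B) (.inl C) =
      gOp x (fuse (act A) (B ⊗ C.X)) (lact A.X (lact B (act C))) ≫ (α_ A.X B C.X).inv := by
  have h := gOp_natural x (fuse_nat (act A) (β_ C.X B).hom).symm
    (lact_natural A.X (braid_fuse_lact B (act C)))
  change A.X ◁ (β_ C.X B).inv ≫ (α_ A.X C.X B).inv ≫ actBy x A C ▷ B ≫ (α_ A.X C.X B).hom ≫
        A.X ◁ (β_ C.X B).hom ≫ (α_ A.X B C.X).inv = _
  rw [actBy_eq, gOp_whiskerRight, fuse_fuse_tensor, fuse_lact, gOp_conjAct]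
  simp only [Category.assoc, Iso.inv_hom_id_assoc]
  rw [← reassoc_of% h, whiskerLeft_inv_hom_assoc]

lemma assocM_011 (A : Mod S H) (B C : S) :
    assocM x y p (.inl A) (.inr B) (.inr C) = tOp (act A) (B ⊗ C) ≫ H ◁ (α_ A.X B C).inv := by
  change (α_ A.X H (B ⊗ C)).inv ≫ twistedFlip A ▷ (B ⊗ C) ≫ (α_ H A.X (B ⊗ C)).hom ≫
        H ◁ (α_ A.X B C).inv = _
  simp only [twistedFlip, tOp, bri, fork, fuse]
  monoidal

lemma assocM_101 (A C : S) (B : Mod S H) :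
    assocM x y p (.inr A) (.inl B) (.inr C) =
      dOp y (lact A (fuse (act B) C)) ≫ H ◁ (α_ A B.X C).inv := by
  change H ◁ (α_ A B.X C).inv ≫ H ◁ insertAct y A B ▷ C ≫ H ◁ (α_ H (A ⊗ B.X) C).hom ≫
        (α_ H H ((A ⊗ B.X) ⊗ C)).inv ≫ MonObj.mul ▷ ((A ⊗ B.X) ⊗ C) = _
  rw [dOp, Category.assoc, Category.assoc, ← whiskerLeft_comp, ← fuse_nat]
  simp only [insertAct, tensorμ, lact, fuse, ins₂, br]
  monoidal

lemma assocM_110 (A B : S) (C : Mod S H) :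
    assocM x y p (.inr A) (.inr B) (.inl C) = vOp (lact A (lact B (act C))) ≫
      H ◁ (α_ A B C.X).inv ≫ (α_ H (A ⊗ B) C.X).inv := by
  have h : vOp (lact A (lact B (act C))) ≫ H ◁ (α_ A B C.X).inv =
      H ◁ (α_ A B C.X).inv ≫ vOp (lact (A ⊗ B) (act C)) := by
    rw [lact_tensor, vOp_conjAct, whiskerLeft_inv_hom_assoc]
  rw [reassoc_of% h]
  change H ◁ (α_ A B C.X).inv ≫ ComonObj.comul ▷ ((A ⊗ B) ⊗ C.X) ≫ tensorμ H H (A ⊗ B) C.X ≫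
        (H ⊗ (A ⊗ B)) ◁ act C = _
  simp only [vOp, lact, br, fork, tensorμ]
  monoidal

lemma assocM_111 (A B C : S) :
    assocM x y p (.inr A) (.inr B) (.inr C) = bri H A (B ⊗ C) ≫ p ▷ (A ⊗ (B ⊗ C)) ≫
      H ◁ (α_ A B C).inv ≫ (α_ H (A ⊗ B) C).inv := by
  change (α_ A H (B ⊗ C)).inv ≫ ((β_ H A).inv ≫ p ▷ A) ▷ (B ⊗ C) ≫ (α_ (H ⊗ A) B C).inv ≫
        (α_ H A B).hom ▷ C = _
  simp only [bri]
  monoidal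

end NestedForms

section TensorHom

variable {A A' M M' : S} {a : H ⊗ A ⟶ A} {a' : H ⊗ A' ⟶ A'} {s : H ⊗ M ⟶ M} {s' : H ⊗ M' ⟶ M'}
  {f : A ⟶ A'} {k : M ⟶ M'}

lemma fuse_tensorHom (h : a ≫ f = H ◁ f ≫ a') (k : M ⟶ M') :
    fuse a M ≫ (f ⊗ₘ k) = H ◁ (f ⊗ₘ k) ≫ fuse a' M' := by
  simp only [MonoidalCategory.tensorHom_def, fuse, Category.assoc, ← comp_whiskerRight_assoc, h,
    whiskerLeft_comp]
  simp only [comp_whiskerRight, Category.assoc, whisker_exchange,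
    associator_inv_naturality_right_assoc]
  simp

lemma lact_tensorHom (f : A ⟶ A') (h : s ≫ k = H ◁ k ≫ s') :
    lact A s ≫ (f ⊗ₘ k) = H ◁ (f ⊗ₘ k) ≫ lact A' s' := by
  simp only [MonoidalCategory.tensorHom_def, whiskerLeft_comp, Category.assoc]
  rw [reassoc_of% lact_whiskerRight f s, ← lact_natural A' h]

lemma bri_tensorHom (f : A ⟶ A') (k : M ⟶ M') :
    (f ⊗ₘ H ◁ k) ≫ bri H A' M' = bri H A M ≫ H ◁ (f ⊗ₘ k) := by
  simp only [MonoidalCategory.tensorHom_def, whiskerLeft_comp, Category.assoc]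
  rw [bri_nat, bri_whisker_assoc]

lemma tOp_tensorHom [IsIso (HopfObj.antipode (X := H))] (h : a ≫ f = H ◁ f ≫ a') (k : M ⟶ M') :
    (f ⊗ₘ H ◁ k) ≫ tOp a' M' = tOp a M ≫ H ◁ (f ⊗ₘ k) := by
  have h1 := fuse_tensorHom h k
  rw [tOp, reassoc_of% bri_tensorHom, fork_nat_assoc, bri_nat_assoc, ← whiskerLeft_comp_assoc,
    whisker_exchange, whiskerLeft_comp_assoc, ← whiskerLeft_comp, ← h1, tOp]
  simp only [whiskerLeft_comp, Category.assoc]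

end TensorHom

end

/-! ### Naturality and linearity of the associators -/

section

variable {S : Type u} [Category.{v} S] [MonoidalCategory S] [BraidedCategory S]
variable {H : S} [HopfObj H]

local notation "𝕞" => fuse (MonObj.mul (X := H))
local notation "𝕕" => fork (ComonObj.comul (X := H))
local notation "𝕦" => ins (MonObj.one (X := H))
local notation "𝕖" => cap (ComonObj.counit (X := H))
local notation "𝕤" => HopfObj.antipode (X := H)

section Total

lemma total_map_injective {X Y : Ext H} {f f' : X ⟶ Y} (h : (total H).map f = (total H).map f') :
    f = f' := by
  match X, Y, f, f', h with
  | .inl X, .inl Y, f, f', h => exact ULift.ext _ _ (Mod.hom_ext _ _ h)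
  | .inr X, .inr Y, f, f', h => exact ULift.ext _ _ h

/-- The inverse of a linear isomorphism is linear. -/
lemma isIso_of_total {X Y : Ext H} (f : X ⟶ Y) (hf : IsIso ((total H).map f)) : IsIso f := by
  match X, Y, f, hf with
  | .inl X, .inl Y, f, hf =>
    have h : IsIso f.down.hom := hf
    have h' : act Y ≫ inv f.down.hom = H ◁ inv f.down.hom ≫ act X := by
      rw [← cancel_epi (H ◁ f.down.hom), ← reassoc_of% act_hom f.down, IsIso.hom_inv_id,
        Category.comp_id, ← whiskerLeft_comp_assoc, IsIso.hom_inv_id, whiskerLeft_id,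
        Category.id_comp]
    exact ⟨(ULift.up (mkHom (inv f.down.hom) h') : (.inl Y : Ext H) ⟶ .inl X),
      total_map_injective (IsIso.hom_inv_id f.down.hom),
      total_map_injective (IsIso.inv_hom_id f.down.hom)⟩
  | .inr X, .inr Y, f, hf =>
    have h : IsIso f.down := hf
    exact ⟨(ULift.up (inv f.down) : (.inr Y : Ext H) ⟶ .inr X),
      total_map_injective (IsIso.hom_inv_id f.down),
      total_map_injective (IsIso.inv_hom_id f.down)⟩

lemma exists_map_inl {M N : Mod S H} (f : M.X ⟶ N.X) (h : act M ≫ f = H ◁ f ≫ act N) :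
    ∃ f' : (.inl M : Ext H) ⟶ .inl N, (total H).map f' = f :=
  ⟨ULift.up (mkHom f h), rfl⟩

lemma exists_map_inr {M N : S} (f : M ⟶ N) :
    ∃ f' : (.inr M : Ext H) ⟶ .inr N, (total H).map f' = f :=
  ⟨ULift.up f, rfl⟩

end Total

section Associator

variable [IsIso (HopfObj.antipode (X := H))] (x y : 𝟙_ S ⟶ H ⊗ H) (p : H ⟶ H)

lemma square {W X Y Z : S} {f : W ⟶ X} {m m' : X ⟶ Z} {n n' : W ⟶ Y} {k : Y ⟶ Z} (hm : m = m')
    (hn : n = n') (h : f ≫ m' = n' ≫ k) : f ≫ m = n ≫ k := by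
  rw [hm, hn, h]

lemma assocM_natural {A A' B B' C C' : Ext H} (f : A ⟶ A') (k : B ⟶ B') (l : C ⟶ C') :
    (total H).map (tensorM f (tensorM k l)) ≫ assocM x y p A' B' C' =
      assocM x y p A B C ≫ (total H).map (tensorM (tensorM f k) l) := by
  match A, A', B, B', C, C', f, k, l with
  | .inl A, .inl A', .inl B, .inl B', .inl C, .inl C', f, k, l =>
    exact associator_inv_naturality f.down.hom k.down.hom l.down.hom
  | .inl A, .inl A', .inl B, .inl B', .inr C, .inr C', f, k, l =>
    exact associator_inv_naturality f.down.hom k.down.hom l.down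
  | .inr A, .inr A', .inl B, .inl B', .inl C, .inl C', f, k, l =>
    exact associator_inv_naturality f.down k.down.hom l.down.hom
  | .inl A, .inl A', .inr B, .inr B', .inl C, .inl C', ⟨f⟩, ⟨k⟩, ⟨l⟩ =>
    have h : (f.hom ⊗ₘ (k ⊗ₘ l.hom)) ≫ gOp x (fuse (act A') (B' ⊗ C'.X))
        (lact A'.X (lact B' (act C'))) ≫ (α_ A'.X B' C'.X).inv =
        (gOp x (fuse (act A) (B ⊗ C.X)) (lact A.X (lact B (act C))) ≫ (α_ A.X B C.X).inv) ≫
          ((f.hom ⊗ₘ k) ⊗ₘ l.hom) := by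
      rw [reassoc_of% gOp_natural x (fuse_tensorHom (act_hom f) _)
        (lact_tensorHom _ (lact_tensorHom _ (act_hom l))), Category.assoc,
          associator_inv_naturality]
    exact square (assocM_010 ..) (assocM_010 ..) h
  | .inl A, .inl A', .inr B, .inr B', .inr C, .inr C', ⟨f⟩, ⟨k⟩, ⟨l⟩ =>
    have h : (f.hom ⊗ₘ H ◁ (k ⊗ₘ l)) ≫ tOp (act A') (B' ⊗ C') ≫ H ◁ (α_ A'.X B' C').inv =
        (tOp (act A) (B ⊗ C) ≫ H ◁ (α_ A.X B C).inv) ≫ H ◁ ((f.hom ⊗ₘ k) ⊗ₘ l) := by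
      rw [reassoc_of% tOp_tensorHom (act_hom f), Category.assoc,
        ← whiskerLeft_comp, ← whiskerLeft_comp, associator_inv_naturality]
    exact square (assocM_011 ..) (assocM_011 ..) h
  | .inr A, .inr A', .inl B, .inl B', .inr C, .inr C', ⟨f⟩, ⟨k⟩, ⟨l⟩ =>
    have h : H ◁ (f ⊗ₘ (k.hom ⊗ₘ l)) ≫ dOp y (lact A' (fuse (act B') C')) ≫
        H ◁ (α_ A' B'.X C').inv = (dOp y (lact A (fuse (act B) C)) ≫ H ◁ (α_ A B.X C).inv) ≫
          H ◁ ((f ⊗ₘ k.hom) ⊗ₘ l) := by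
      rw [reassoc_of% dOp_natural y (lact_tensorHom f (fuse_tensorHom (act_hom k) l)),
        Category.assoc, ← whiskerLeft_comp, ← whiskerLeft_comp, associator_inv_naturality]
    exact square (assocM_101 ..) (assocM_101 ..) h
  | .inr A, .inr A', .inr B, .inr B', .inl C, .inl C', ⟨f⟩, ⟨k⟩, ⟨l⟩ =>
    have h : H ◁ (f ⊗ₘ (k ⊗ₘ l.hom)) ≫ vOp (lact A' (lact B' (act C'))) ≫
        H ◁ (α_ A' B' C'.X).inv ≫ (α_ H (A' ⊗ B') C'.X).inv =
        (vOp (lact A (lact B (act C))) ≫ H ◁ (α_ A B C.X).inv ≫ (α_ H (A ⊗ B) C.X).inv) ≫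
          (H ◁ (f ⊗ₘ k) ⊗ₘ l.hom) := by
      rw [reassoc_of% vOp_natural (lact_tensorHom f (lact_tensorHom k (act_hom l)))]
      simp only [Category.assoc]
      rw [← whiskerLeft_comp_assoc, associator_inv_naturality, whiskerLeft_comp_assoc,
        ← id_tensorHom H ((f ⊗ₘ k) ⊗ₘ l.hom), ← id_tensorHom H (f ⊗ₘ k),
        associator_inv_naturality]
    exact square (assocM_110 ..) (assocM_110 ..) h
  | .inr A, .inr A', .inr B, .inr B', .inr C, .inr C', ⟨f⟩, ⟨k⟩, ⟨l⟩ =>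
    have h : (f ⊗ₘ H ◁ (k ⊗ₘ l)) ≫ bri H A' (B' ⊗ C') ≫ p ▷ (A' ⊗ (B' ⊗ C')) ≫
        H ◁ (α_ A' B' C').inv ≫ (α_ H (A' ⊗ B') C').inv =
        (bri H A (B ⊗ C) ≫ p ▷ (A ⊗ (B ⊗ C)) ≫ H ◁ (α_ A B C).inv ≫ (α_ H (A ⊗ B) C).inv) ≫
          (H ◁ (f ⊗ₘ k) ⊗ₘ l) := by
      rw [reassoc_of% bri_tensorHom]
      simp only [Category.assoc]
      rw [whisker_exchange_assoc, ← whiskerLeft_comp_assoc, associator_inv_naturality,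
        whiskerLeft_comp_assoc, ← id_tensorHom H ((f ⊗ₘ k) ⊗ₘ l), ← id_tensorHom H (f ⊗ₘ k),
        associator_inv_naturality]
    exact square (assocM_111 ..) (assocM_111 ..) h

lemma linear_congr {M N : S} {a : H ⊗ M ⟶ M} {b : H ⊗ N ⟶ N}  {m m' : M ⟶ N} (hm : m = m')
    (h : a ≫ m' = H ◁ m' ≫ b) : a ≫ m = H ◁ m ≫ b := by
  rw [hm, h]

lemma exists_assocHom (A B C : Ext H) :
    ∃ f : tensorO A (tensorO B C) ⟶ tensorO (tensorO A B) C,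
      (total H).map f = assocM x y p A B C := by
  match A, B, C with
  -- In odd total degree source and target lie in `S`, and there is no linearity to check.
  | .inl A, .inl B, .inr C => exact exists_map_inr _
  | .inr A, .inl B, .inl C => exact exists_map_inr _
  | .inl A, .inr B, .inl C => exact exists_map_inr _
  | .inr A, .inr B, .inr C => exact exists_map_inr _
  | .inl A, .inl B, .inl C =>
    have h : act (tensorMod (tensorMod A B) C) =
        conjAct (α_ A.X B.X C.X) (act (tensorMod A (tensorMod B C))) := by
      have h : act (tensorMod (tensorMod A B) C) =
          diag (fuse (diag (fuse (act A) B.X) (lact A.X (act B))) C.X)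
            (lact (A.X ⊗ B.X) (act C)) := by
        rw [← tensorMod_act, tensorMod_act]; rfl
      have h' : act (tensorMod A (tensorMod B C)) =
          diag (fuse (act A) (B.X ⊗ C.X))
            (lact A.X (diag (fuse (act B) C.X) (lact B.X (act C)))) := by
        rw [← tensorMod_act, tensorMod_act]; rfl
      rw [h, fuse_diag, fuse_fuse_tensor, fuse_lact, lact_tensor, diag_conjAct, diag_conjAct,
        diag_diag, ← lact_diag]
      exact congrArg _ h'.symm
    refine exists_map_inl (M := tensorMod A (tensorMod B C)) (N := tensorMod (tensorMod A B) C)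
      (α_ A.X B.X C.X).inv ?_
    rw [h]
    exact (whiskerLeft_inv_hom_assoc ..).symm
  | .inl A, .inr B, .inr C =>
    have h : diag (fuse (act A) (H ⊗ (B ⊗ C))) (lact A.X (𝕞 (B ⊗ C))) ≫ tOp (act A) (B ⊗ C) ≫
        H ◁ (α_ A.X B C).inv = H ◁ (tOp (act A) (B ⊗ C) ≫ H ◁ (α_ A.X B C).inv) ≫
          𝕞 ((A.X ⊗ B) ⊗ C) := by
      have h1 := uOp_linear (isAct_act A) (B ⊗ C)
      have h2 := congrArg (fun f => H ◁ f) (tOp_uOp (isAct_act A) (B ⊗ C))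
      simp only [whiskerLeft_comp, Category.assoc] at h2
      -- Linearity of `uOp`, with its inverse composed on either side.
      have h3 := congrArg (fun f => H ◁ tOp (act A) (B ⊗ C) ≫ f ≫ tOp (act A) (B ⊗ C)) h1
      simp only [whiskerLeft_comp, Category.assoc] at h3
      rw [uOp_tOp (isAct_act A), reassoc_of% h2, whiskerLeft_id, Category.id_comp,
        Category.comp_id] at h3
      simp only [whiskerLeft_comp, Category.assoc]
      rw [fuse_nat, reassoc_of% h3]
    exact exists_map_inl (M := tensorMod A (freeMod (B ⊗ C))) (N := freeMod ((A.X ⊗ B) ⊗ C))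
      (assocM x y p (.inl A) (.inr B) (.inr C)) (((congrArg (· ≫ _) (tensorMod_act A _)).trans
        (linear_congr (assocM_011 ..) h)))
  | .inr A, .inl B, .inr C =>
    have h : 𝕞 (A ⊗ (B.X ⊗ C)) ≫ dOp y (lact A (fuse (act B) C)) ≫ H ◁ (α_ A B.X C).inv =
        H ◁ (dOp y (lact A (fuse (act B) C)) ≫ H ◁ (α_ A B.X C).inv) ≫ 𝕞 ((A ⊗ B.X) ⊗ C) := by
      rw [reassoc_of% dOp_linear, whiskerLeft_comp_assoc, fuse_nat]
    exact exists_map_inl (M := freeMod (A ⊗ (B.X ⊗ C))) (N := freeMod ((A ⊗ B.X) ⊗ C))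
      (assocM x y p (.inr A) (.inl B) (.inr C)) (linear_congr (assocM_101 ..) h)
  | .inr A, .inr B, .inl C =>
    have h : 𝕞 (A ⊗ (B ⊗ C.X)) ≫ vOp (lact A (lact B (act C))) ≫
        H ◁ (α_ A B C.X).inv ≫ (α_ H (A ⊗ B) C.X).inv =
        H ◁ (vOp (lact A (lact B (act C))) ≫ H ◁ (α_ A B C.X).inv ≫ (α_ H (A ⊗ B) C.X).inv) ≫
          diag (fuse (𝕞 (A ⊗ B)) C.X) (lact (H ⊗ (A ⊗ B)) (act C)) := by
      rw [reassoc_of% vOp_linear (((isAct_act C).lact B).lact A)]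
      have h1 : fuse (𝕞 (A ⊗ B)) C.X = conjAct (α_ H (A ⊗ B) C.X)
          (conjAct (whiskerLeftIso H (α_ A B C.X)) (𝕞 (A ⊗ (B ⊗ C.X)))) := by
        rw [fuse_fuse_tensor, ← fuse_whiskerLeftIso]
      rw [h1, lact_tensor, lact_tensor, lact_conjAct, diag_conjAct, diag_conjAct]
      simp [conjAct]
    exact exists_map_inl (M := freeMod (A ⊗ (B ⊗ C.X))) (N := tensorMod (freeMod (A ⊗ B)) C)
      (assocM x y p (.inr A) (.inr B) (.inl C)) ((linear_congr (assocM_110 ..) h).trans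
        (congrArg (_ ≫ ·) (tensorMod_act _ C)).symm)

end Associator

end

/-! ### Invertibility of the associators and the pentagon axiom -/

section

variable {S : Type u} [Category.{v} S] [MonoidalCategory S] [BraidedCategory S]
variable {H : S} [HopfObj H]

local notation "𝕞" => fuse (MonObj.mul (X := H))
local notation "𝕕" => fork (ComonObj.comul (X := H))
local notation "𝕦" => ins (MonObj.one (X := H))
local notation "𝕖" => cap (ComonObj.counit (X := H))
local notation "𝕤" => HopfObj.antipode (X := H)

section WhiskerTotal

lemma total_id_tensor_inl_inl {A M N : Mod S H} {f : (.inl M : Ext H) ⟶ .inl N} {u : M.X ⟶ N.X}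
    (h : (total H).map f = u) : (total H).map (tensorM (𝟙 (.inl A : Ext H)) f) = A.X ◁ u := by
  subst h
  exact id_tensorHom _ _

lemma total_id_tensor_inl_inr {A : Mod S H} {M N : S} {f : (.inr M : Ext H) ⟶ .inr N} {u : M ⟶ N}
    (h : (total H).map f = u) : (total H).map (tensorM (𝟙 (.inl A : Ext H)) f) = A.X ◁ u := by
  subst h
  exact id_tensorHom _ _

lemma total_id_tensor_inr_inl {A : S} {M N : Mod S H} {f : (.inl M : Ext H) ⟶ .inl N}
    {u : M.X ⟶ N.X} (h : (total H).map f = u) :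
    (total H).map (tensorM (𝟙 (.inr A : Ext H)) f) = A ◁ u := by
  subst h
  exact id_tensorHom _ _

lemma total_id_tensor_inr_inr {A M N : S} {f : (.inr M : Ext H) ⟶ .inr N} {u : M ⟶ N}
    (h : (total H).map f = u) : (total H).map (tensorM (𝟙 (.inr A : Ext H)) f) = H ◁ A ◁ u := by
  subst h
  exact congrArg (H ◁ ·) (id_tensorHom _ _)

lemma total_tensor_id_inl_inl {A M N : Mod S H} {f : (.inl M : Ext H) ⟶ .inl N} {u : M.X ⟶ N.X}
    (h : (total H).map f = u) : (total H).map (tensorM f (𝟙 (.inl A : Ext H))) = u ▷ A.X := by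
  subst h
  exact tensorHom_id _ _

lemma total_tensor_id_inr_inl {A : Mod S H} {M N : S} {f : (.inr M : Ext H) ⟶ .inr N} {u : M ⟶ N}
    (h : (total H).map f = u) : (total H).map (tensorM f (𝟙 (.inl A : Ext H))) = u ▷ A.X := by
  subst h
  exact tensorHom_id _ _

lemma total_tensor_id_inl_inr {A : S} {M N : Mod S H} {f : (.inl M : Ext H) ⟶ .inl N}
    {u : M.X ⟶ N.X} (h : (total H).map f = u) :
    (total H).map (tensorM f (𝟙 (.inr A : Ext H))) = u ▷ A := by
  subst h
  exact tensorHom_id _ _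

lemma total_tensor_id_inr_inr {A M N : S} {f : (.inr M : Ext H) ⟶ .inr N} {u : M ⟶ N}
    (h : (total H).map f = u) : (total H).map (tensorM f (𝟙 (.inr A : Ext H))) = H ◁ u ▷ A := by
  subst h
  exact congrArg (H ◁ ·) (tensorHom_id _ _)

lemma pentagon_congr {X₁ X₂ X₃ X₄ X₅ : S} {a a' : X₁ ⟶ X₂} {b b' : X₂ ⟶ X₃} {c c' : X₁ ⟶ X₄}
    {d d' : X₄ ⟶ X₅} {e e' : X₅ ⟶ X₃} (ha : a = a') (hb : b = b') (hc : c = c') (hd : d = d')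
    (he : e = e') (h : a' ≫ b' = c' ≫ d' ≫ e') : a ≫ b = c ≫ d ≫ e := by
  rw [ha, hb, hc, hd, he, h]

lemma isIso_of_eq {X Y : S} {f f' : X ⟶ Y} (h : f = f') (h' : IsIso f') : IsIso f :=
  h ▸ h'

end WhiskerTotal

namespace HopfDatum

variable [IsIso (HopfObj.antipode (X := H))] {E : 𝟙_ S ⟶ H ⊗ H} {lam : H ⟶ 𝟙_ S}
  {g gi : 𝟙_ S ⟶ H} (hD : HopfDatum H E lam g gi)
include hD

lemma isIso_assocM (A B C : Ext H) :
    IsIso (assocM (gam E) (del E g) (fourier E lam) A B C) := by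
  match A, B, C with
  | .inl A, .inl B, .inl C => exact inferInstanceAs (IsIso (α_ A.X B.X C.X).inv)
  | .inl A, .inl B, .inr C => exact inferInstanceAs (IsIso (α_ A.X B.X C).inv)
  | .inr A, .inl B, .inl C => exact inferInstanceAs (IsIso (α_ A B.X C.X).inv)
  | .inl A, .inr B, .inl C =>
    have hA := (isAct_act A).fuse (B ⊗ C.X)
    have hC := ((isAct_act C).lact B).lact A.X
    have h : IsIso (gOp (gam E) (fuse (act A) (B ⊗ C.X)) (lact A.X (lact B (act C)))) :=
      ⟨_, hD.gOp_gam_comp hA hC (comm_fuse_lact _ _), hD.gOp_comp_gam hA hC (comm_fuse_lact _ _)⟩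
    have h' : IsIso (gOp (gam E) (fuse (act A) (B ⊗ C.X)) (lact A.X (lact B (act C))) ≫
      (α_ A.X B C.X).inv) := inferInstance
    exact isIso_of_eq (assocM_010 ..) h'
  | .inl A, .inr B, .inr C =>
    have h : IsIso (tOp (act A) (B ⊗ C)) := ⟨_, tOp_uOp (isAct_act A) _, uOp_tOp (isAct_act A) _⟩
    have h' : IsIso (tOp (act A) (B ⊗ C) ≫ H ◁ (α_ A.X B C).inv) := inferInstance
    exact isIso_of_eq (assocM_011 ..) h'
  | .inr A, .inl B, .inr C =>
    have hB := ((isAct_act B).fuse C).lact A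
    have h : IsIso (dOp (del E g) (lact A (fuse (act B) C))) :=
      ⟨_, hD.dOp_dInv hB, hD.dInv_dOp hB⟩
    have h' : IsIso (dOp (del E g) (lact A (fuse (act B) C)) ≫ H ◁ (α_ A B.X C).inv) :=
      inferInstance
    exact isIso_of_eq (assocM_101 ..) h'
  | .inr A, .inr B, .inl C =>
    have hC := ((isAct_act C).lact B).lact A
    have h : IsIso (vOp (lact A (lact B (act C)))) := ⟨_, vOp_vInv hC, vInv_vOp hC⟩
    have h' : IsIso (vOp (lact A (lact B (act C))) ≫ H ◁ (α_ A B C.X).inv ≫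
      (α_ H (A ⊗ B) C.X).inv) := inferInstance
    exact isIso_of_eq (assocM_110 ..) h'
  | .inr A, .inr B, .inr C =>
    have h := hD.isIso_fourier
    have h₂ : IsIso (bri H A (B ⊗ C)) := ⟨_, bri_br .., br_bri ..⟩
    have h' : IsIso (bri H A (B ⊗ C) ≫ fourier E lam ▷ (A ⊗ (B ⊗ C)) ≫
      H ◁ (α_ A B C).inv ≫ (α_ H (A ⊗ B) C).inv) := inferInstance
    exact isIso_of_eq (assocM_111 ..) h'

lemma pentagon (a : ∀ A B C : Ext H, tensorO (tensorO A B) C ≅ tensorO A (tensorO B C))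
    (ha : ∀ A B C, (total H).map (a A B C).inv =
      assocM (gam E) (del E g) (fourier E lam) A B C) (A B C D : Ext H) :
    (a A B (tensorO C D)).inv ≫ (a (tensorO A B) C D).inv =
      tensorM (𝟙 A) (a B C D).inv ≫ (a A (tensorO B C) D).inv ≫
        tensorM (a A B C).inv (𝟙 D) := by
  apply total_map_injective
  simp only [Functor.map_comp]
  match A, B, C, D with
  -- In degrees 0000, 0001 and 1000 all edges are associators of `S`.
  | .inl A, .inl B, .inl C, .inl D =>
    exact pentagon_congr (ha ..) (ha ..) (total_id_tensor_inl_inl (ha ..)) (ha ..)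
      (total_tensor_id_inl_inl (ha ..)) MonoidalCategory.pentagon_inv.symm
  | .inl A, .inl B, .inl C, .inr D =>
    exact pentagon_congr (ha ..) (ha ..) (total_id_tensor_inl_inr (ha ..)) (ha ..)
      (total_tensor_id_inl_inr (ha ..)) MonoidalCategory.pentagon_inv.symm
  | .inr A, .inl B, .inl C, .inl D =>
    exact pentagon_congr (ha ..) (ha ..) (total_id_tensor_inr_inl (ha ..)) (ha ..)
      (total_tensor_id_inr_inl (ha ..)) MonoidalCategory.pentagon_inv.symm
  | .inl A, .inl B, .inr C, .inl D =>
    have h := hD.pentagon_0010 (C := C) (isAct_act A) (isAct_act B) (isAct_act D)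
    rw [← tensorMod_act A B] at h
    exact pentagon_congr (ha ..) ((ha ..).trans (assocM_010 ..))
      (total_id_tensor_inl_inr ((ha ..).trans (assocM_010 ..))) ((ha ..).trans (assocM_010 ..))
      (total_tensor_id_inr_inl (ha ..)) h
  | .inl A, .inr B, .inl C, .inl D =>
    have h := hD.pentagon_0100 (B := B) (isAct_act A) (isAct_act C) (isAct_act D)
    rw [← tensorMod_act C D] at h
    exact pentagon_congr ((ha ..).trans (assocM_010 ..)) (ha ..)
      (total_id_tensor_inl_inr (ha ..)) ((ha ..).trans (assocM_010 ..))
      (total_tensor_id_inr_inl ((ha ..).trans (assocM_010 ..))) ((Category.assoc _ _ _).trans h)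
  | .inl A, .inl B, .inr C, .inr D =>
    have h := hD.pentagon_0011 (C := C) (D := D) (isAct_act A) (isAct_act B)
    rw [← tensorMod_act A B] at h
    exact pentagon_congr (ha ..) ((ha ..).trans (assocM_011 ..))
      (total_id_tensor_inl_inl ((ha ..).trans (assocM_011 ..))) ((ha ..).trans (assocM_011 ..))
      (total_tensor_id_inr_inr (ha ..)) h
  | .inl A, .inr B, .inl C, .inr D =>
    have h := hD.pentagon_0101 (B := B) (D := D) (isAct_act A) (isAct_act C)
    exact pentagon_congr ((ha ..).trans (assocM_011 ..)) ((ha ..).trans (assocM_101 ..))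
      (total_id_tensor_inl_inl ((ha ..).trans (assocM_101 ..))) ((ha ..).trans (assocM_011 ..))
      (total_tensor_id_inr_inr ((ha ..).trans (assocM_010 ..))) h
  | .inl A, .inr B, .inr C, .inl D =>
    have h := hD.pentagon_0110 (B := B) (C := C) (d := act D) (isAct_act A)
    exact pentagon_congr ((ha ..).trans (assocM_011 ..)) ((ha ..).trans (assocM_110 ..))
      (total_id_tensor_inl_inl ((ha ..).trans (assocM_110 ..))) (ha ..)
      (total_tensor_id_inl_inl ((ha ..).trans (assocM_011 ..))) h
  | .inr A, .inl B, .inl C, .inr D =>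
    have h := hD.pentagon_1001 (A := A) (D := D) (b := act B) (c := act C)
    rw [← tensorMod_act B C] at h
    exact pentagon_congr ((ha ..).trans (assocM_101 ..)) ((ha ..).trans (assocM_101 ..))
      (total_id_tensor_inr_inr (ha ..)) ((ha ..).trans (assocM_101 ..))
      (total_tensor_id_inr_inr (ha ..)) h
  | .inr A, .inl B, .inr C, .inl D =>
    have h := hD.pentagon_1010 (A := A) (C := C) (isAct_act B) (isAct_act D)
    exact pentagon_congr ((ha ..).trans (assocM_101 ..)) ((ha ..).trans (assocM_110 ..))
      (total_id_tensor_inr_inr ((ha ..).trans (assocM_010 ..))) ((ha ..).trans (assocM_110 ..))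
      (total_tensor_id_inl_inl ((ha ..).trans (assocM_101 ..))) h
  | .inr A, .inr B, .inl C, .inl D =>
    have h := hD.pentagon_1100 (A := A) (B := B) (c := act C) (d := act D)
    rw [← tensorMod_act C D] at h
    exact pentagon_congr ((ha ..).trans (assocM_110 ..)) (ha ..)
      (total_id_tensor_inr_inr (ha ..)) ((ha ..).trans (assocM_110 ..))
      (total_tensor_id_inl_inl ((ha ..).trans (assocM_110 ..))) h
  | .inr A, .inr B, .inr C, .inl D =>
    have h := hD.pentagon_1110 (A := A) (B := B) (C := C) (isAct_act D)
    exact pentagon_congr ((ha ..).trans (assocM_111 ..)) ((ha ..).trans (assocM_010 ..))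
      (total_id_tensor_inr_inl ((ha ..).trans (assocM_110 ..))) (ha ..)
      (total_tensor_id_inr_inl ((ha ..).trans (assocM_111 ..))) h
  | .inr A, .inr B, .inl C, .inr D =>
    have h := hD.pentagon_1101 (A := A) (B := B) (D := D) (isAct_act C)
    exact pentagon_congr ((ha ..).trans (assocM_111 ..)) (ha ..)
      (total_id_tensor_inr_inl ((ha ..).trans (assocM_101 ..))) ((ha ..).trans (assocM_111 ..))
      (total_tensor_id_inl_inr ((ha ..).trans (assocM_110 ..))) h
  | .inr A, .inl B, .inr C, .inr D =>
    have h := hD.pentagon_1011 (A := A) (C := C) (D := D) (isAct_act B)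
    exact pentagon_congr (ha ..) ((ha ..).trans (assocM_111 ..))
      (total_id_tensor_inr_inl ((ha ..).trans (assocM_011 ..))) ((ha ..).trans (assocM_111 ..))
      (total_tensor_id_inl_inr ((ha ..).trans (assocM_101 ..))) h
  | .inl A, .inr B, .inr C, .inr D =>
    have h := hD.pentagon_0111 (B := B) (C := C) (D := D) (isAct_act A)
    exact pentagon_congr ((ha ..).trans (assocM_010 ..)) ((ha ..).trans (assocM_111 ..))
      (total_id_tensor_inl_inr ((ha ..).trans (assocM_111 ..))) (ha ..)
      (total_tensor_id_inl_inr ((ha ..).trans (assocM_011 ..))) ((Category.assoc _ _ _).trans h)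
  | .inr A, .inr B, .inr C, .inr D =>
    have h := hD.pentagon_1111 (A := A) (B := B) (C := C) (D := D)
    exact pentagon_congr ((ha ..).trans (assocM_110 ..)) ((ha ..).trans (assocM_011 ..))
      (total_id_tensor_inr_inr ((ha ..).trans (assocM_111 ..))) ((ha ..).trans (assocM_101 ..))
      (total_tensor_id_inr_inr ((ha ..).trans (assocM_111 ..))) h

end HopfDatum

end

/-! ### Unitors, the triangle axiom, and assembly of the monoidal category -/

section

variable {S : Type u} [Category.{v} S] [MonoidalCategory S] [BraidedCategory S]
variable {H : S} [HopfObj H]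

local notation "𝕞" => fuse (MonObj.mul (X := H))
local notation "𝕕" => fork (ComonObj.comul (X := H))
local notation "𝕦" => ins (MonObj.one (X := H))
local notation "𝕖" => cap (ComonObj.counit (X := H))
local notation "𝕤" => HopfObj.antipode (X := H)

section TensorFunctor

lemma tensorM_id (A B : Ext H) : tensorM (𝟙 A) (𝟙 B) = 𝟙 (tensorO A B) := by
  apply total_map_injective
  match A, B with
  | .inl A, .inl B => exact id_tensorHom_id A.X B.X
  | .inl A, .inr B => exact id_tensorHom_id A.X B
  | .inr A, .inl B => exact id_tensorHom_id A B.X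
  | .inr A, .inr B =>
    exact (congrArg (H ◁ ·) (id_tensorHom_id A B)).trans (whiskerLeft_id H (A ⊗ B))

lemma tensorM_comp {A A' A'' B B' B'' : Ext H} (f : A ⟶ A') (f' : A' ⟶ A'') (k : B ⟶ B')
    (k' : B' ⟶ B'') : tensorM (f ≫ f') (k ≫ k') = tensorM f k ≫ tensorM f' k' := by
  apply total_map_injective
  rw [Functor.map_comp]
  match A, A', A'', B, B', B'', f, f', k, k' with
  | .inl _, .inl _, .inl _, .inl _, .inl _, .inl _, f, f', k, k' =>
    exact (tensorHom_comp_tensorHom f.down.hom k.down.hom f'.down.hom k'.down.hom).symm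
  | .inl _, .inl _, .inl _, .inr _, .inr _, .inr _, f, f', k, k' =>
    exact (tensorHom_comp_tensorHom f.down.hom k.down f'.down.hom k'.down).symm
  | .inr _, .inr _, .inr _, .inl _, .inl _, .inl _, f, f', k, k' =>
    exact (tensorHom_comp_tensorHom f.down k.down.hom f'.down k'.down.hom).symm
  | .inr _, .inr _, .inr _, .inr _, .inr _, .inr _, f, f', k, k' =>
    exact (congrArg (H ◁ ·) (tensorHom_comp_tensorHom f.down k.down f'.down k'.down).symm).trans
      (whiskerLeft_comp H _ _)

end TensorFunctor

section Unitors

lemma fuse_cap_tail (l : H ⟶ 𝟙_ S) (Y W : S) : fuse (cap l Y) W = cap l (Y ⊗ W) := by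
  simp [fuse, cap]

lemma lact_cap (l : H ⟶ 𝟙_ S) (A M : S) : lact A (cap l M) = cap l (A ⊗ M) := by
  rw [lact, cap_braid]

lemma diag_counit_left {M : S} (s : H ⊗ M ⟶ M) : diag (𝕖 M) s = s := by
  rw [diag, cap_nat, comul_counit_left_assoc]

lemma diag_counit_right {M : S} (s : H ⊗ M ⟶ M) : diag s (𝕖 M) = s := by
  rw [diag, comul_counit_right_assoc]

lemma lact_unit {M : S} (s : H ⊗ M ⟶ M) : lact (𝟙_ S) s ≫ (λ_ M).hom = H ◁ (λ_ M).hom ≫ s := by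
  simp only [lact, br, braiding_tensorUnit_right]
  monoidal

lemma fuse_unit {M : S} (s : H ⊗ M ⟶ M) : fuse s (𝟙_ S) ≫ (ρ_ M).hom = H ◁ (ρ_ M).hom ≫ s := by
  simp [fuse]

lemma exists_leftUnitorHom (A : Ext H) :
    ∃ f : tensorO (unitO H) A ⟶ A, (total H).map f = leftUnitorM A := by
  match A with
  | .inr A => exact exists_map_inr _
  | .inl A =>
    have h : diag (fuse (𝕖 (𝟙_ S)) A.X) (lact (𝟙_ S) (act A)) ≫ (λ_ A.X).hom =
        H ◁ (λ_ A.X).hom ≫ act A := by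
      rw [fuse_cap_tail, diag_counit_left, lact_unit]
    exact exists_map_inl (M := tensorMod trivMod A) (N := A) (λ_ A.X).hom
      ((congrArg (· ≫ _) (tensorMod_act trivMod A)).trans h)

lemma exists_rightUnitorHom (A : Ext H) :
    ∃ f : tensorO A (unitO H) ⟶ A, (total H).map f = rightUnitorM A := by
  match A with
  | .inr A => exact exists_map_inr _
  | .inl A =>
    have h : diag (fuse (act A) (𝟙_ S)) (lact A.X (𝕖 (𝟙_ S))) ≫ (ρ_ A.X).hom =
        H ◁ (ρ_ A.X).hom ≫ act A := by
      rw [lact_cap, diag_counit_right, fuse_unit]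
    exact exists_map_inl (M := tensorMod A trivMod) (N := A) (ρ_ A.X).hom
      ((congrArg (· ≫ _) (tensorMod_act A trivMod)).trans h)

lemma isIso_leftUnitorM (A : Ext H) : IsIso (leftUnitorM A) := by
  match A with
  | .inl A => exact inferInstanceAs (IsIso (λ_ A.X).hom)
  | .inr A => exact inferInstanceAs (IsIso (λ_ A).hom)

lemma isIso_rightUnitorM (A : Ext H) : IsIso (rightUnitorM A) := by
  match A with
  | .inl A => exact inferInstanceAs (IsIso (ρ_ A.X).hom)
  | .inr A => exact inferInstanceAs (IsIso (ρ_ A).hom)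

lemma leftUnitorM_natural {A B : Ext H} (f : A ⟶ B) :
    (total H).map (tensorM (𝟙 (unitO H)) f) ≫ leftUnitorM B = leftUnitorM A ≫ (total H).map f := by
  match A, B, f with
  | .inl A, .inl B, f =>
    exact (congrArg (· ≫ _) (total_id_tensor_inl_inl (f := f) rfl)).trans
      (leftUnitor_naturality f.down.hom)
  | .inr A, .inr B, f =>
    exact (congrArg (· ≫ _) (total_id_tensor_inl_inr (f := f) rfl)).trans
      (leftUnitor_naturality f.down)

lemma rightUnitorM_natural {A B : Ext H} (f : A ⟶ B) :
    (total H).map (tensorM f (𝟙 (unitO H))) ≫ rightUnitorM B = rightUnitorM A ≫ (total H).map f := by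
  match A, B, f with
  | .inl A, .inl B, f =>
    exact (congrArg (· ≫ _) (total_tensor_id_inl_inl (f := f) rfl)).trans
      (rightUnitor_naturality f.down.hom)
  | .inr A, .inr B, f =>
    exact (congrArg (· ≫ _) (total_tensor_id_inr_inl (f := f) rfl)).trans
      (rightUnitor_naturality f.down)

end Unitors

lemma triangle_congr {X Y Z : S} {a a' : X ⟶ Y} {b b' : Y ⟶ Z} {c c' : X ⟶ Z} (ha : a = a')
    (hb : b = b') (hc : c = c') (h : a' ≫ b' = c') : a ≫ b = c := by
  rw [ha, hb, hc, h]

namespace HopfDatum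

variable [IsIso (HopfObj.antipode (X := H))] {E : 𝟙_ S ⟶ H ⊗ H} {lam : H ⟶ 𝟙_ S}
  {g gi : 𝟙_ S ⟶ H} (hD : HopfDatum H E lam g gi)
include hD

/-- $(\mathrm{id}\otimes\varepsilon)\delta=1$, so $\delta$ has no effect when the middle object is
the unit. This is the only triangle whose associator is not that of `S`. -/
lemma dOp_counit (M : S) : dOp (del E g) (𝕖 M) = 𝟙 _ := by
  have h : ins₂ (del E g) M ≫ H ◁ 𝕖 M = 𝕦 M := by
    rw [ins₂_del_antiR, Category.assoc, ← whiskerLeft_comp, hD.antiR_counit, hD.counit_right]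
  rw [dOp, ← fuse_nat, ← whiskerLeft_comp_assoc, h, mul_one]

lemma triangle (a : ∀ A B C : Ext H, tensorO (tensorO A B) C ≅ tensorO A (tensorO B C))
    (ha : ∀ A B C, (total H).map (a A B C).inv =
      assocM (gam E) (del E g) (fourier E lam) A B C)
    (l : ∀ A : Ext H, tensorO (unitO H) A ≅ A) (hl : ∀ A, (total H).map (l A).hom = leftUnitorM A)
    (r : ∀ A : Ext H, tensorO A (unitO H) ≅ A) (hr : ∀ A, (total H).map (r A).hom = rightUnitorM A)
    (A B : Ext H) :
    (a A (unitO H) B).inv ≫ tensorM (r A).hom (𝟙 B) = tensorM (𝟙 A) (l B).hom := by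
  apply total_map_injective
  simp only [Functor.map_comp]
  match A, B with
  | .inl A, .inl B =>
    exact triangle_congr (ha ..) (total_tensor_id_inl_inl (hr ..)) (total_id_tensor_inl_inl (hl ..))
      (triangle_assoc_comp_right A.X B.X)
  | .inl A, .inr B =>
    exact triangle_congr (ha ..) (total_tensor_id_inl_inr (hr ..)) (total_id_tensor_inl_inr (hl ..))
      (triangle_assoc_comp_right A.X B)
  | .inr A, .inl B =>
    exact triangle_congr (ha ..) (total_tensor_id_inr_inl (hr ..)) (total_id_tensor_inr_inl (hl ..))
      (triangle_assoc_comp_right A B.X)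
  | .inr A, .inr B =>
    have h : (dOp (del E g) (lact A (fuse (𝕖 (𝟙_ S)) B)) ≫ H ◁ (α_ A (𝟙_ S) B).inv) ≫
        H ◁ (ρ_ A).hom ▷ B = H ◁ A ◁ (λ_ B).hom := by
      rw [fuse_cap_tail, lact_cap, hD.dOp_counit, Category.id_comp, ← whiskerLeft_comp,
        triangle_assoc_comp_right]
    exact triangle_congr ((ha ..).trans (assocM_101 ..)) (total_tensor_id_inr_inr (hr ..))
      (total_id_tensor_inr_inr (hl ..)) h

theorem exists_monoidalCategory :
    ∃ (a : ∀ A B C : Ext H, tensorO (tensorO A B) C ≅ tensorO A (tensorO B C))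
      (l : ∀ A : Ext H, tensorO (unitO H) A ≅ A) (r : ∀ A : Ext H, tensorO A (unitO H) ≅ A)
      (M : MonoidalCategory (Ext H)), M.toMonoidalCategoryStruct = extStruct a l r ∧
      (∀ A B C, (total H).map (a A B C).inv =
        assocM (gam E) (del E g) (fourier E lam) A B C) ∧
      (∀ A, (total H).map (l A).hom = leftUnitorM A) ∧
      (∀ A, (total H).map (r A).hom = rightUnitorM A) := by
  choose f hf using exists_assocHom (gam E) (del E g) (fourier E lam)
  choose l hl using exists_leftUnitorHom (H := H)
  choose r hr using exists_rightUnitorHom (H := H)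
  have hf' A B C : IsIso (f A B C) := isIso_of_total _ (isIso_of_eq (hf A B C) (hD.isIso_assocM A B C))
  have hl' A : IsIso (l A) := isIso_of_total _ (isIso_of_eq (hl A) (isIso_leftUnitorM A))
  have hr' A : IsIso (r A) := isIso_of_total _ (isIso_of_eq (hr A) (isIso_rightUnitorM A))
  let a A B C := (asIso (f A B C)).symm
  let l' A := asIso (l A)
  let r' A := asIso (r A)
  have ha A B C : (total H).map (a A B C).inv =
      assocM (gam E) (del E g) (fourier E lam) A B C := hf A B C
  refine ⟨a, l', r', { extStruct a l' r' with
    tensorHom_def := ?_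
    id_tensorHom_id := tensorM_id
    tensorHom_comp_tensorHom := fun f f' k k' => (tensorM_comp f k f' k').symm
    whiskerLeft_id := tensorM_id
    id_whiskerRight := tensorM_id
    associator_naturality := ?_
    leftUnitor_naturality := ?_
    rightUnitor_naturality := ?_
    pentagon := ?_
    triangle := ?_ }, rfl, ha, hl, hr⟩
  · intro A B C D f k
    change tensorM f k = tensorM f (𝟙 C) ≫ tensorM (𝟙 B) k
    rw [← tensorM_comp, Category.comp_id, Category.id_comp]
  · intro _ _ _ A' B' B'' f k m
    change tensorM (tensorM f k) m ≫ (a _ _ _).hom = (a _ _ _).hom ≫ tensorM f (tensorM k m)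
    have h : tensorM f (tensorM k m) ≫ (a A' B' B'').inv =
        (a _ _ _).inv ≫ tensorM (tensorM f k) m := by
      apply total_map_injective
      rw [Functor.map_comp, Functor.map_comp, ha, ha, assocM_natural]
    rw [← Iso.inv_comp_eq, ← Category.assoc, ← h, Category.assoc, Iso.inv_hom_id, Category.comp_id]
  · intro A B f
    apply total_map_injective
    change (total H).map (tensorM (𝟙 (unitO H)) f ≫ l B) = (total H).map (l A ≫ f)
    rw [Functor.map_comp, Functor.map_comp, hl, hl, leftUnitorM_natural]
  · intro A B f
    apply total_map_injective
    change (total H).map (tensorM f (𝟙 (unitO H)) ≫ r B) = (total H).map (r A ≫ f)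
    rw [Functor.map_comp, Functor.map_comp, hr, hr, rightUnitorM_natural]
  · intro A B C D
    -- The prescribed morphisms are inverse associators, so their pentagon has to be inverted.
    have h := hD.pentagon a ha A B C D
    change tensorM (a A B C).hom (𝟙 D) ≫ (a A (tensorO B C) D).hom ≫ tensorM (𝟙 A) (a B C D).hom =
      (a (tensorO A B) C D).hom ≫ (a A B (tensorO C D)).hom
    rw [← cancel_epi (a (tensorO A B) C D).inv, ← cancel_epi (a A B (tensorO C D)).inv,
      ← Category.assoc, h]
    simp only [Category.assoc, Iso.inv_hom_id_assoc, Iso.inv_hom_id]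
    rw [← Category.assoc (tensorM (a A B C).inv (𝟙 D)), ← tensorM_comp, Iso.inv_hom_id,
      Category.comp_id, tensorM_id, Category.id_comp, Iso.inv_hom_id_assoc, ← tensorM_comp,
      Iso.inv_hom_id, Category.comp_id, tensorM_id]
  · intro A B
    have h := hD.triangle a ha l' hl r' hr A B
    change (a A (unitO H) B).hom ≫ tensorM (𝟙 A) (l' B).hom = tensorM (r' A).hom (𝟙 B)
    rw [← h, Iso.hom_inv_id_assoc]

end HopfDatum

lemma monoidalCategory_ext {C : Type*} [Category C] {M M' : MonoidalCategory C}
    (h : M.toMonoidalCategoryStruct = M'.toMonoidalCategoryStruct) : M = M' := by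
  cases M
  cases M'
  cases h
  rfl

end

/-! ### Existence and uniqueness of the extension; transport of the data -/

section

variable {S : Type u} [Category.{v} S] [MonoidalCategory S] [BraidedCategory S]
variable {H : S} [HopfObj H]

local notation "𝕞" => fuse (MonObj.mul (X := H))
local notation "𝕕" => fork (ComonObj.comul (X := H))
local notation "𝕦" => ins (MonObj.one (X := H))
local notation "𝕖" => cap (ComonObj.counit (X := H))
local notation "𝕤" => HopfObj.antipode (X := H)

section Existence

variable [IsIso (HopfObj.antipode (X := H))] [RightRigidCategory S] [RibbonCategory S]
  {Γ : (Hᘁ : S) ⟶ H} {lam : H ⟶ 𝟙_ S} {g : 𝟙_ S ⟶ H}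

/-- Evaluate the defining equations at $\Lambda$, where $\lambda(\Lambda)=1$. -/
lemma IsAdmissible.distinguished_unique (h : IsAdmissible Γ lam g) {g' : 𝟙_ S ⟶ H}
    (hg : IsDistinguished lam g') : g' = g := by
  apply ext_ins
  intro W
  have h1 := congrArg (fun f => ins (integral (copairing Γ) lam) W ≫ f)
    ((isDistinguished_iff.1 hg W).symm.trans (isDistinguished_iff.1 h.distinguished W))
  simpa only [reassoc_of% h.hopfDatum.integral_cap] using h1

lemma IsAdmissible.isMulInverse (h : IsAdmissible Γ lam g) : IsMulInverse g (g ≫ 𝕤) :=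
  (isMulInverse_iff g (g ≫ 𝕤)).2 ⟨h.hopfDatum.gi_g, h.hopfDatum.g_gi⟩

lemma IsAdmissible.isHopfCopairing (h : IsAdmissible Γ lam g) : IsHopfCopairing (copairing Γ) :=
  h.hopfDatum.toIsHopfCopairing

theorem IsAdmissible.exists_isExtension (h : IsAdmissible Γ lam g) :
    ∃ M : MonoidalCategory (Ext H), IsExtension Γ lam g M := by
  obtain ⟨a, l, r, M, hM, ha, hl, hr⟩ := h.hopfDatum.exists_monoidalCategory
  refine ⟨M, a, l, r, hM, fun A B C => ?_, hl, hr⟩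
  rw [ha, gammaOf_eq, deltaOf_eq, phiOf_eq h.isHopfCopairing]

/-- Coherence isomorphisms are determined by their underlying morphisms in `S`. -/
lemma IsExtension.unique {M M' : MonoidalCategory (Ext H)} (h : IsExtension Γ lam g M)
    (h' : IsExtension Γ lam g M') : M = M' := by
  obtain ⟨a, l, r, hM, ha, hl, hr⟩ := h
  obtain ⟨a', l', r', hM', ha', hl', hr'⟩ := h'
  have h1 : a = a' := by
    funext A B C
    exact Iso.ext_inv (total_map_injective ((ha A B C).trans (ha' A B C).symm))
  have h2 : l = l' := by
    funext A
    exact Iso.ext (total_map_injective ((hl A).trans (hl' A).symm))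
  have h3 : r = r' := by
    funext A
    exact Iso.ext (total_map_injective ((hr A).trans (hr' A).symm))
  apply monoidalCategory_ext
  rw [hM, hM', h1, h2, h3]

end Existence

section Hom

variable {K : S} [HopfObj K] (f : H ⟶ K) [IsBimonHom f]

lemma mul_hom (W : S) : 𝕞 W ≫ f ▷ W = f ▷ (H ⊗ W) ≫ K ◁ f ▷ W ≫ fuse MonObj.mul W := by
  have h := IsMonHom.mul_hom f
  rw [fuse_comp, h, fuse, fuse, MonoidalCategory.tensorHom_def]
  simp

lemma mul_hom_assoc : type_of% (reassoc_of% @mul_hom) := @(reassoc_of% @mul_hom)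

lemma one_hom (W : S) : 𝕦 W ≫ f ▷ W = ins MonObj.one W := by
  rw [ins_comp, IsMonHom.one_hom f]

lemma hom_comul (W : S) :
    f ▷ W ≫ fork ComonObj.comul W = 𝕕 W ≫ f ▷ (H ⊗ W) ≫ K ◁ f ▷ W := by
  have h := IsComonHom.hom_comul f
  rw [comp_fork, h, fork, fork, MonoidalCategory.tensorHom_def]
  simp

lemma hom_comul_assoc : type_of% (reassoc_of% @hom_comul) := @(reassoc_of% @hom_comul)

lemma hom_counit (W : S) : f ▷ W ≫ cap ComonObj.counit W = 𝕖 W := by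
  rw [comp_cap, IsComonHom.hom_counit f]

lemma hom_antipode_whisker (W : S) :
    f ▷ W ≫ HopfObj.antipode (X := K) ▷ W = 𝕤 ▷ W ≫ f ▷ W := by
  rw [← comp_whiskerRight, HopfObj.hom_antipode, comp_whiskerRight]

lemma hom_antipode_inv [IsIso (HopfObj.antipode (X := H))] [IsIso (HopfObj.antipode (X := K))] :
    f ≫ inv (HopfObj.antipode (X := K)) = inv (HopfObj.antipode (X := H)) ≫ f := by
  rw [← cancel_mono (HopfObj.antipode (X := K)), Category.assoc, IsIso.inv_hom_id, Category.assoc,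
    HopfObj.hom_antipode, IsIso.inv_hom_id_assoc, Category.comp_id]

lemma hom_mulR (x : 𝟙_ S ⟶ H) : f ≫ mulR (x ≫ f) = mulR x ≫ f := by
  apply ext_whiskerRight
  intro W
  rw [comp_whiskerRight, comp_whiskerRight, mulR_whiskerRight, mulR_whiskerRight, Category.assoc,
    mul_hom, ← ins_comp, whiskerLeft_comp_assoc, whisker_exchange_assoc]

lemma hom_mulL (x : 𝟙_ S ⟶ H) : f ≫ mulL (x ≫ f) = mulL x ≫ f := by
  apply ext_whiskerRight
  intro W
  rw [comp_whiskerRight, comp_whiskerRight, mulL_whiskerRight, mulL_whiskerRight, Category.assoc,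
    mul_hom, ← ins_comp, Category.assoc, ins_nat_assoc, whisker_exchange_assoc]

lemma ins₂_map (E : 𝟙_ S ⟶ H ⊗ H) (W : S) :
    ins₂ (E ≫ (f ⊗ₘ f)) W = ins₂ E W ≫ H ◁ f ▷ W ≫ f ▷ (K ⊗ W) := by
  rw [MonoidalCategory.tensorHom_def', ← Category.assoc, ← ins₂_left, ← ins₂_right, Category.assoc]

variable {f} {E : 𝟙_ S ⟶ H ⊗ H}

lemma IsMulInverse.map {x y : 𝟙_ S ⟶ H} (h : IsMulInverse x y) : IsMulInverse (x ≫ f) (y ≫ f) := by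
  have h' (x y : 𝟙_ S ⟶ H) : (λ_ (𝟙_ S)).inv ≫ (x ≫ f ⊗ₘ y ≫ f) ≫ MonObj.mul =
      ((λ_ (𝟙_ S)).inv ≫ (x ⊗ₘ y) ≫ MonObj.mul) ≫ f := by
    rw [Category.assoc, Category.assoc, IsMonHom.mul_hom f, tensorHom_comp_tensorHom_assoc]
  exact ⟨by rw [h', h.1, IsMonHom.one_hom f], by rw [h', h.2, IsMonHom.one_hom f]⟩

lemma IsHopfCopairing.map (hE : IsHopfCopairing E)
    (hc : ∀ {W Z : S} (k k' : K ⊗ W ⟶ Z), ins₂ (E ≫ (f ⊗ₘ f)) W ≫ K ◁ k =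
      ins₂ (E ≫ (f ⊗ₘ f)) W ≫ K ◁ k' → k = k') : IsHopfCopairing (E ≫ (f ⊗ₘ f)) where
  comul_left W := by
    have h := mul_hom f W
    rw [← whisker_exchange_assoc] at h
    have h1 := congrArg (fun f => H ◁ H ◁ f) (h)
    simp only [whiskerLeft_comp, Category.assoc] at h1
    simp only [ins₂_map, whiskerLeft_comp, Category.assoc]
    rw [hom_comul, fork_nat_assoc, reassoc_of% hE.comul_left, reassoc_of% h1]
    simp only [← whisker_exchange, ← whisker_exchange_assoc, ← whiskerLeft_whisker_exchange,
      ← whiskerLeft_whisker_exchange_assoc]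
    rw [whiskerLeft_ins₂_nat_assoc]
  comul_right W := by
    have h := mul_hom f (K ⊗ K ⊗ W)
    rw [← whisker_exchange_assoc] at h
    have h' := hom_comul f W
    rw [← whisker_exchange] at h'
    have h1 := congrArg (fun f => H ◁ f) (h')
    simp only [whiskerLeft_comp, Category.assoc] at h1
    simp only [ins₂_map, whiskerLeft_comp, Category.assoc]
    rw [← whisker_exchange, reassoc_of% h1, reassoc_of% hE.comul_right, ← fuse_nat_assoc,
      ← fuse_nat_assoc, h]
    simp only [← whisker_exchange, ← whisker_exchange_assoc, ← whiskerLeft_whisker_exchange,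
      ← whiskerLeft_whisker_exchange_assoc]
    rw [whiskerLeft_ins₂_nat_assoc]
  counit_left W := by
    rw [ins₂_map, Category.assoc, Category.assoc, hom_counit, cap_nat, reassoc_of% hE.counit_left,
      one_hom]
  counit_right W := by
    rw [ins₂_map, Category.assoc, Category.assoc, ← whisker_exchange, ← whiskerLeft_comp_assoc,
      hom_counit, reassoc_of% hE.counit_right, one_hom]
  antipode W := by
    have h := congrArg (fun f => H ◁ f) (hom_antipode_whisker f W)
    simp only [whiskerLeft_comp, Category.assoc] at h
    rw [ins₂_map, Category.assoc, Category.assoc, hom_antipode_whisker]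
    simp only [whiskerLeft_comp, Category.assoc]
    rw [whisker_exchange_assoc, ← whisker_exchange f, reassoc_of% h, reassoc_of% hE.antipode]
  cancel := hc

end Hom

section Transport

variable [RightRigidCategory S] {K : S} [HopfObj K]

/-- Sliding $f^\vee$ through coevaluation puts `f` on the first leg as well. Transport of $\Gamma$
is thus transport of the copairing by $f\otimes f$, to which the conditions translate. -/
lemma copairing_map (f : H ⟶ K) (Γ : (Hᘁ : S) ⟶ H) :
    copairing (rightAdjointMate f ≫ Γ ≫ f) = copairing Γ ≫ (f ⊗ₘ f) := by
  simp only [copairing, whiskerLeft_comp, Category.assoc]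
  rw [coevaluation_comp_rightAdjointMate_assoc, ← whisker_exchange_assoc,
    MonoidalCategory.tensorHom_def]

lemma copairing_comp (Γ : (Hᘁ : S) ⟶ H) (T : H ⟶ H) :
    copairing (Γ ≫ T) = copairing Γ ≫ H ◁ T := by
  rw [copairing, copairing, Category.assoc, whiskerLeft_comp]

variable [RibbonCategory S] {Γ : (Hᘁ : S) ⟶ H} {lam : H ⟶ 𝟙_ S} {g : 𝟙_ S ⟶ H}

theorem IsAdmissible.map (h : IsAdmissible Γ lam g) (f : H ≅ K) [IsBimonHom f.hom]
    [IsBimonHom f.inv] :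
    IsAdmissible (rightAdjointMate f.hom ≫ Γ ≫ f.hom) (f.inv ≫ lam) (g ≫ f.hom) where
  hopf_iso := by
    have := h.hopf_iso.isIso
    have : IsIso (rightAdjointMate f.hom) :=
      ⟨rightAdjointMate f.inv, by rw [← comp_rightAdjointMate, f.inv_hom_id, rightAdjointMate_id],
        by rw [← comp_rightAdjointMate, f.hom_inv_id, rightAdjointMate_id]⟩
    refine (isHopfCopairing_iff _).1 ?_
    have h1 := (isHopfCopairing_iff Γ).2 h.hopf_iso
    have h2 := copairing_map f.hom Γ
    rw [h2]
    exact h1.map (by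
      rw [← h2]
      exact copairing_cancel)
  cointegral := by
    rw [isRightCointegral_iff]
    intro W
    have hc (W : S) : f.hom ▷ W ≫ cap (f.inv ≫ lam) W = cap lam W := by
      rw [comp_cap, Iso.hom_inv_id_assoc]
    rw [← cancel_epi (f.hom ▷ W), hom_comul_assoc, cap_nat, reassoc_of% hc, reassoc_of% hc,
      reassoc_of% isRightCointegral_iff.1 h.cointegral W, one_hom]
  distinguished := by
    rw [isDistinguished_iff]
    intro W
    have hc (W : S) : f.hom ▷ W ≫ cap (f.inv ≫ lam) W = cap lam W := by
      rw [comp_cap, Iso.hom_inv_id_assoc]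
    rw [← cancel_epi (f.hom ▷ W), hom_comul_assoc, ← whiskerLeft_comp, hc, reassoc_of% hc,
      ← whisker_exchange, reassoc_of% isDistinguished_iff.1 h.distinguished W, ins_comp]
  normalised := by
    have h1 := h.normalised
    have h2 := copairing_map f.hom Γ
    rw [copairing, copairing, Category.assoc] at h2
    rw [reassoc_of% h2, tensorHom_comp_tensorHom_assoc, Iso.hom_inv_id_assoc, h1]
  self_dual y hy := by
    have hy' := hy.map (f := f.inv)
    rw [Category.assoc, Iso.hom_inv_id, Category.comp_id] at hy'
    have h1 := h.self_dual _ hy'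
    have h2 : f.hom ≫ (mulR (g ≫ f.hom) ≫ mulL y) ≫ HopfObj.antipode ≫ HopfObj.antipode =
        ((mulR g ≫ mulL (y ≫ f.inv)) ≫ HopfObj.antipode ≫ HopfObj.antipode) ≫ f.hom := by
      have h3 := hom_mulL f.hom (y ≫ f.inv)
      rw [Category.assoc, Iso.inv_hom_id, Category.comp_id] at h3
      simp only [Category.assoc]
      rw [reassoc_of% hom_mulR f.hom g, reassoc_of% h3,
        reassoc_of% HopfObj.hom_antipode f.hom, HopfObj.hom_antipode f.hom]
    have h4 := (self_dual_iff Γ (Γ ≫ (mulR g ≫ mulL (y ≫ f.inv)) ≫ HopfObj.antipode ≫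
      HopfObj.antipode)).1 (by simpa only [Category.assoc] using h1)
    have h5 := (self_dual_iff (rightAdjointMate f.hom ≫ Γ ≫ f.hom)
      ((rightAdjointMate f.hom ≫ Γ ≫ f.hom) ≫ (mulR (g ≫ f.hom) ≫ mulL y) ≫ HopfObj.antipode ≫
      HopfObj.antipode)).2 (by
        rw [copairing_comp, copairing_map, Category.assoc, Category.assoc,
          MonoidalCategory.tensorHom_def, Category.assoc, ← whiskerLeft_comp_assoc, h2,
          whiskerLeft_comp_assoc, ← whisker_exchange_assoc, ← tensorHom_def_assoc,
          ← MonoidalCategory.tensorHom_def, BraidedCategory.braiding_naturality]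
        rw [copairing_comp] at h4
        simp only [Category.assoc] at h4 ⊢
        rw [reassoc_of% h4])
    simpa only [Category.assoc] using h5

end Transport

end

/-! ### The operators under restriction along a Hopf algebra morphism -/

section

variable {S : Type u} [Category.{v} S] [MonoidalCategory S] [BraidedCategory S]
variable {H : S} [HopfObj H]

local notation "𝕞" => fuse (MonObj.mul (X := H))
local notation "𝕕" => fork (ComonObj.comul (X := H))
local notation "𝕦" => ins (MonObj.one (X := H))
local notation "𝕖" => cap (ComonObj.counit (X := H))
local notation "𝕤" => HopfObj.antipode (X := H)

section Restriction

variable {K : S} [HopfObj K] (f : H ⟶ K) [IsBimonHom f] {A M : S}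

lemma fuse_restrict (a : K ⊗ A ⟶ A) (W : S) : fuse (f ▷ A ≫ a) W = f ▷ (A ⊗ W) ≫ fuse a W := by
  simp [fuse]

lemma lact_restrict (X : S) (s : K ⊗ M ⟶ M) : lact X (f ▷ M ≫ s) = f ▷ (X ⊗ M) ≫ lact X s := by
  rw [lact, lact, whiskerLeft_comp, whisker_braid_assoc]

lemma diag_restrict (r s : K ⊗ M ⟶ M) : diag (f ▷ M ≫ r) (f ▷ M ≫ s) = f ▷ M ≫ diag r s := by
  rw [diag, diag, hom_comul_assoc, ← whisker_exchange_assoc]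
  simp only [whiskerLeft_comp, Category.assoc]
  rw [whisker_exchange_assoc, whisker_exchange_assoc]

lemma gOp_restrict (x : 𝟙_ S ⟶ H ⊗ H) (r s : K ⊗ M ⟶ M) :
    gOp x (f ▷ M ≫ r) (f ▷ M ≫ s) = gOp (x ≫ (f ⊗ₘ f)) r s := by
  rw [gOp, gOp, ins₂_map, whiskerLeft_comp_assoc, whisker_exchange_assoc, Category.assoc,
    Category.assoc]

/-- Here and in the next lemmas the regular factor changes from `H` to `K`, so the operators agree
only up to `f` on that factor. -/
lemma vOp_restrict (s : K ⊗ M ⟶ M) : vOp (f ▷ M ≫ s) ≫ f ▷ M = f ▷ M ≫ vOp s := by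
  rw [vOp, vOp, hom_comul_assoc, Category.assoc, whiskerLeft_comp_assoc, whisker_exchange,
    ← whisker_exchange_assoc]

lemma vOp_restrict_assoc : type_of% (reassoc_of% @vOp_restrict) := @(reassoc_of% @vOp_restrict)

lemma dOp_restrict (x : 𝟙_ S ⟶ H ⊗ H) (s : K ⊗ M ⟶ M) :
    dOp x (f ▷ M ≫ s) ≫ f ▷ M = f ▷ M ≫ dOp (x ≫ (f ⊗ₘ f)) s := by
  rw [dOp, dOp, ins₂_map]
  simp only [whiskerLeft_comp, Category.assoc]
  rw [whisker_exchange, ← fuse_nat_assoc, mul_hom_assoc]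
  simp only [← whisker_exchange, ← whisker_exchange_assoc]

lemma dOp_restrict_assoc : type_of% (reassoc_of% @dOp_restrict) := @(reassoc_of% @dOp_restrict)

variable [IsIso (HopfObj.antipode (X := H))] [IsIso (HopfObj.antipode (X := K))]

lemma tOp_restrict (a : K ⊗ A ⟶ A) (W : S) :
    tOp (f ▷ A ≫ a) W ≫ f ▷ (A ⊗ W) = A ◁ f ▷ W ≫ tOp a W := by
  have h : inv 𝕤 ▷ (A ⊗ W) ≫ f ▷ (A ⊗ W) =
      f ▷ (A ⊗ W) ≫ inv (HopfObj.antipode (X := K)) ▷ (A ⊗ W) := by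
    rw [← comp_whiskerRight, ← hom_antipode_inv, comp_whiskerRight]
  have h' := congrArg (fun f => H ◁ f) (h)
  simp only [whiskerLeft_comp, Category.assoc] at h'
  rw [tOp, tOp, fuse_restrict, whisker_bri_assoc, hom_comul_assoc, whisker_bri_assoc,
    bri_whisker_assoc, ← whisker_exchange_assoc, ← whisker_exchange, ← reassoc_of% h']
  simp only [whiskerLeft_comp, Category.assoc]

lemma tOp_restrict_assoc : type_of% (reassoc_of% @tOp_restrict) := @(reassoc_of% @tOp_restrict)

lemma gam_map (E : 𝟙_ S ⟶ H ⊗ H) : gam E ≫ (f ⊗ₘ f) = gam (E ≫ (f ⊗ₘ f)) := by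
  rw [gam, gam, MonoidalCategory.tensorHom_def', Category.assoc, Category.assoc, Category.assoc,
    ← whiskerLeft_comp_assoc, ← hom_antipode_inv, whiskerLeft_comp_assoc, whisker_exchange]

lemma fourier_map (E : 𝟙_ S ⟶ H ⊗ H) (lam : K ⟶ 𝟙_ S) :
    fourier E (f ≫ lam) ≫ f = f ≫ fourier (E ≫ (f ⊗ₘ f)) lam := by
  apply ext_whiskerRight
  intro W
  have h := congrArg (fun f => H ◁ f) (mul_hom f W)
  simp only [whiskerLeft_comp, Category.assoc] at h
  rw [comp_whiskerRight, comp_whiskerRight, fourier_whiskerRight, fourier_whiskerRight, ins₂_map,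
    ← comp_cap]
  simp only [whiskerLeft_comp, Category.assoc]
  rw [ins₂_nat_assoc, reassoc_of% h]
  simp only [← whisker_exchange, ← whisker_exchange_assoc, ← whiskerLeft_whisker_exchange,
      ← whiskerLeft_whisker_exchange_assoc]

end Restriction

lemma del_map {K : S} [HopfObj K] (f : H ⟶ K) [IsBimonHom f] (E : 𝟙_ S ⟶ H ⊗ H) (g : 𝟙_ S ⟶ H) :
    del E g ≫ (f ⊗ₘ f) = del (E ≫ (f ⊗ₘ f)) (g ≫ f) := by
  rw [del, del, MonoidalCategory.tensorHom_def', Category.assoc, Category.assoc, Category.assoc,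
    ← whiskerLeft_comp_assoc, Category.assoc, ← hom_mulR, ← reassoc_of% HopfObj.hom_antipode f,
    whiskerLeft_comp_assoc, whisker_exchange]

end

/-! ### The restriction functor and its structure maps -/

section

variable {S : Type u} [Category.{v} S] [MonoidalCategory S] [BraidedCategory S]
variable {H : S} [HopfObj H]

local notation "𝕞" => fuse (MonObj.mul (X := H))
local notation "𝕕" => fork (ComonObj.comul (X := H))
local notation "𝕦" => ins (MonObj.one (X := H))
local notation "𝕖" => cap (ComonObj.counit (X := H))
local notation "𝕤" => HopfObj.antipode (X := H)

section RestrictionFunctor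

variable {K : S} [HopfObj K] (f : H ⟶ K) [IsBimonHom f]

/-- Restriction of a module along a morphism of Hopf algebras. -/
def restrictMod (A : Mod S K) : Mod S H :=
  mkMod A.X (f ▷ A.X ≫ act A)
    (by rw [← comp_whiskerRight_assoc, IsMonHom.one_hom f, act_one])
    (by
      rw [← comp_whiskerRight_assoc, IsMonHom.mul_hom f, MonoidalCategory.tensorHom_def,
        comp_whiskerRight_assoc, comp_whiskerRight_assoc, act_mul,
          associator_naturality_middle_assoc,
        associator_naturality_left_assoc, whiskerLeft_comp_assoc, ← whisker_exchange_assoc,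
        ← whisker_exchange_assoc])

/-- Restriction along a morphism of Hopf algebras on the objects of `C`. -/
def restrictO : Ext K → Ext H
  | .inl A => .inl (restrictMod f A)
  | .inr A => .inr A

/-- Restriction along a morphism of Hopf algebras on the morphisms of `C`. -/
def restrictM {A B : Ext K} (k : A ⟶ B) : restrictO f A ⟶ restrictO f B :=
  match A, B, k with
  | .inl A, .inl B,
    k => ULift.up (mkHom (M := restrictMod f A) (N := restrictMod f B) k.down.hom (by
      change (f ▷ A.X ≫ act A) ≫ k.down.hom = H ◁ k.down.hom ≫ f ▷ B.X ≫ act B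
      rw [Category.assoc, act_hom, whisker_exchange_assoc]))
  | .inr _, .inr _, k => ULift.up k.down

/-- Restriction along a morphism of Hopf algebras, as a functor on `C`. -/
def restrictE : Ext K ⥤ Ext H where
  obj := restrictO f
  map k := restrictM f k
  map_id A := by
    apply total_map_injective
    match A with
    | .inl A => rfl
    | .inr A => rfl
  map_comp {A B C} k l := by
    apply total_map_injective
    match A, B, C, k, l with
    | .inl A, .inl B, .inl C, k, l => rfl
    | .inr A, .inr B, .inr C, k, l => rfl

instance restrictE_faithful : (restrictE f).Faithful where
  map_injective {A B} k l h := by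
    apply total_map_injective
    match A, B, k, l, h with
    | .inl A, .inl B, k, l, h => exact congrArg ((total H).map ·) h
    | .inr A, .inr B, k, l, h => exact congrArg ((total H).map ·) h

instance restrictE_full [IsIso f] : (restrictE f).Full where
  map_surjective {A B} k := by
    match A, B, k with
    | .inl A, .inl B, k =>
      have h (u : A.X ⟶ B.X) (hu : (f ▷ A.X ≫ act A) ≫ u = H ◁ u ≫ f ▷ B.X ≫ act B) :
          act A ≫ u = K ◁ u ≫ act B := by
        rw [← cancel_epi (f ▷ A.X), ← Category.assoc, hu, whisker_exchange_assoc]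
      exact ⟨ULift.up (mkHom (M := A) (N := B) k.down.hom (h _ (act_hom k.down))), rfl⟩
    | .inr A, .inr B, k => exact ⟨ULift.up k.down, rfl⟩

lemma restrictE_essSurj (e : H ≅ K) [IsBimonHom e.hom] [IsBimonHom e.inv] :
    (restrictE e.hom).EssSurj where
  mem_essImage A := by
    match A with
    | .inr A => exact ⟨.inr A, ⟨Iso.refl _⟩⟩
    | .inl A =>
      have h : (e.hom ▷ A.X ≫ e.inv ▷ A.X ≫ act A) ≫ 𝟙 A.X = H ◁ 𝟙 A.X ≫ act A := by
        rw [← comp_whiskerRight_assoc, e.hom_inv_id]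
        simp
      let m : (.inl (restrictMod e.hom (restrictMod e.inv A)) : Ext H) ⟶ .inl A :=
        ULift.up (mkHom (M := restrictMod e.hom (restrictMod e.inv A)) (N := A) (𝟙 A.X) h)
      have : IsIso m := isIso_of_total m (inferInstanceAs (IsIso (𝟙 A.X)))
      let e' := asIso m
      -- A preimage is the restriction along the inverse; restricting back gives the same object
      -- with an equal action, so the identity is linear.
      exact ⟨.inl (restrictMod e.inv A), ⟨e'⟩⟩

/-- The tensor structure of restriction. -/
def tensorator : (A B : Ext K) →
    (tensorO (restrictO f A) (restrictO f B) ⟶ restrictO f (tensorO A B))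
  | .inl A, .inl B => ULift.up (mkHom (M := tensorMod (restrictMod f A) (restrictMod f B))
      (N := restrictMod f (tensorMod A B)) (𝟙 (A.X ⊗ B.X)) (by
        have h : diag (fuse (f ▷ A.X ≫ act A) B.X) (lact A.X (f ▷ B.X ≫ act B)) ≫ 𝟙 _ =
            H ◁ 𝟙 (A.X ⊗ B.X) ≫ f ▷ (A.X ⊗ B.X) ≫ diag (fuse (act A) B.X) (lact A.X (act B)) := by
          rw [fuse_restrict, lact_restrict, diag_restrict]
          simp
        exact ((congrArg (· ≫ _) (tensorMod_act _ _)).trans h).trans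
          (congrArg (fun r => _ ≫ _ ≫ r) (tensorMod_act A B).symm)))
  | .inl A, .inr B => ULift.up (𝟙 (A.X ⊗ B))
  | .inr A, .inl B => ULift.up (𝟙 (A ⊗ B.X))
  | .inr A, .inr B => ULift.up (mkHom (M := freeMod (A ⊗ B)) (N := restrictMod f (freeMod (A ⊗ B)))
      (f ▷ (A ⊗ B)) (by
        have h := mul_hom f (A ⊗ B)
        rw [← whisker_exchange_assoc] at h
        exact h))

lemma isIso_tensorator [IsIso f] (A B : Ext K) : IsIso (tensorator f A B) := by
  apply isIso_of_total
  match A, B with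
  | .inl A, .inl B => exact inferInstanceAs (IsIso (𝟙 (A.X ⊗ B.X)))
  | .inl A, .inr B => exact inferInstanceAs (IsIso (𝟙 (A.X ⊗ B)))
  | .inr A, .inl B => exact inferInstanceAs (IsIso (𝟙 (A ⊗ B.X)))
  | .inr A, .inr B => exact inferInstanceAs (IsIso (f ▷ (A ⊗ B)))

lemma tensorator_natural {A A' B B' : Ext K} (k : A ⟶ A') (l : B ⟶ B') :
    tensorM (restrictM f k) (restrictM f l) ≫ tensorator f A' B' =
      tensorator f A B ≫ restrictM f (tensorM k l) := by
  apply total_map_injective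
  simp only [Functor.map_comp]
  match A, A', B, B', k, l with
  | .inl A, .inl A', .inl B, .inl B', k, l =>
    exact (Category.comp_id (k.down.hom ⊗ₘ l.down.hom)).trans (Category.id_comp _).symm
  | .inl A, .inl A', .inr B, .inr B', k, l =>
    exact (Category.comp_id (k.down.hom ⊗ₘ l.down)).trans (Category.id_comp _).symm
  | .inr A, .inr A', .inl B, .inl B', k, l =>
    exact (Category.comp_id (k.down ⊗ₘ l.down.hom)).trans (Category.id_comp _).symm
  | .inr A, .inr A', .inr B, .inr B', k, l =>
    exact whisker_exchange f (k.down ⊗ₘ l.down)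

/-- The unit structure of restriction. -/
def restrictUnit : unitO H ⟶ restrictO f (unitO K) :=
  ULift.up (mkHom (M := trivMod) (N := restrictMod f trivMod) (𝟙 (𝟙_ S)) (by
    have h : 𝕖 (𝟙_ S) ≫ 𝟙 (𝟙_ S) = H ◁ 𝟙 (𝟙_ S) ≫ f ▷ 𝟙_ S ≫ cap ComonObj.counit (𝟙_ S) := by
      rw [hom_counit]
      simp
    exact h))

lemma isIso_restrictUnit : IsIso (restrictUnit f) :=
  isIso_of_total _ (inferInstanceAs (IsIso (𝟙 (𝟙_ S))))

end RestrictionFunctor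

end

/-! ### Monoidality of restriction -/

section

variable {S : Type u} [Category.{v} S] [MonoidalCategory S] [BraidedCategory S]
variable {H : S} [HopfObj H]

local notation "𝕞" => fuse (MonObj.mul (X := H))
local notation "𝕕" => fork (ComonObj.comul (X := H))
local notation "𝕦" => ins (MonObj.one (X := H))
local notation "𝕖" => cap (ComonObj.counit (X := H))
local notation "𝕤" => HopfObj.antipode (X := H)

lemma square_congr {X₁ X₂ X₃ X₄ Y₂ Y₃ : S} {a a' : X₁ ⟶ X₂} {b b' : X₂ ⟶ X₃} {c c' : X₃ ⟶ X₄}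
    {d d' : X₁ ⟶ Y₂} {e e' : Y₂ ⟶ Y₃} {m m' : Y₃ ⟶ X₄} (ha : a = a') (hb : b = b') (hc : c = c')
    (hd : d = d') (he : e = e') (hm : m = m') (h : a' ≫ b' ≫ c' = d' ≫ e' ≫ m') :
    a ≫ b ≫ c = d ≫ e ≫ m := by
  rw [ha, hb, hc, hd, he, hm, h]

section RestrictionCoherence

variable {K : S} [HopfObj K] (f : H ⟶ K) [IsBimonHom f]

lemma total_restrictM_inl {M N : Mod S K} {k : (.inl M : Ext K) ⟶ .inl N} {u : M.X ⟶ N.X}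
    (h : (total K).map k = u) : (total H).map (restrictM f k) = u := h

lemma total_restrictM_inr {M N : S} {k : (.inr M : Ext K) ⟶ .inr N} {u : M ⟶ N}
    (h : (total K).map k = u) : (total H).map (restrictM f k) = u := h

lemma tensorator_leftUnitor (l : ∀ A : Ext K, tensorO (unitO K) A ≅ A)
    (hl : ∀ A, (total K).map (l A).hom = leftUnitorM A)
    (l' : ∀ A : Ext H, tensorO (unitO H) A ≅ A)
    (hl' : ∀ A, (total H).map (l' A).hom = leftUnitorM A) (A : Ext K) :
    (l' (restrictO f A)).hom = tensorM (restrictUnit f) (𝟙 (restrictO f A)) ≫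
      tensorator f (unitO K) A ≫ restrictM f (l A).hom := by
  apply total_map_injective
  simp only [Functor.map_comp]
  match A with
  | .inl A =>
    have h : (λ_ A.X).hom = 𝟙 (𝟙_ S) ▷ A.X ≫ 𝟙 (𝟙_ S ⊗ A.X) ≫ (λ_ A.X).hom := by simp
    exact ((triangle_congr (total_tensor_id_inl_inl rfl) ((congrArg (𝟙 (𝟙_ S ⊗ A.X) ≫ ·)
      (total_restrictM_inl f (hl ..)))) (hl' ..) h.symm)).symm
  | .inr A =>
    have h : (λ_ A).hom = 𝟙 (𝟙_ S) ▷ A ≫ 𝟙 (𝟙_ S ⊗ A) ≫ (λ_ A).hom := by simp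
    exact ((triangle_congr (total_tensor_id_inl_inr rfl) ((congrArg (𝟙 (𝟙_ S ⊗ A) ≫ ·)
      (total_restrictM_inr f (hl ..)))) (hl' ..) h.symm)).symm

lemma tensorator_rightUnitor (r : ∀ A : Ext K, tensorO A (unitO K) ≅ A)
    (hr : ∀ A, (total K).map (r A).hom = rightUnitorM A)
    (r' : ∀ A : Ext H, tensorO A (unitO H) ≅ A)
    (hr' : ∀ A, (total H).map (r' A).hom = rightUnitorM A) (A : Ext K) :
    (r' (restrictO f A)).hom = tensorM (𝟙 (restrictO f A)) (restrictUnit f) ≫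
      tensorator f A (unitO K) ≫ restrictM f (r A).hom := by
  apply total_map_injective
  simp only [Functor.map_comp]
  match A with
  | .inl A =>
    have h : (ρ_ A.X).hom = A.X ◁ 𝟙 (𝟙_ S) ≫ 𝟙 (A.X ⊗ 𝟙_ S) ≫ (ρ_ A.X).hom := by simp
    exact ((triangle_congr (total_id_tensor_inl_inl rfl) ((congrArg (𝟙 (A.X ⊗ 𝟙_ S) ≫ ·)
      (total_restrictM_inl f (hr ..)))) (hr' ..) h.symm)).symm
  | .inr A =>
    have h : (ρ_ A).hom = A ◁ 𝟙 (𝟙_ S) ≫ 𝟙 (A ⊗ 𝟙_ S) ≫ (ρ_ A).hom := by simp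
    exact ((triangle_congr (total_id_tensor_inr_inl rfl) ((congrArg (𝟙 (A ⊗ 𝟙_ S) ≫ ·)
      (total_restrictM_inr f (hr ..)))) (hr' ..) h.symm)).symm

variable [IsIso (HopfObj.antipode (X := H))] [IsIso (HopfObj.antipode (X := K))]

/-- The structure map is `f` on each free factor and the identity elsewhere, so each degree reduces
to the restriction rule of its operator; in degree 111 it is the hypothesis `hp`. -/
lemma tensorator_associator {x y : 𝟙_ S ⟶ H ⊗ H} {p : H ⟶ H} {q : K ⟶ K} (hp : p ≫ f = f ≫ q)
    (a : ∀ A B C : Ext K, tensorO (tensorO A B) C ≅ tensorO A (tensorO B C))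
    (ha : ∀ A B C, (total K).map (a A B C).inv =
      assocM (x ≫ (f ⊗ₘ f)) (y ≫ (f ⊗ₘ f)) q A B C)
    (a' : ∀ A B C : Ext H, tensorO (tensorO A B) C ≅ tensorO A (tensorO B C))
    (ha' : ∀ A B C, (total H).map (a' A B C).inv = assocM x y p A B C) (A B C : Ext K) :
    (a' (restrictO f A) (restrictO f B) (restrictO f C)).inv ≫
      tensorM (tensorator f A B) (𝟙 (restrictO f C)) ≫ tensorator f (tensorO A B) C =
    tensorM (𝟙 (restrictO f A)) (tensorator f B C) ≫ tensorator f A (tensorO B C) ≫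
      restrictM f (a A B C).inv := by
  apply total_map_injective
  simp only [Functor.map_comp]
  match A, B, C with
  | .inl A, .inl B, .inl C =>
    have h : (α_ A.X B.X C.X).inv ≫ 𝟙 (A.X ⊗ B.X) ▷ C.X ≫ 𝟙 ((A.X ⊗ B.X) ⊗ C.X) =
        A.X ◁ 𝟙 (B.X ⊗ C.X) ≫ 𝟙 (A.X ⊗ (B.X ⊗ C.X)) ≫ (α_ A.X B.X C.X).inv := by simp
    exact square_congr (ha' ..) (total_tensor_id_inl_inl rfl) rfl (total_id_tensor_inl_inl rfl) rfl
      (total_restrictM_inl f (ha ..)) h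
  | .inl A, .inl B, .inr C =>
    have h : (α_ A.X B.X C).inv ≫ 𝟙 (A.X ⊗ B.X) ▷ C ≫ 𝟙 ((A.X ⊗ B.X) ⊗ C) =
        A.X ◁ 𝟙 (B.X ⊗ C) ≫ 𝟙 (A.X ⊗ (B.X ⊗ C)) ≫ (α_ A.X B.X C).inv := by simp
    exact square_congr (ha' ..) (total_tensor_id_inl_inr rfl) rfl (total_id_tensor_inl_inr rfl) rfl
      (total_restrictM_inr f (ha ..)) h
  | .inr A, .inl B, .inl C =>
    have h : (α_ A B.X C.X).inv ≫ 𝟙 (A ⊗ B.X) ▷ C.X ≫ 𝟙 ((A ⊗ B.X) ⊗ C.X) =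
        A ◁ 𝟙 (B.X ⊗ C.X) ≫ 𝟙 (A ⊗ (B.X ⊗ C.X)) ≫ (α_ A B.X C.X).inv := by simp
    exact square_congr (ha' ..) (total_tensor_id_inr_inl rfl) rfl (total_id_tensor_inr_inl rfl) rfl
      (total_restrictM_inr f (ha ..)) h
  | .inl A, .inr B, .inl C =>
    have h : (gOp x (fuse (f ▷ A.X ≫ act A) (B ⊗ C.X)) (lact A.X (lact B (f ▷ C.X ≫ act C))) ≫
        (α_ A.X B C.X).inv) ≫ 𝟙 (A.X ⊗ B) ▷ C.X ≫ 𝟙 ((A.X ⊗ B) ⊗ C.X) =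
        A.X ◁ 𝟙 (B ⊗ C.X) ≫ 𝟙 (A.X ⊗ (B ⊗ C.X)) ≫
          gOp (x ≫ (f ⊗ₘ f)) (fuse (act A) (B ⊗ C.X)) (lact A.X (lact B (act C))) ≫
            (α_ A.X B C.X).inv := by
      rw [fuse_restrict, lact_restrict, lact_restrict, gOp_restrict]
      simp
    exact square_congr ((ha' ..).trans (assocM_010 ..)) (total_tensor_id_inr_inl rfl) rfl
      (total_id_tensor_inl_inr rfl) rfl (total_restrictM_inr f ((ha ..).trans (assocM_010 ..))) h
  | .inl A, .inr B, .inr C =>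
    have h : (tOp (f ▷ A.X ≫ act A) (B ⊗ C) ≫ H ◁ (α_ A.X B C).inv) ≫ H ◁ 𝟙 (A.X ⊗ B) ▷ C ≫
        f ▷ ((A.X ⊗ B) ⊗ C) = A.X ◁ f ▷ (B ⊗ C) ≫ 𝟙 (A.X ⊗ (K ⊗ (B ⊗ C))) ≫
          tOp (act A) (B ⊗ C) ≫ K ◁ (α_ A.X B C).inv := by
      rw [id_whiskerRight, whiskerLeft_id, Category.id_comp, Category.id_comp, Category.assoc,
        whisker_exchange, tOp_restrict_assoc]
    exact square_congr ((ha' ..).trans (assocM_011 ..)) (total_tensor_id_inr_inr rfl) rfl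
      (total_id_tensor_inl_inl rfl) rfl (total_restrictM_inl f ((ha ..).trans (assocM_011 ..))) h
  | .inr A, .inl B, .inr C =>
    have h : (dOp y (lact A (fuse (f ▷ B.X ≫ act B) C)) ≫ H ◁ (α_ A B.X C).inv) ≫
        H ◁ 𝟙 (A ⊗ B.X) ▷ C ≫ f ▷ ((A ⊗ B.X) ⊗ C) = H ◁ A ◁ 𝟙 (B.X ⊗ C) ≫ f ▷ (A ⊗ (B.X ⊗ C)) ≫
          dOp (y ≫ (f ⊗ₘ f)) (lact A (fuse (act B) C)) ≫ K ◁ (α_ A B.X C).inv := by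
      rw [id_whiskerRight, whiskerLeft_id, Category.id_comp, whiskerLeft_id, whiskerLeft_id,
        Category.id_comp, Category.assoc, whisker_exchange, fuse_restrict, lact_restrict,
        dOp_restrict_assoc]
    exact square_congr ((ha' ..).trans (assocM_101 ..)) (total_tensor_id_inr_inr rfl) rfl
      (total_id_tensor_inr_inr rfl) rfl (total_restrictM_inl f ((ha ..).trans (assocM_101 ..))) h
  | .inr A, .inr B, .inl C =>
    have h : (vOp (lact A (lact B (f ▷ C.X ≫ act C))) ≫ H ◁ (α_ A B C.X).inv ≫
        (α_ H (A ⊗ B) C.X).inv) ≫ f ▷ (A ⊗ B) ▷ C.X ≫ 𝟙 ((K ⊗ (A ⊗ B)) ⊗ C.X) =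
        H ◁ A ◁ 𝟙 (B ⊗ C.X) ≫ f ▷ (A ⊗ (B ⊗ C.X)) ≫ vOp (lact A (lact B (act C))) ≫
          K ◁ (α_ A B C.X).inv ≫ (α_ K (A ⊗ B) C.X).inv := by
      rw [Category.comp_id, whiskerLeft_id, whiskerLeft_id, Category.id_comp, Category.assoc,
        Category.assoc, ← associator_inv_naturality_left, whisker_exchange_assoc, lact_restrict,
        lact_restrict, vOp_restrict_assoc]
    exact square_congr ((ha' ..).trans (assocM_110 ..)) (total_tensor_id_inl_inl rfl) rfl
      (total_id_tensor_inr_inr rfl) rfl (total_restrictM_inl f ((ha ..).trans (assocM_110 ..))) h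
  | .inr A, .inr B, .inr C =>
    have h : (bri H A (B ⊗ C) ≫ p ▷ (A ⊗ (B ⊗ C)) ≫ H ◁ (α_ A B C).inv ≫
        (α_ H (A ⊗ B) C).inv) ≫ f ▷ (A ⊗ B) ▷ C ≫ 𝟙 ((K ⊗ (A ⊗ B)) ⊗ C) =
        A ◁ f ▷ (B ⊗ C) ≫ 𝟙 (A ⊗ (K ⊗ (B ⊗ C))) ≫ bri K A (B ⊗ C) ≫ q ▷ (A ⊗ (B ⊗ C)) ≫
          K ◁ (α_ A B C).inv ≫ (α_ K (A ⊗ B) C).inv := by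
      simp only [Category.assoc]
      rw [Category.comp_id, Category.id_comp, ← associator_inv_naturality_left,
        whisker_exchange_assoc, ← comp_whiskerRight_assoc, hp, comp_whiskerRight_assoc,
        whisker_bri_assoc]
    exact square_congr ((ha' ..).trans (assocM_111 ..)) (total_tensor_id_inl_inr rfl) rfl
      (total_id_tensor_inr_inl rfl) rfl (total_restrictM_inr f ((ha ..).trans (assocM_111 ..))) h

theorem nonempty_monoidal_restrictE [IsIso f] {x y : 𝟙_ S ⟶ H ⊗ H} {p : H ⟶ H} {q : K ⟶ K}
    (hp : p ≫ f = f ≫ q)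
    {a : ∀ A B C : Ext K, tensorO (tensorO A B) C ≅ tensorO A (tensorO B C)}
    (ha : ∀ A B C, (total K).map (a A B C).inv = assocM (x ≫ (f ⊗ₘ f)) (y ≫ (f ⊗ₘ f)) q A B C)
    {l : ∀ A : Ext K, tensorO (unitO K) A ≅ A} (hl : ∀ A, (total K).map (l A).hom = leftUnitorM A)
    {r : ∀ A : Ext K, tensorO A (unitO K) ≅ A} (hr : ∀ A, (total K).map (r A).hom = rightUnitorM A)
    {a' : ∀ A B C : Ext H, tensorO (tensorO A B) C ≅ tensorO A (tensorO B C)}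
    (ha' : ∀ A B C, (total H).map (a' A B C).inv = assocM x y p A B C)
    {l' : ∀ A : Ext H, tensorO (unitO H) A ≅ A}
    (hl' : ∀ A, (total H).map (l' A).hom = leftUnitorM A)
    {r' : ∀ A : Ext H, tensorO A (unitO H) ≅ A}
    (hr' : ∀ A, (total H).map (r' A).hom = rightUnitorM A)
    (M : MonoidalCategory (Ext K)) (hM : M.toMonoidalCategoryStruct = extStruct a l r)
    (M' : MonoidalCategory (Ext H)) (hM' : M'.toMonoidalCategoryStruct = extStruct a' l' r') :
    Nonempty (restrictE f).Monoidal := by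
  obtain @⟨_, h₁, h₂, h₃, h₄, h₅, h₆, h₇, h₈, h₉, h₁₀⟩ := M
  obtain @⟨_, k₁, k₂, k₃, k₄, k₅, k₆, k₇, k₈, k₉, k₁₀⟩ := M'
  cases hM
  cases hM'
  let M : MonoidalCategory (Ext K) := @MonoidalCategory.mk _ _ (extStruct a l r) h₁ h₂ h₃ h₄ h₅ h₆
    h₇ h₈ h₉ h₁₀
  let M' : MonoidalCategory (Ext H) := @MonoidalCategory.mk _ _ (extStruct a' l' r') k₁ k₂ k₃ k₄
    k₅ k₆ k₇ k₈ k₉ k₁₀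
  refine ⟨Functor.CoreMonoidal.toMonoidal
    { εIso := @asIso _ _ _ _ (restrictUnit f) (isIso_restrictUnit f)
      μIso := fun A B => @asIso _ _ _ _ (tensorator f A B) (isIso_tensorator f A B)
      μIso_hom_natural_left := fun {A B} k C => ?_
      μIso_hom_natural_right := fun {A B} C k => ?_
      associativity := fun A B C => ?_
      left_unitality := fun A => tensorator_leftUnitor f l hl l' hl' A
      right_unitality := fun A => tensorator_rightUnitor f r hr r' hr' A }⟩
  · have h := tensorator_natural f k (𝟙 C)
    rwa [show restrictM f (𝟙 C) = 𝟙 _ from (restrictE f).map_id C] at h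
  · have h := tensorator_natural f (𝟙 C) k
    rwa [show restrictM f (𝟙 C) = 𝟙 _ from (restrictE f).map_id C] at h
  · have h := tensorator_associator f hp a ha a' ha' A B C
    have h1 : restrictM f (a A B C).inv ≫ restrictM f (a A B C).hom = 𝟙 _ :=
      ((restrictE f).mapIso (a A B C)).inv_hom_id
    have h2 := (Iso.inv_comp_eq _).1 h
    have h3 := congrArg (· ≫ restrictM f (a A B C).hom) h2
    simp only [Category.assoc] at h3
    refine h3.trans ?_
    erw [h1, Category.comp_id]
    rfl

end RestrictionCoherence

end

end HopfExt

/-! ### The theorem -/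

theorem theorem1 {S : Type u} [Category.{v} S] [MonoidalCategory S] [BraidedCategory S]
    [RightRigidCategory S] [RibbonCategory S]
    (H : S) [HopfObj H] [IsIso (HopfObj.antipode (X := H))]
    (Γ : (Hᘁ : S) ⟶ H) (lam : H ⟶ 𝟙_ S) (g : 𝟙_ S ⟶ H)
    (hadm : HopfExt.IsAdmissible Γ lam g) :
    -- the distinguished element is unique and has a multiplicative inverse
    ((∀ g' : 𝟙_ S ⟶ H, HopfExt.IsDistinguished lam g' → g' = g) ∧
      (∃ gInv : 𝟙_ S ⟶ H, HopfExt.IsMulInverse g gInv)) ∧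
    -- part (i)
    (∃! M : MonoidalCategory (HopfExt.Ext H), HopfExt.IsExtension Γ lam g M) ∧
    -- part (ii)
    (∀ (H' : S) [HopfObj H'] [IsIso (HopfObj.antipode (X := H'))] (φ : H' ≅ H)
      [IsBimonHom φ.hom],
      HopfExt.IsAdmissible (rightAdjointMate φ.inv ≫ Γ ≫ φ.inv) (φ.hom ≫ lam) (g ≫ φ.inv) ∧
      (∃ M' : MonoidalCategory (HopfExt.Ext H'),
        HopfExt.IsExtension (rightAdjointMate φ.inv ≫ Γ ≫ φ.inv) (φ.hom ≫ lam) (g ≫ φ.inv) M') ∧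
      ∀ (M : MonoidalCategory (HopfExt.Ext H)) (M' : MonoidalCategory (HopfExt.Ext H')),
        HopfExt.IsExtension Γ lam g M →
        HopfExt.IsExtension (rightAdjointMate φ.inv ≫ Γ ≫ φ.inv) (φ.hom ≫ lam) (g ≫ φ.inv) M' →
        ∃ e : HopfExt.Ext H ≌ HopfExt.Ext H', Nonempty e.functor.Monoidal) := by
  refine ⟨⟨fun g' hg => hadm.distinguished_unique hg, _, hadm.isMulInverse⟩, ?_,
    fun H' _ _ φ _ => ?_⟩
  · obtain ⟨M, hM⟩ := hadm.exists_isExtension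
    exact ⟨M, hM, fun M' hM' => hM'.unique hM⟩
  · have : IsBimonHom φ.inv := {}
    have hadm' : HopfExt.IsAdmissible (rightAdjointMate φ.inv ≫ Γ ≫ φ.inv) (φ.hom ≫ lam)
        (g ≫ φ.inv) := by
      have : IsBimonHom φ.symm.hom := inferInstanceAs (IsBimonHom φ.inv)
      have : IsBimonHom φ.symm.inv := inferInstanceAs (IsBimonHom φ.hom)
      exact hadm.map φ.symm
    refine ⟨hadm', hadm'.exists_isExtension, fun M M' hM hM' => ?_⟩
    have := HopfExt.restrictE_essSurj φ
    have : (HopfExt.restrictE φ.hom).IsEquivalence := {}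
    refine ⟨(HopfExt.restrictE φ.hom).asEquivalence, ?_⟩
    obtain ⟨a, l, r, hs, ha, hl, hr⟩ := hM
    obtain ⟨a', l', r', hs', ha', hl', hr'⟩ := hM'
    -- Pushing the transported copairing forward along $\varphi$ gives back the original one.
    have hE : HopfExt.copairing (rightAdjointMate φ.inv ≫ Γ ≫ φ.inv) ≫ (φ.hom ⊗ₘ φ.hom) =
        HopfExt.copairing Γ := by
      rw [HopfExt.copairing_map, Category.assoc, MonoidalCategory.tensorHom_comp_tensorHom]
      simp
    -- Restriction along $\varphi:H'\to H$ goes from $C(H)$ to $C(H')$, so the coefficients for `H`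
    -- must be the images under $\varphi$ of those for `H'`.
    refine HopfExt.nonempty_monoidal_restrictE φ.hom (x := HopfExt.gammaOf _)
      (y := HopfExt.deltaOf _ _) (p := HopfExt.phiOf _ _) (q := HopfExt.phiOf Γ lam)
      ?_ ?_ hl hr ha' hl' hr' M hs M' hs'
    · rw [HopfExt.phiOf_eq hadm.isHopfCopairing, HopfExt.phiOf_eq hadm'.isHopfCopairing,
        HopfExt.fourier_map, hE]
    · intro A B C
      rw [HopfExt.gammaOf_eq, HopfExt.deltaOf_eq, HopfExt.gam_map, HopfExt.del_map, hE,
        Category.assoc, Iso.inv_hom_id, Category.comp_id, ← HopfExt.gammaOf_eq,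
        ← HopfExt.deltaOf_eq]
      exact ha A B C
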